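/- All groups and posets are finite. A group is supersolvable if it has a series $1=N_0\le N_1\le\dots\le N_k=G$ of subgroups normal in $G$ with all factors of prime order. The coset poset $\mathfrak C(G)$ is the set of all cosets $Hx$ of proper subgroups $H<G$, ordered by inclusion, and the coset lattice is $\hat{\mathfrak C}(G)=\mathfrak C(G)\cup\{G,\emptyset\}$. $G$ is coset-shellable if the order complex of $\mathfrak C(G)$ (whose faces are the chains of $\mathfrak C(G)$) is shellable: its facets can be ordered $F_1,\dots,F_n$ so that for all $k\ge2$, $F_k\cap\bigcup_{i<k}F_i$ is a nonempty union of facets of $F_k$ (purity is not required). An integer labeling of the cover relations of a poset $P$ is an EL-labeling if every interval has a unique strictly increasing maximal chain and this chain is lexicographically first among the maximal chains of the interval; a coEL-labeling of $P$ is an EL-labeling of the dual of $P$, so that chains are read downwards. $P$ is coEL-shellable if it has a coEL-labeling. \textbf{Theorem.} Let $G$ be a finite group. (1) $G$ is supersolvable with all Sylow subgroups elementary abelian if and only if $G$ is isomorphic to a subgroup of a direct product $G_1\times\dots\times G_r$ of groups of square-free order. (2) Let $\Gamma=G_1\times\dots\times G_r$ with every $|G_i|$ square-free, and identify $G_i$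 with its image in $\Gamma$. For a prime $p$ and $H\le \Gamma$, choose a Sylow $p$-subgroup $H^*$ of $H$, a Sylow $p$-subgroup $G^*\supseteq H^*$ of $\Gamma$, and a generator $e_i$ of $G^*\cap G_i\cong\mathbb Z_p$ for each $i$ with $p\mid |G_i|$. Then $(e_i)$, ordered by $i$, is a basis of the $\mathbb Z_p$-vector space $G^*$. Let $I^p(H)\subseteq\{1,\dots,r\}$ be the set of indices $i$ of the pivot columns of the reduced row echelon form of a matrix whose rows are the coordinate vectors of generators of $H^*$ in this basis. For each $i$ and each prime $p\mid |G_i|$ choose a subgroup $M^*_{p,i}$ of index $p$ in $G_i$, and set $M_{p,i}=M^*_{p,i}\times\prod_{j\ne i}G_j$. Let $l$ be a strictly order-preserving map to the positive integers from the pairs $(p,j)$, $p$ a prime divisor of $|\Gamma|$ and $1\le j\le r$, in lexicographic order. Label the edges of $\hat{\mathfrak C}(\Gamma)$ as follows. If $H_0x$ covers $H_1x$, then $[H_0:H_1]=p$ is prime and $I^p(H_0)=I^p(H_1)\cup\{j\}$ for a unique $j\notin I^p(H_1)$; put $$\lambda(H_0x\to H_1x)=\begin{cases}-l(p,j)&\text{if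 }H_1x=H_0x\cap M_{p,j},\\ \phantom{-}l(p,j)&\text{otherwise,}\end{cases}$$ and put $\lambda(\{x\}\to\emptyset)=0$. Such choices exist, and for all such choices and every embedding of $G$ in $\Gamma$, the restriction of $\lambda$ to $\hat{\mathfrak C}(G)\cong[\emptyset,G]\subseteq\hat{\mathfrak C}(\Gamma)$ is a coEL-labeling of $\hat{\mathfrak C}(G)$. In particular, for $G=\Gamma$, $\lambda$ itself is one. (3) Hence, if $G$ is supersolvable with all Sylow subgroups elementary abelian, then $\hat{\mathfrak C}(G)$ is coEL-shellable and $G$ is coset-shellable. -/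

import Mathlib

open scoped Pointwise

universe u v

/-! ### Group-theoretic notions -/

/-- A group is supersolvable if it has a finite series `1 = N 0 ≤ N 1 ≤ ⋯ ≤ N k = G` of normal
subgroups of `G` with every factor of prime order (such a series is automatically a chief
series). -/
def IsSupersolvable (G : Type*) [Group G] : Prop :=
  ∃ (k : ℕ) (N : ℕ → Subgroup G), N 0 = ⊥ ∧ N k = ⊤ ∧ (∀ i, (N i).Normal) ∧
    ∀ i < k, N i ≤ N (i + 1) ∧ ((N i).relIndex (N (i + 1))).Prime

/-- Every Sylow subgroup is elementary abelian: abelian, of exponent dividing `p`. -/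
def HasElementaryAbelianSylows (G : Type*) [Group G] : Prop :=
  ∀ (p : Nat.Primes) (P : Sylow p G),
    (∀ x ∈ P, ∀ y ∈ P, x * y = y * x) ∧ ∀ x ∈ P, x ^ (p : ℕ) = 1

/-! ### Coset poset and coset lattice -/

/-- The right coset `Hx`. -/
def rightCoset {G : Type*} [Group G] (H : Subgroup G) (x : G) : Set G :=
  (fun h => h * x) '' (H : Set G)

/-- The poset of all cosets of proper subgroups, ordered by inclusion. -/
abbrev CosetPoset (G : Type*) [Group G] : Type _ :=
  {S : Set G // ∃ (H : Subgroup G) (x : G), H ≠ ⊤ ∧ S = rightCoset H x}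

/-- The coset lattice: all cosets of all subgroups, and the empty set, ordered by inclusion. -/
abbrev CosetLattice (G : Type*) [Group G] : Type _ :=
  {S : Set G // S = ∅ ∨ ∃ (H : Subgroup G) (x : G), S = rightCoset H x}

/-! ### Shellability -/

/-- The faces of the order complex of `P` (the empty face included): finite chains of `P`. -/
def orderComplex (P : Type*) [PartialOrder P] : Set (Finset P) :=
  {s | IsChain (· ≤ ·) (s : Set P)}

/-- `F 0, …, F (n - 1)` is a shelling of the simplicial complex with set of faces `Δ`: it lists the
facets without repetition, and for every `k` except the first, the intersection of `F k` (with all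
its faces) with the union of the earlier `F i` is the union of a nonempty family of facets
`F k \ {v}`, `v ∈ A`, of `F k`. -/
def IsShelling {V : Type*} (Δ : Set (Finset V)) {n : ℕ} (F : Fin n → Finset V) : Prop :=
  Function.Injective F ∧ Set.range F = {s | Maximal (· ∈ Δ) s} ∧
    ∀ k : Fin n, 0 < (k : ℕ) → ∃ A : Finset V, A.Nonempty ∧ A ⊆ F k ∧
      {s : Finset V | s ⊆ F k ∧ ∃ i < k, s ⊆ F i} = {s : Finset V | s ⊆ F k ∧ ∃ v ∈ A, v ∉ s}

/-- A poset is shellable if its order complex has a shelling. -/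
def IsShellablePoset (P : Type*) [PartialOrder P] : Prop :=
  ∃ (n : ℕ) (F : Fin n → Finset P), IsShelling (orderComplex P) F

/-- `G` is coset-shellable if its coset poset is shellable. -/
def IsCosetShellable (G : Type*) [Group G] : Prop :=
  IsShellablePoset (CosetPoset G)

/-! ### EL- and coEL-labelings (of finite posets) -/

/-- `c` lists, from bottom to top, a maximal chain of the interval `[x, y]`. -/
def IsMaxChainOn {P : Type*} [PartialOrder P] (x y : P) (c : List P) : Prop :=
  c.head? = some x ∧ c.getLast? = some y ∧ c.IsChain (· ⋖ ·)

/-- The sequence of labels of the cover relations along a chain. -/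
def chainLabels {P : Type*} (lab : P → P → ℤ) (c : List P) : List ℤ :=
  List.zipWith lab c c.tail

/-- `lab` (only its values on cover relations `x ⋖ y` matter) is an EL-labeling: every interval has
a unique strictly increasing maximal chain, and this chain lexicographically precedes all other
maximal chains of the interval. -/
def IsELLabeling {P : Type*} [PartialOrder P] (lab : P → P → ℤ) : Prop :=
  ∀ x y : P, x ≤ y → ∃ c : List P, IsMaxChainOn x y c ∧ (chainLabels lab c).Pairwise (· < ·) ∧
    ∀ d : List P, IsMaxChainOn x y d → d ≠ c →
      ¬ (chainLabels lab d).Pairwise (· < ·) ∧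
        List.Lex (· < ·) (chainLabels lab c) (chainLabels lab d)

/-- A coEL-labeling of `P` is an EL-labeling of the dual of `P`; here `lab a b` is the label of the
edge from `a` down to `b`. -/
def IsCoELLabeling {P : Type*} [PartialOrder P] (lab : P → P → ℤ) : Prop :=
  IsELLabeling (P := Pᵒᵈ) fun a b => lab (OrderDual.ofDual a) (OrderDual.ofDual b)

/-- A poset is coEL-shellable if it has a coEL-labeling. -/
def IsCoELShellable (P : Type*) [PartialOrder P] : Prop :=
  ∃ lab : P → P → ℤ, IsCoELLabeling lab

/-! ### Pivots -/

/-- The first nonzero coordinate of `v` is in position `j`. -/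
def IsLeading {ι R : Type*} [LinearOrder ι] [Zero R] (v : ι → R) (j : ι) : Prop :=
  v j ≠ 0 ∧ ∀ i < j, v i = 0

/-- Reduced row echelon form. -/
structure IsRREF {ι R : Type*} [LinearOrder ι] [Zero R] [One R] {k : ℕ}
    (M : Matrix (Fin k) ι R) : Prop where
  lead_eq_one : ∀ a j, IsLeading (M a) j → M a j = 1
  lead_col : ∀ a j, IsLeading (M a) j → ∀ b, b ≠ a → M b j = 0
  lead_lt : ∀ a b i j, a < b → IsLeading (M a) i → IsLeading (M b) j → i < j
  zero_below : ∀ a b, a < b → M a = 0 → M b = 0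

/-- For a set `S` of coordinate vectors over a field, the set of pivot columns of the matrix in
reduced row echelon form whose rows span the same subspace as `S`. -/
def pivotColumns {ι R : Type*} [LinearOrder ι] [CommRing R] (S : Set (ι → R)) : Set ι :=
  {j | ∃ (k : ℕ) (M : Matrix (Fin k) ι R), IsRREF M ∧
    Submodule.span R (Set.range M) = Submodule.span R S ∧ ∃ a, IsLeading (M a) j}

/-- The choices made in computing `I^p(H)` for a subgroup `H` of `G₁ × ⋯ × G_r`: a Sylow
`p`-subgroup `G*` of the product, a Sylow `p`-subgroup `H*` of `H` contained in `G*`, and a generator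
`e i` of `G* ∩ G_i` for each `i` with `p ∣ |G_i|`. -/
structure PivotData {r : ℕ} (Γ : Fin r → Type*) [∀ i, Group (Γ i)] (p : Nat.Primes)
    (H : Subgroup (∀ i, Γ i)) where
  Gstar : Sylow p (∀ i, Γ i)
  Hstar : Sylow p H
  Hstar_le : (Hstar : Subgroup H).map H.subtype ≤ (Gstar : Subgroup (∀ i, Γ i))
  e : ∀ i : {i : Fin r // (p : ℕ) ∣ Nat.card (Γ i)}, Γ i
  zpowers_e : ∀ i, Subgroup.zpowers (MonoidHom.mulSingle Γ i.1 (e i)) =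
    (Gstar : Subgroup (∀ i, Γ i)) ⊓ (MonoidHom.mulSingle Γ i.1).range

/-- The coordinate vectors over `ℤ/p`, with respect to the basis `(e i)` of `G*`, of the elements of
`H*`: the coordinates `α` of `h` are given by `h = ∏ i, e i ^ α i`. -/
def PivotData.coords {r : ℕ} {Γ : Fin r → Type*} [∀ i, Group (Γ i)] {p : Nat.Primes}
    {H : Subgroup (∀ i, Γ i)} (D : PivotData Γ p H) :
    Set ({i : Fin r // (p : ℕ) ∣ Nat.card (Γ i)} → ZMod p) :=
  {α | ∃ h ∈ (D.Hstar : Subgroup H), ∀ i : Fin r, (h : ∀ i, Γ i) i =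
    if hi : (p : ℕ) ∣ Nat.card (Γ i) then D.e ⟨i, hi⟩ ^ (α ⟨i, hi⟩).val else 1}

/-- The invariant `I^p(H)`, a set of indices of factors. -/
def PivotData.pivots {r : ℕ} {Γ : Fin r → Type*} [∀ i, Group (Γ i)] {p : Nat.Primes}
    {H : Subgroup (∀ i, Γ i)} (D : PivotData Γ p H) : Set (Fin r) :=
  Subtype.val '' pivotColumns D.coords

/-! ### The labeling -/

/-- All choices made in the labeling of the coset lattice of `G₁ × ⋯ × G_r`: the choices in the
invariants `I^p(H)`, subgroups `M*_{p,i}` of index `p` in `G_i` for each prime `p` dividing `|G_i|`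
(values at other pairs are irrelevant), and a strictly order preserving map `l` to the positive
integers from the pairs `(p, j)`, `p` a prime divisor of `|G₁ × ⋯ × G_r|`, in lexicographic order. -/
structure LabelingData {r : ℕ} (Γ : Fin r → Type*) [∀ i, Group (Γ i)] where
  pivot : ∀ (p : Nat.Primes) (H : Subgroup (∀ i, Γ i)), PivotData Γ p H
  Mstar : ∀ (_ : Nat.Primes) (i : Fin r), Subgroup (Γ i)
  index_Mstar : ∀ (p : Nat.Primes) (i : Fin r),
    (p : ℕ) ∣ Nat.card (Γ i) → (Mstar p i).index = p
  l : Nat.Primes → Fin r → ℕ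
  l_pos : ∀ (p : Nat.Primes) (j : Fin r), (p : ℕ) ∣ Nat.card (∀ i, Γ i) → 0 < l p j
  l_lt : ∀ (p q : Nat.Primes) (i j : Fin r), (p : ℕ) ∣ Nat.card (∀ i, Γ i) →
    (q : ℕ) ∣ Nat.card (∀ i, Γ i) → ((p : ℕ) < q ∨ p = q ∧ i < j) → l p i < l q j

namespace LabelingData

variable {r : ℕ} {Γ : Fin r → Type*} [∀ i, Group (Γ i)] (D : LabelingData Γ)

/-- `I^p(H)`. -/
def I (p : Nat.Primes) (H : Subgroup (∀ i, Γ i)) : Set (Fin r) :=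
  (D.pivot p H).pivots

/-- The distinguished maximal subgroup `M_{p,j} = M*_{p,j} × ∏_{i ≠ j} G_i`. -/
def M (p : Nat.Primes) (j : Fin r) : Subgroup (∀ i, Γ i) :=
  (D.Mstar p j).comap (Pi.evalMonoidHom Γ j)

/-- For a cover `A = H₀x ⊋ B = H₁x` the pair `t = (p, j)` satisfies `[H₀ : H₁] = p` and
`I^p(H₀) = I^p(H₁) ∪ {j}` with `j ∉ I^p(H₁)`. The subgroup `H` is recovered from a right coset `Hx`
as its stabilizer under left translation. -/
def IsType (A B : Set (∀ i, Γ i)) (t : Nat.Primes × Fin r) : Prop :=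
  (MulAction.stabilizer (∀ i, Γ i) B).relIndex (MulAction.stabilizer (∀ i, Γ i) A) = t.1 ∧
    t.2 ∉ D.I t.1 (MulAction.stabilizer (∀ i, Γ i) B) ∧
    D.I t.1 (MulAction.stabilizer (∀ i, Γ i) A) =
      D.I t.1 (MulAction.stabilizer (∀ i, Γ i) B) ∪ {t.2}

open Classical in
/-- The label of the edge from the coset `A` down to `B`: it is `0` if `B` is empty, and for a cover
of type `(p, j)` it is `-l(p, j)` if `B = A ∩ M_{p,j}` and `l(p, j)` otherwise. (A pair `A`, `B`
has at most one type, and the last branch never occurs for a cover of cosets.) -/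
noncomputable def label (A B : Set (∀ i, Γ i)) : ℤ :=
  if B = ∅ then 0
  else if h : ∃ t, D.IsType A B t then
    if B = A ∩ (D.M h.choose.1 h.choose.2 : Set (∀ i, Γ i)) then -(D.l h.choose.1 h.choose.2 : ℤ)
    else (D.l h.choose.1 h.choose.2 : ℤ)
  else 0

/-- The labeling of the coset lattice of `G` obtained by restriction along a homomorphism `φ` of `G`
into `G₁ × ⋯ × G_r`; for injective `φ` it identifies the coset lattice of `G` with the interval
from `∅` to `φ(G)`. -/
noncomputable def labelVia {G : Type*} [Group G] (φ : G →* ∀ i, Γ i) (A B : CosetLattice G) : ℤ :=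
  D.label (φ '' A.1) (φ '' B.1)

end LabelingData

/-! The product `Γ` has a descending normal series, running through the primes in increasing order
and, for each prime, through the coordinates. Its factor at `(p, j)` is trivial or of order `p`, and
in the latter case `M_{p,j}` complements it. A subgroup `H` is recorded by the set `J H` of
positions at which it induces a nontrivial factor, and `I^p(H)` is the part of `J H` at `p`,
whatever choices are made (`PivotData.mem_pivots_iff`). Comparable subgroups with equal `J`
coincide, so a cover of cosets removes exactly one position. All of this pulls back along an
injection (`ComplementedSeries.comap`), so one abstract labeled series (`IsLabel`) handles `Γ` and
its subgroups alike.

By `IsLocalEL.isELLabeling` it suffices to find in each interval a first step with strictly least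
label, after which labels rise, while after every other first step some next label fails to rise.
From `Hx` down to `H₁x`, a label `-l t` is possible only if `H₁x ⊆ M t`. If some missing position
`t` satisfies this, the largest one gives the first step `Hx ∩ M t`; any other step either leaves
this edge available or removes `t` differently, and then a label at most `l t` must follow. If there
is none, all labels are positive and the least missing position goes first, in the only possible
way. Down to `∅`, the largest position of `J H` is cut out first.

For shellability, maximal chains are sorted by label word. A chain that does not take the
distinguished step towards its next meeting point with an earlier chain has one element that can be
exchanged for a smaller word (`IsLocalEL.exists_exchange`).

Subgroups of `Γ` inherit the series and the Sylow structure. Conversely, for `x ≠ 1` let `N` be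
maximal among normal subgroups avoiding `x`. Then `G/N` has a unique minimal normal subgroup `Z`, of
prime order. It lies in the normal Sylow subgroup for the largest prime and equals it by a Maschke
argument; Schur–Zassenhaus makes `Z` its own centralizer, and the quotient by `Z` embeds in the
cyclic group `Aut Z`. So `G/N` has square-free order, and these quotients separate points. -/

/-! ### A local criterion for EL-labelings -/

/-- A local criterion for EL-labelings: each interval `[x, y]` has an atom with the strictly smallest
label, labels strictly increase after this atom, and need not increase after any other atom. -/
def IsLocalEL {P : Type*} [PartialOrder P] (lab : P → P → ℤ) : Prop :=
  ∀ x y : P, x < y → ∃ a, x ⋖ a ∧ a ≤ y ∧ (∀ b, a ⋖ b → b ≤ y → lab x a < lab a b) ∧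
    ∀ a', x ⋖ a' → a' ≤ y → a' ≠ a → lab x a < lab x a' ∧ ∃ b, a' ⋖ b ∧ b ≤ y ∧ lab a' b ≤ lab x a'

section MaxChain

variable {P : Type*} [PartialOrder P]

theorem isMaxChainOn_singleton (x : P) : IsMaxChainOn x x [x] := by
  simp [IsMaxChainOn]

theorem IsMaxChainOn.cons {x a y : P} {c : List P} (hxa : x ⋖ a) (h : IsMaxChainOn a y c) :
    IsMaxChainOn x y (x :: c) := by
  obtain ⟨h1, h2, h3⟩ := h
  cases c with
  | nil => simp at h1
  | cons b c =>
    simp only [List.head?_cons, Option.some.injEq] at h1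
    subst h1
    exact ⟨rfl, by simpa using h2, List.isChain_cons_cons.2 ⟨hxa, h3⟩⟩

theorem IsMaxChainOn.le {x y : P} {c : List P} (h : IsMaxChainOn x y c) :
    ∀ z ∈ c, x ≤ z ∧ z ≤ y := by
  induction c generalizing x with
  | nil => simp
  | cons b c ih =>
    obtain ⟨h1, h2, h3⟩ := h
    simp only [List.head?_cons, Option.some.injEq] at h1
    subst h1
    cases c with
    | nil => simp at h2; subst h2; simp
    | cons a c =>
      obtain ⟨hba, h3⟩ := List.isChain_cons_cons.1 h3
      have key := ih (x := a) ⟨rfl, by simpa using h2, h3⟩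
      intro z hz
      rcases List.mem_cons.1 hz with rfl | hz
      · exact ⟨le_rfl, hba.le.trans (key a (by simp)).2⟩
      · exact ⟨hba.le.trans (key z hz).1, (key z hz).2⟩

/-- A maximal chain is a singleton or starts with a cover relation. -/
theorem IsMaxChainOn.cases {x y : P} {c : List P} (h : IsMaxChainOn x y c) :
    (x = y ∧ c = [x]) ∨ ∃ a c', x ⋖ a ∧ a ≤ y ∧ c = x :: a :: c' ∧ IsMaxChainOn a y (a :: c') := by
  obtain ⟨h1, h2, h3⟩ := h
  cases c with
  | nil => simp at h1
  | cons b c =>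
    simp only [List.head?_cons, Option.some.injEq] at h1
    subst h1
    cases c with
    | nil => left; simpa using h2
    | cons a c =>
      right
      obtain ⟨hba, h3⟩ := List.isChain_cons_cons.1 h3
      have hm : IsMaxChainOn a y (a :: c) := ⟨rfl, by simpa using h2, h3⟩
      exact ⟨a, c, hba, (hm.le a (by simp)).2, rfl, hm⟩

theorem IsMaxChainOn.head_mem {x y : P} {c : List P} (h : IsMaxChainOn x y c) : x ∈ c :=
  List.mem_of_mem_head? h.1

theorem IsMaxChainOn.last_mem {x y : P} {c : List P} (h : IsMaxChainOn x y c) : y ∈ c :=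
  List.mem_of_mem_getLast? h.2.1

theorem IsMaxChainOn.eq_singleton {x : P} {c : List P} (h : IsMaxChainOn x x c) : c = [x] := by
  rcases h.cases with h | ⟨a, c', hxa, hay, -⟩
  · exact h.2
  · exact absurd hay hxa.lt.not_ge

theorem IsMaxChainOn.pairwise {x y : P} {c : List P} (h : IsMaxChainOn x y c) :
    c.Pairwise (· < ·) :=
  List.isChain_iff_pairwise.1 (h.2.2.imp fun _ _ h => h.lt)

theorem IsMaxChainOn.append {x y z : P} {c d : List P} (h : IsMaxChainOn x y c)
    (hd : IsMaxChainOn y z (y :: d)) : IsMaxChainOn x z (c ++ d) := by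
  induction c generalizing x with
  | nil => simp [IsMaxChainOn] at h
  | cons b c ih =>
    rcases h.cases with ⟨rfl, hc⟩ | ⟨a, c', hxa, hay, hc, hm⟩
    · rw [hc]; exact hd
    · obtain ⟨rfl, rfl⟩ := List.cons.inj hc
      exact (ih hm).cons hxa

theorem exists_isMaxChainOn [Finite P] {x y : P} (h : x ≤ y) : ∃ c, IsMaxChainOn x y c := by
  induction x using WellFoundedGT.induction with
  | ind x ih =>
    rcases h.eq_or_lt with rfl | h
    · exact ⟨_, isMaxChainOn_singleton x⟩
    · obtain ⟨a, hxa, hay⟩ := exists_covBy_le_of_lt h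
      obtain ⟨c, hc⟩ := ih a hxa.lt hay
      exact ⟨_, hc.cons hxa⟩

@[simp] theorem chainLabels_cons_cons {P : Type*} (lab : P → P → ℤ) (x a : P) (c : List P) :
    chainLabels lab (x :: a :: c) = lab x a :: chainLabels lab (a :: c) := rfl

@[simp] theorem chainLabels_singleton {P : Type*} (lab : P → P → ℤ) (x : P) : chainLabels lab [x] = [] := rfl

theorem IsLocalEL.isELLabeling [Finite P] {lab : P → P → ℤ} (h : IsLocalEL lab) :
    IsELLabeling lab := by
  intro x y hxy
  induction x using WellFoundedGT.induction with
  | ind x ih =>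
    rcases hxy.eq_or_lt with rfl | hlt
    · exact ⟨[x], isMaxChainOn_singleton x, by simp, fun d hd hne => absurd hd.eq_singleton hne⟩
    obtain ⟨a, hxa, hay, hab, huniq⟩ := h x y hlt
    obtain ⟨c, hc, hinc, hc'⟩ := ih a hxa.lt hay
    have hcx := hc.cons hxa
    have hex : ∃ c₀, c = a :: c₀ := by
      rcases hc.cases with ⟨-, rfl⟩ | ⟨b, c', -, -, rfl, -⟩ <;> exact ⟨_, rfl⟩
    refine ⟨x :: c, hcx, ?_, ?_⟩
    · rcases hc.cases with ⟨-, rfl⟩ | ⟨b, c', hab', hby, rfl, -⟩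
      · simp
      · rw [chainLabels_cons_cons]
        rw [chainLabels_cons_cons] at hinc ⊢
        exact List.isChain_iff_pairwise.1
          (List.isChain_cons_cons.2 ⟨hab b hab' hby, List.isChain_iff_pairwise.2 hinc⟩)
    · intro d hd hne
      rcases hd.cases with ⟨rfl, -⟩ | ⟨a', d', hxa', ha'y, rfl, hd'⟩
      · exact absurd hlt (lt_irrefl _)
      obtain ⟨c₀, rfl⟩ := hex
      rw [chainLabels_cons_cons, chainLabels_cons_cons]
      by_cases haa : a' = a
      · subst haa
        have := hc' _ hd' (fun h => hne (by rw [h]))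
        exact ⟨fun hp => this.1 (List.pairwise_cons.1 hp).2, List.Lex.cons this.2⟩
      · obtain ⟨hlt', b, hb, hby, hle⟩ := huniq a' hxa' ha'y haa
        refine ⟨fun hp => ?_, List.Lex.rel hlt'⟩
        obtain ⟨hp1, hp2⟩ := List.pairwise_cons.1 hp
        -- If `d` were increasing, its tail would be the increasing chain of `[a', y]`, which is
        -- lexicographically first there. Its first label would then be at most `lab a' b ≤ lab x
        -- a'`.
        obtain ⟨c₂, -, hinc₂, huniq₂⟩ := ih a' hxa'.lt ha'y
        have hdc : a' :: d' = c₂ := by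
          by_contra hne'
          exact (huniq₂ _ hd' hne').1 hp2
        subst hdc
        obtain ⟨e, he⟩ := exists_isMaxChainOn hby
        rcases hd'.cases with ⟨rfl, -⟩ | ⟨w, d₂, -, -, hd₂, -⟩
        · exact absurd hby hb.lt.not_ge
        obtain ⟨-, rfl⟩ := List.cons.inj hd₂
        have hw : lab a' w ≤ lab a' b := by
          obtain ⟨e', rfl⟩ : ∃ e', e = b :: e' := by
            rcases he.cases with ⟨-, rfl⟩ | ⟨_, _, -, -, rfl, -⟩ <;> exact ⟨_, rfl⟩
          by_cases heq : a' :: b :: e' = a' :: w :: d₂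
          · simp only [List.cons.injEq, true_and] at heq
            rw [heq.1]
          · have := (huniq₂ _ (he.cons hb) heq).2
            rw [chainLabels_cons_cons, chainLabels_cons_cons] at this
            rcases List.cons_lex_cons_iff.1 this with h | h
            · exact h.le
            · exact h.1.le
        have := hp1 (lab a' w) (by simp)
        omega

/-! ### Shellability from the local criterion -/

/-- Walking up the chain, an element comparable with all members cannot be skipped: it would lie
strictly inside a cover. This is what makes the chains facets. -/
theorem IsMaxChainOn.mem_of_forall_comparable {x y z : P} {c : List P} (h : IsMaxChainOn x y c)
    (hxz : x ≤ z) (hzy : z ≤ y) (hz : ∀ u ∈ c, u ≤ z ∨ z ≤ u) : z ∈ c := by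
  induction c generalizing x with
  | nil => simp [IsMaxChainOn] at h
  | cons b c ih =>
    rcases h.cases with ⟨rfl, hc⟩ | ⟨a, c', hxa, hay, hc, hm⟩
    · rw [hc, le_antisymm hzy hxz]; simp
    · obtain ⟨rfl, rfl⟩ := List.cons.inj hc
      rcases hxz.eq_or_lt with rfl | hlt
      · simp
      rcases hz a (by simp) with haz | hza
      · exact List.mem_cons_of_mem _ (ih hm haz fun u hu => hz u (List.mem_cons_of_mem _ hu))
      · rcases hza.eq_or_lt with rfl | hza
        · simp
        · exact absurd hza (hxa.2 hlt)

theorem IsMaxChainOn.eq_of_mem_iff {x y : P} {c d : List P} (hc : IsMaxChainOn x y c)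
    (hd : IsMaxChainOn x y d) (h : ∀ z, z ∈ c ↔ z ∈ d) : c = d :=
  List.Perm.eq_of_pairwise (le := fun a b => a < b)
    (fun _ _ _ _ h1 h2 => absurd h1 h2.not_gt) hc.pairwise hd.pairwise
    ((List.perm_ext_iff_of_nodup (hc.pairwise.imp fun h => h.ne)
      (hd.pairwise.imp fun h => h.ne)).2 h)

theorem exists_isMaxChainOn_of_isChain [Finite P] {x y : P} (hxy : x ≤ y) (S : Finset P)
    (hS : IsChain (· ≤ ·) (S : Set P)) (hxS : ∀ z ∈ S, x ≤ z ∧ z ≤ y) :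
    ∃ c, IsMaxChainOn x y c ∧ ∀ z ∈ S, z ∈ c := by
  classical
  induction hn : S.card generalizing x S with
  | zero =>
    obtain ⟨c, hc⟩ := exists_isMaxChainOn hxy
    exact ⟨c, hc, by simp [Finset.card_eq_zero.1 hn]⟩
  | succ n ih =>
    obtain ⟨m, hm⟩ := S.exists_minimal (Finset.card_pos.1 (by omega))
    have hmS : ∀ z ∈ S, m ≤ z := fun z hz => by
      rcases hS.total hm.1 hz with h | h
      · exact h
      · exact hm.2 hz h
    obtain ⟨d, hd, hd'⟩ := ih (hxS m hm.1).2 (S.erase m)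
      (hS.mono (by simp)) (fun z hz => ⟨hmS z (Finset.mem_of_mem_erase hz),
        (hxS z (Finset.mem_of_mem_erase hz)).2⟩) (by rw [Finset.card_erase_of_mem hm.1, hn]; rfl)
    obtain ⟨c, hc⟩ := exists_isMaxChainOn (hxS m hm.1).1
    obtain ⟨d', rfl⟩ : ∃ d', d = m :: d' := by
      rcases hd.cases with ⟨-, rfl⟩ | ⟨_, _, -, -, rfl, -⟩ <;> exact ⟨_, rfl⟩
    refine ⟨c ++ d', hc.append hd, fun z hz => ?_⟩
    by_cases hzm : z = m
    · subst hzm; exact List.mem_append_left _ hc.last_mem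
    · have := hd' z (Finset.mem_erase.2 ⟨hzm, hz⟩)
      rw [List.mem_cons] at this
      exact List.mem_append_right _ (this.resolve_left hzm)

/-- Either the chain `d` starts towards `z` with the smallest atom, or one of its elements below `z`
can be exchanged to obtain a lexicographically smaller chain. -/
theorem exists_exchange_below [Finite P] {lab : P → P → ℤ} (α : ∀ x y : P, x < y → P)
    (hα : ∀ x y (h : x < y), x ⋖ α x y h ∧ α x y h ≤ y ∧
      ∀ a', x ⋖ a' → a' ≤ y → a' ≠ α x y h →
        lab x (α x y h) < lab x a' ∧ ∃ b, a' ⋖ b ∧ b ≤ y ∧ lab a' b ≤ lab x a')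
    (hα' : ∀ x y (h : x < y), ∀ b, α x y h ⋖ b → b ≤ y → lab x (α x y h) < lab (α x y h) b)
    {x y z : P} {d : List P} (hd : IsMaxChainOn x y d) (hz : z ∈ d) (hxz : x < z) :
    (∃ d', d = x :: α x z hxz :: d') ∨
      ∃ v ∈ d, x < v ∧ v < z ∧ ∃ e, IsMaxChainOn x y e ∧ chainLabels lab e < chainLabels lab d ∧
        ∀ u ∈ d, u ≠ v → u ∈ e := by
  induction d generalizing x with
  | nil => simp at hz
  | cons x' d ih =>
    rcases hd.cases with ⟨rfl, hc⟩ | ⟨b, d, hxb, hby, hc, hm⟩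
    · rw [hc, List.mem_singleton] at hz
      exact absurd hz hxz.ne'
    obtain ⟨rfl, rfl⟩ := List.cons.inj hc
    have hzd : z ∈ b :: d := (List.mem_cons.1 hz).resolve_left hxz.ne'
    have hbz : b ≤ z := (hm.le z hzd).1
    by_cases hb : b = α x' z hxz
    · exact Or.inl ⟨d, by rw [← hb]⟩
    obtain ⟨-, b', hbb', hb'z, hle⟩ := (hα x' z hxz).2.2 b hxb hbz hb
    have hbz' : b < z := hbb'.lt.trans_le hb'z
    right
    rcases ih hm hzd hbz' with ⟨d', hd'⟩ | ⟨v, hv, hbv, hvz, e, he, hlt, hue⟩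
    · obtain ⟨-, rfl⟩ := List.cons.inj hd'
      set w := α b z hbz' with hw
      have hbw : b ⋖ w := (hα b z hbz').1
      have hwz : w ≤ z := (hα b z hbz').2.1
      -- The chain has a descent at `b`. Hence `b` is not the distinguished atom of `[x', w]`, and
      -- replacing `b` by a chain through that atom lowers the first label while keeping `w` and
      -- everything above it.
      have hle' : lab b w ≤ lab x' b := by
        by_cases h : b' = w
        · rwa [← h]
        · exact ((hα b z hbz').2.2 b' hbb' hb'z h).1.le.trans hle
      have hxw : x' < w := hxb.lt.trans hbw.lt
      have hne : b ≠ α x' w hxw := fun h => by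
        have := hα' x' w hxw w (h ▸ hbw) le_rfl
        rw [← h] at this
        omega
      have hlt := ((hα x' w hxw).2.2 b hxb hbw.le hne).1
      obtain ⟨c, hc⟩ := exists_isMaxChainOn (hα x' w hxw).2.1
      obtain ⟨c', rfl⟩ : ∃ c', c = α x' w hxw :: c' := by
        rcases hc.cases with ⟨-, rfl⟩ | ⟨_, _, -, -, rfl, -⟩ <;> exact ⟨_, rfl⟩
      have hw' : IsMaxChainOn w y (w :: d') := by
        rcases hm.cases with ⟨rfl, -⟩ | ⟨a, _, -, -, h, hm'⟩
        · exact absurd hby (hbw.lt.trans_le (hm.le w (by simp)).2).not_ge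
        · obtain ⟨-, h⟩ := List.cons.inj h
          obtain ⟨rfl, rfl⟩ := List.cons.inj h
          exact hm'
      refine ⟨b, by simp, hxb.lt, hbz', _, (hc.append hw').cons (hα x' w hxw).1, ?_, ?_⟩
      · rw [List.cons_append, chainLabels_cons_cons, chainLabels_cons_cons]
        exact List.Lex.rel hlt
      · intro u hu hub
        simp only [List.mem_cons] at hu
        rcases hu with rfl | rfl | rfl | hu
        · simp
        · exact absurd rfl hub
        · exact List.mem_cons_of_mem _ (List.mem_append_left _ hc.last_mem)
        · exact List.mem_cons_of_mem _ (List.mem_append_right _ hu)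
    · refine ⟨v, List.mem_cons_of_mem _ hv, hxb.lt.trans hbv, hvz, _, he.cons hxb, ?_, ?_⟩
      · obtain ⟨e', rfl⟩ : ∃ e', e = b :: e' := by
          rcases he.cases with ⟨-, rfl⟩ | ⟨_, _, -, -, rfl, -⟩ <;> exact ⟨_, rfl⟩
        rw [chainLabels_cons_cons, chainLabels_cons_cons]
        exact List.Lex.cons hlt
      · intro u hu huv
        rcases List.mem_cons.1 hu with rfl | hu
        · simp
        · exact List.mem_cons_of_mem _ (hue u hu huv)

/-- This is the shelling condition for chains. After the common initial part, let `z` be the first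
element of `d` that lies on `c` again and apply `exists_exchange_below` towards `z`; the exchanged
element lies strictly before `z`, hence off `c`. Equal label words are allowed for `c` and `d`,
since `e` is strictly smaller in any case. -/
theorem IsLocalEL.exists_exchange [Finite P] {lab : P → P → ℤ} (h : IsLocalEL lab) {x y : P}
    {c d : List P} (hc : IsMaxChainOn x y c) (hd : IsMaxChainOn x y d) (hne : c ≠ d)
    (hle : ¬ chainLabels lab d < chainLabels lab c) :
    ∃ v ∈ d, v ∉ c ∧ ∃ e, IsMaxChainOn x y e ∧ chainLabels lab e < chainLabels lab d ∧
      ∀ u ∈ d, u ≠ v → u ∈ e := by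
  induction d generalizing x c with
  | nil => simp [IsMaxChainOn] at hd
  | cons x' d ih =>
    rcases hd.cases with ⟨rfl, hd'⟩ | ⟨b, d, hxb, hby, hd', hm⟩
    · exact absurd (hc.eq_singleton.trans hd'.symm) hne
    obtain ⟨rfl, rfl⟩ := List.cons.inj hd'
    rcases hc.cases with ⟨rfl, -⟩ | ⟨a, c, hxa, hay, rfl, hcm⟩
    · exact absurd hby hxb.lt.not_ge
    rw [chainLabels_cons_cons, chainLabels_cons_cons] at hle
    by_cases hab : a = b
    · subst hab
      obtain ⟨v, hv, hvc, e, he, hlt, hue⟩ := ih hcm hm (fun h => hne (by rw [h]))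
        (fun h => hle (List.Lex.cons h))
      refine ⟨v, List.mem_cons_of_mem _ hv, ?_, _, he.cons hxa, ?_, ?_⟩
      · rw [List.mem_cons, not_or]
        exact ⟨(hxa.lt.trans_le (hm.le v hv).1).ne', hvc⟩
      · obtain ⟨e', rfl⟩ : ∃ e', e = a :: e' := by
          rcases he.cases with ⟨-, rfl⟩ | ⟨_, _, -, -, rfl, -⟩ <;> exact ⟨_, rfl⟩
        rw [chainLabels_cons_cons, chainLabels_cons_cons]
        exact List.Lex.cons hlt
      · intro u hu huv
        rcases List.mem_cons.1 hu with rfl | hu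
        · simp
        · exact List.mem_cons_of_mem _ (hue u hu huv)
    · classical
      choose α hα using h
      let S := (b :: d).toFinset.filter (· ∈ a :: c)
      obtain ⟨z, hz⟩ := S.exists_minimal ⟨y, by
        simpa [S] using And.intro (List.mem_cons.1 hm.last_mem) (List.mem_cons.1 hcm.last_mem)⟩
      obtain ⟨hz1, hz2⟩ : z ∈ b :: d ∧ z ∈ a :: c := by simpa [S] using hz.1
      have hxz : x' < z := hxb.lt.trans_le (hm.le z hz1).1
      rcases exists_exchange_below α (fun x y h => ⟨(hα x y h).1, (hα x y h).2.1, (hα x y h).2.2.2⟩)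
        (fun x y h => (hα x y h).2.2.1) hd (List.mem_cons_of_mem _ hz1) hxz with
        ⟨d', hd'⟩ | ⟨v, hv, hxv, hvz, e, he⟩
      -- If `d` begins with the distinguished atom of `[x', z]`, its word precedes that of `c`,
      -- which begins with another atom below `z`.
      · obtain ⟨-, hd'⟩ := List.cons.inj hd'
        obtain ⟨rfl, -⟩ := List.cons.inj hd'
        exact absurd (List.Lex.rel ((hα x' z hxz).2.2.2 a hxa (hcm.le z hz2).1 hab).1) hle
      · refine ⟨v, hv, fun hvc => ?_, e, he⟩
        have hv1 : v ∈ b :: d := (List.mem_cons.1 hv).resolve_left hxv.ne'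
        have hv2 : v ∈ a :: c := (List.mem_cons.1 hvc).resolve_left hxv.ne'
        have hvS : v ∈ S := Finset.mem_filter.2 ⟨List.mem_toFinset.2 hv1, hv2⟩
        exact absurd hvz (hz.2 hvS hvz.le).not_gt

/-- If `P` is bounded and satisfies the local criterion, its proper part `Q` is shellable; the order
of `Q` is that of its image in `P` or the reverse. -/
theorem IsLocalEL.isShellablePoset {P Q : Type*} [PartialOrder P] [BoundedOrder P] [Finite P]
    [PartialOrder Q] {lab : P → P → ℤ} (h : IsLocalEL lab) (f : Q → P)
    (hf : Function.Injective f) (hrange : ∀ z, z ∈ Set.range f ↔ z ≠ ⊥ ∧ z ≠ ⊤)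
    (hcomp : ∀ a b, (a ≤ b ∨ b ≤ a) ↔ (f a ≤ f b ∨ f b ≤ f a)) : IsShellablePoset Q := by
  classical
  have : Finite Q := Finite.of_injective f hf
  have := Fintype.ofFinite Q
  let L := {c : List P // IsMaxChainOn ⊥ ⊤ c}
  have : Finite L := Finite.of_injective (fun c : L => {z | z ∈ c.1}) fun c d hcd =>
    Subtype.ext (c.2.eq_of_mem_iff d.2 fun z => Set.ext_iff.1 hcd z)
  let fac : L → Finset Q := fun c => Finset.univ.filter fun q => f q ∈ c.1
  have mem_fac : ∀ c q, q ∈ fac c ↔ f q ∈ c.1 := fun c q => by simp [fac]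
  have hmem : ∀ (c d : L), (∀ q, f q ∈ c.1 → f q ∈ d.1) → ∀ z ∈ c.1, z ∈ d.1 := by
    intro c d hcd z hz
    by_cases hzb : z ≠ ⊥ ∧ z ≠ ⊤
    · obtain ⟨q, rfl⟩ := (hrange z).2 hzb
      exact hcd q hz
    · rw [not_and_or, not_not, not_not] at hzb
      rcases hzb with rfl | rfl
      exacts [d.2.head_mem, d.2.last_mem]
  have fac_inj : Function.Injective fac := fun c d hcd => by
    have : ∀ q, f q ∈ c.1 ↔ f q ∈ d.1 := fun q => by rw [← mem_fac, ← mem_fac, hcd]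
    exact Subtype.ext (c.2.eq_of_mem_iff d.2 fun z =>
      ⟨hmem c d (fun q => (this q).1) z, hmem d c (fun q => (this q).2) z⟩)
  have chain_iff : ∀ s : Set Q, IsChain (· ≤ ·) s ↔ IsChain (· ≤ ·) (f '' s) := by
    intro s
    constructor
    · rintro hs _ ⟨a, ha, rfl⟩ _ ⟨b, hb, rfl⟩ hne
      exact (hcomp a b).1 (hs ha hb fun h => hne (by rw [h]))
    · intro hs a ha b hb hne
      exact (hcomp a b).2 (hs ⟨a, ha, rfl⟩ ⟨b, hb, rfl⟩ fun h => hne (hf h))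
  have list_chain : ∀ c : L, IsChain (· ≤ ·) {z | z ∈ c.1} := fun c a ha b hb hne => by
    obtain ⟨i, hi, rfl⟩ := List.mem_iff_getElem.1 ha
    obtain ⟨j, hj, rfl⟩ := List.mem_iff_getElem.1 hb
    rcases lt_trichotomy i j with hij | rfl | hij
    · exact Or.inl (List.pairwise_iff_getElem.1 c.2.pairwise i j hi hj hij).le
    · exact absurd rfl hne
    · exact Or.inr (List.pairwise_iff_getElem.1 c.2.pairwise j i hj hi hij).le
  have fac_chain : ∀ c, fac c ∈ orderComplex Q := fun c => by
    refine (chain_iff _).2 ((list_chain c).mono ?_)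
    rintro _ ⟨q, hq, rfl⟩
    exact (mem_fac c q).1 hq
  have fac_max : ∀ c, Maximal (· ∈ orderComplex Q) (fac c) := fun c => by
    refine ⟨fac_chain c, fun t ht hct q hq => (mem_fac c q).2 ?_⟩
    refine c.2.mem_of_forall_comparable bot_le le_top fun u hu => ?_
    by_cases hub : u ≠ ⊥ ∧ u ≠ ⊤
    · obtain ⟨q', rfl⟩ := (hrange u).2 hub
      exact (hcomp q' q).1 (ht.total (hct ((mem_fac c q').2 hu)) hq)
    · rw [not_and_or, not_not, not_not] at hub
      rcases hub with rfl | rfl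
      exacts [Or.inl bot_le, Or.inr le_top]
  have fac_surj : ∀ s, Maximal (· ∈ orderComplex Q) s → ∃ c, fac c = s := fun s hs => by
    obtain ⟨c, hc, hcs⟩ := exists_isMaxChainOn_of_isChain (bot_le (a := (⊤ : P))) (s.image f)
      (by rw [Finset.coe_image]; exact (chain_iff _).1 hs.1) fun z _ => ⟨bot_le, le_top⟩
    refine ⟨⟨c, hc⟩, (hs.eq_of_le (fac_chain ⟨c, hc⟩) fun q hq => ?_).symm⟩
    exact (mem_fac _ q).2 (hcs _ (Finset.mem_image_of_mem f hq))
  let e := Finite.equivFin L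
  let key : Fin (Nat.card L) → List ℤ := fun i => chainLabels lab (e.symm i).1
  -- Chains with the same label word may come in any order.
  let σ := Tuple.sort key
  have hσ : Monotone (key ∘ σ) := Tuple.monotone_sort key
  refine ⟨Nat.card L, fun i => fac (e.symm (σ i)),
    fac_inj.comp (e.symm.injective.comp σ.injective), ?_, ?_⟩
  · ext s
    constructor
    · rintro ⟨i, rfl⟩
      exact fac_max _
    · intro hs
      obtain ⟨c, rfl⟩ := fac_surj s hs
      exact ⟨σ.symm (e c), by simp⟩
  · intro k hk
    have key_lemma : ∀ i < k, ∃ v ∈ fac (e.symm (σ k)), v ∉ fac (e.symm (σ i)) ∧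
        ∃ j < k, (fac (e.symm (σ k))).erase v ⊆ fac (e.symm (σ j)) := by
      intro i hik
      have hle : key (σ i) ≤ key (σ k) := hσ hik.le
      obtain ⟨v, hv, hvc, e', he', hlt, hue⟩ := h.exists_exchange (e.symm (σ i)).2
        (e.symm (σ k)).2 (fun h => hik.ne (σ.injective (e.symm.injective (Subtype.ext h))))
        (not_lt.2 hle)
      obtain ⟨q, rfl⟩ := (hrange v).2 ⟨fun h => hvc (h ▸ (e.symm (σ i)).2.head_mem),
        fun h => hvc (h ▸ (e.symm (σ i)).2.last_mem)⟩
      have hj : e.symm (σ (σ.symm (e ⟨e', he'⟩))) = ⟨e', he'⟩ := by simp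
      refine ⟨q, (mem_fac _ q).2 hv, fun h => hvc ((mem_fac _ q).1 h), σ.symm (e ⟨e', he'⟩), ?_, ?_⟩
      · by_contra hjk
        have : key (σ k) ≤ key (σ (σ.symm (e ⟨e', he'⟩))) := hσ (not_lt.1 hjk)
        refine absurd this (not_le.2 ?_)
        simp only [key, hj]
        exact hlt
      · rw [hj]
        intro u hu
        rw [Finset.mem_erase] at hu
        exact (mem_fac _ u).2 (hue _ ((mem_fac _ u).1 hu.2) fun h => hu.1 (hf h))
    -- The vertices to remove are those whose deletion leaves a face of an earlier facet.
    refine ⟨(fac (e.symm (σ k))).filter fun v =>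
      ∃ j < k, (fac (e.symm (σ k))).erase v ⊆ fac (e.symm (σ j)), ?_, Finset.filter_subset _ _, ?_⟩
    · obtain ⟨v, hv, -, hj⟩ := key_lemma ⟨0, hk.trans k.2⟩ hk
      exact ⟨v, Finset.mem_filter.2 ⟨hv, hj⟩⟩
    · ext s
      simp only [Set.mem_ofPred_eq, and_congr_right_iff, Finset.mem_filter]
      intro hs
      constructor
      · rintro ⟨i, hik, hsi⟩
        obtain ⟨v, hv, hvi, hj⟩ := key_lemma i hik
        exact ⟨v, ⟨hv, hj⟩, fun h => hvi (hsi h)⟩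
      · rintro ⟨v, ⟨-, j, hjk, hj⟩, hvs⟩
        exact ⟨j, hjk, fun u hu => hj (Finset.mem_erase.2 ⟨fun h => hvs (h ▸ hu), hs hu⟩)⟩

end MaxChain

/-! ### Normal series with complemented factors -/

/-- A descending normal series `N` each of whose factors `N k / N (k + 1)` is trivial or has prime
order and, in the latter case, is complemented by `M k`. -/
structure ComplementedSeries (G : Type*) [Group G] where
  N : ℕ → Subgroup G
  M : ℕ → Subgroup G
  length : ℕ
  antitone_N : Antitone N
  N_zero : N 0 = ⊤
  N_length : N length = ⊥
  normal : ∀ k, (N k).Normal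
  -- The three conditions on `M k` are vacuous when `N k = N (k + 1)`, so `M k` is arbitrary there.
  -- Prime order enters through the last one: every nontrivial element of the factor supplements `M
  -- k`.
  le_M : ∀ k g, g ∈ N k → g ∉ N (k + 1) → N (k + 1) ≤ M k
  inf_le : ∀ k, M k ⊓ N k ≤ N (k + 1)
  exists_zpow_mul_mem : ∀ k g, g ∈ N k → g ∉ N (k + 1) → ∀ x, ∃ m : ℤ, g ^ m * x ∈ M k

namespace ComplementedSeries

variable {G : Type*} [Group G] (C : ComplementedSeries G)

/-- The positions at which the series induces a nontrivial factor in `H`. -/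
def J (H : Subgroup G) : Set ℕ := {k | ∃ h ∈ H, h ∈ C.N k ∧ h ∉ C.N (k + 1)}

/-- The pullback of a complemented series along an injective homomorphism. -/
def comap {G' : Type*} [Group G'] (φ : G' →* G) (hφ : Function.Injective φ) :
    ComplementedSeries G' where
  N k := (C.N k).comap φ
  M k := (C.M k).comap φ
  length := C.length
  antitone_N _ _ h := Subgroup.comap_mono (C.antitone_N h)
  N_zero := by rw [C.N_zero, Subgroup.comap_top]
  N_length := by
    rw [C.N_length]
    exact (MonoidHom.ker_eq_bot_iff φ).2 hφ
  normal k := (C.normal k).comap φ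
  le_M k g h1 h2 := Subgroup.comap_mono (C.le_M k (φ g) h1 h2)
  inf_le k _ h := C.inf_le k ⟨h.1, h.2⟩
  exists_zpow_mul_mem k g h1 h2 x := by
    obtain ⟨m, hm⟩ := C.exists_zpow_mul_mem k (φ g) h1 h2 (φ x)
    exact ⟨m, by simpa using hm⟩

theorem J_comap {G' : Type*} [Group G'] (φ : G' →* G) (hφ : Function.Injective φ)
    (H : Subgroup G') : (C.comap φ hφ).J H = C.J (H.map φ) := by
  ext k
  simp [J, comap]

variable {C}

theorem lt_length {H : Subgroup G} {k : ℕ} (hk : k ∈ C.J H) : k < C.length := by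
  obtain ⟨h, -, h1, h2⟩ := hk
  by_contra hlt
  have := C.antitone_N (not_lt.1 hlt) h1
  rw [C.N_length, Subgroup.mem_bot] at this
  exact h2 (this ▸ one_mem _)

theorem finite_J (H : Subgroup G) : (C.J H).Finite :=
  (Set.finite_lt_nat C.length).subset fun _ => lt_length

theorem J_mono {H₁ H₀ : Subgroup G} (h : H₁ ≤ H₀) : C.J H₁ ⊆ C.J H₀ :=
  fun _ ⟨g, hg, hk⟩ => ⟨g, h hg, hk⟩

/-- The power of `g` that moves `x` into `M k` moves it into `M k ⊓ N k ≤ N (k + 1)`; so every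
nontrivial element generates the factor. -/
theorem exists_zpow_mul_mem_succ {k : ℕ} {g x : G} (hg : g ∈ C.N k) (hg' : g ∉ C.N (k + 1))
    (hx : x ∈ C.N k) : ∃ m : ℤ, g ^ m * x ∈ C.N (k + 1) := by
  obtain ⟨m, hm⟩ := C.exists_zpow_mul_mem k g hg hg' x
  exact ⟨m, C.inf_le k ⟨hm, mul_mem (zpow_mem hg m) hx⟩⟩

/-- If `H₁ ≤ H₀` have the same positions from `k` on, they agree in `N k`. -/
theorem inf_N_le {H₁ H₀ : Subgroup G} (h : H₁ ≤ H₀) (k : ℕ)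
    (hJ : ∀ s ∈ C.J H₀, k ≤ s → s ∈ C.J H₁) : H₀ ⊓ C.N k ≤ H₁ := by
  rintro x ⟨hx, hxk⟩
  induction hd : C.length - k generalizing k x with
  | zero =>
    have := C.antitone_N (Nat.sub_eq_zero_iff_le.1 hd) hxk
    rw [C.N_length, Subgroup.mem_bot] at this
    exact this ▸ one_mem _
  | succ d ih =>
    have ih' : ∀ x ∈ H₀, x ∈ C.N (k + 1) → x ∈ H₁ := fun x hx hxk =>
      ih (k + 1) (fun s hs hks => hJ s hs (by omega)) hx hxk (by omega)
    by_cases hx' : x ∈ C.N (k + 1)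
    · exact ih' x hx hx'
    · obtain ⟨g, hg, hgn, hgn'⟩ := hJ k ⟨x, hx, hxk, hx'⟩ le_rfl
      obtain ⟨m, hm⟩ := exists_zpow_mul_mem_succ hgn hgn' hxk
      have := ih' _ (mul_mem (zpow_mem (h hg) m) hx) hm
      exact (Subgroup.mul_mem_cancel_left _ (zpow_mem hg m)).1 this

/-- The case `k = 0` of `inf_N_le`. It turns questions about comparable subgroups into questions
about sets of positions. -/
theorem eq_of_J_subset {H₁ H₀ : Subgroup G} (h : H₁ ≤ H₀) (hJ : C.J H₀ ⊆ C.J H₁) : H₁ = H₀ := by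
  refine le_antisymm h fun x hx => inf_N_le h 0 (fun s hs _ => hJ hs) ⟨hx, ?_⟩
  rw [C.N_zero]
  trivial

/-- The subgroup `H₁ (H₀ ∩ N k)`. -/
def mid (C : ComplementedSeries G) (H₁ H₀ : Subgroup G) (k : ℕ) : Subgroup G := H₁ ⊔ (H₀ ⊓ C.N k)

theorem mid_le {H₁ H₀ : Subgroup G} (h : H₁ ≤ H₀) (k : ℕ) : C.mid H₁ H₀ k ≤ H₀ :=
  sup_le h inf_le_left

theorem le_mid (H₁ H₀ : Subgroup G) (k : ℕ) : H₁ ≤ C.mid H₁ H₀ k := le_sup_left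

/-- Multiplying by elements of `N k` does not change classes at positions before `k`, while from `k`
on the group contains all of `H₀ ⊓ N k`. -/
theorem mem_J_mid {H₁ H₀ : Subgroup G} (h : H₁ ≤ H₀) {k s : ℕ} :
    s ∈ C.J (C.mid H₁ H₀ k) ↔ s ∈ C.J H₁ ∨ s ∈ C.J H₀ ∧ k ≤ s := by
  constructor
  · intro hs
    by_cases hks : k ≤ s
    · exact Or.inr ⟨J_mono (mid_le h k) hs, hks⟩
    · obtain ⟨x, hx, hxs, hxs'⟩ := hs
      have hx' : x ∈ H₁ ⊔ C.N k := sup_le_sup_left inf_le_right H₁ hx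
      have := C.normal k
      obtain ⟨y, hy, n, hn, rfl⟩ := Subgroup.mem_sup_of_normal_right.1 hx'
      have hns : n ∈ C.N (s + 1) := C.antitone_N (by omega) hn
      have hns' : n ∈ C.N s := C.antitone_N (by omega) hns
      exact Or.inl ⟨y, hy, (Subgroup.mul_mem_cancel_right _ hns').1 hxs,
        fun h => hxs' (mul_mem h hns)⟩
  · rintro (hs | ⟨⟨x, hx, hxs, hxs'⟩, hks⟩)
    · exact J_mono (le_mid _ _ _) hs
    · exact ⟨x, (le_sup_right : _ ≤ C.mid H₁ H₀ k) ⟨hx, C.antitone_N hks hxs⟩, hxs, hxs'⟩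

theorem mid_eq {H₁ H₀ : Subgroup G} (h : H₁ ≤ H₀) {k : ℕ}
    (hJ : ∀ s ∈ C.J H₀, s ∉ C.J H₁ → k ≤ s) : C.mid H₁ H₀ k = H₀ :=
  eq_of_J_subset (mid_le h k) fun s hs =>
    (mem_J_mid h).2 <| or_iff_not_imp_left.2 fun hs' => ⟨hs, hJ s hs hs'⟩

/-- Position `t` is lost because `M t ⊓ N t ≤ N (t + 1)`. A witness for `s < t` is moved into `M t`
by a power of an element of `H ⊓ N t`, invisible at `s`; a witness for `s > t` lies in `N (t + 1) ≤
M t` already. -/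
theorem mem_J_inf_M {H : Subgroup G} {t s : ℕ} (ht : t ∈ C.J H) :
    s ∈ C.J (H ⊓ C.M t) ↔ s ∈ C.J H ∧ s ≠ t := by
  constructor
  · intro hs
    refine ⟨J_mono inf_le_left hs, ?_⟩
    rintro rfl
    obtain ⟨x, hx, hxs, hxs'⟩ := hs
    exact hxs' (C.inf_le _ ⟨hx.2, hxs⟩)
  · rintro ⟨⟨x, hx, hxs, hxs'⟩, hst⟩
    obtain ⟨g, hg, hgt, hgt'⟩ := ht
    rcases lt_or_gt_of_ne hst with hlt | hlt
    · obtain ⟨m, hm⟩ := C.exists_zpow_mul_mem t g hgt hgt' x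
      have hgs : g ^ m ∈ C.N (s + 1) := C.antitone_N (by omega) (zpow_mem hgt m)
      refine ⟨g ^ m * x, ⟨mul_mem (zpow_mem hg m) hx, hm⟩,
        mul_mem (C.antitone_N (by omega) hgs) hxs, fun h => hxs' ?_⟩
      exact (Subgroup.mul_mem_cancel_left _ hgs).1 h
    · exact ⟨x, ⟨hx, C.le_M t g hgt hgt' (C.antitone_N (by omega) hxs)⟩, hxs, hxs'⟩

/-- If `H₁` is missing only positions after `t` and lies in `M t`, then `H₀` lies in `M t`. -/
theorem le_M_of_J {H₁ H₀ : Subgroup G} (h : H₁ ≤ H₀) {t : ℕ} {g : G} (hg : g ∈ C.N t)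
    (hg' : g ∉ C.N (t + 1)) (hM : H₁ ≤ C.M t) (hJ : ∀ s ∈ C.J H₀, s ∉ C.J H₁ → t < s) :
    H₀ ≤ C.M t := by
  rw [← mid_eq h hJ]
  exact sup_le hM (inf_le_right.trans (C.le_M t g hg hg'))

/-- A pair of subgroups with no subgroup strictly between them differs in a single position. -/
theorem exists_J_eq_insert {H₁ H₀ : Subgroup G} (h : H₁ < H₀)
    (hcov : ∀ K, H₁ ≤ K → K ≤ H₀ → K = H₁ ∨ K = H₀) :
    ∃ t, t ∉ C.J H₁ ∧ C.J H₀ = insert t (C.J H₁) := by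
  have hne : ∃ t, t ∈ C.J H₀ ∧ t ∉ C.J H₁ := by
    by_contra! hno
    exact h.ne (eq_of_J_subset h.le hno)
  classical
  obtain ⟨ht0, ht1⟩ := Nat.find_spec hne
  set t := Nat.find hne with ht
  refine ⟨t, ht1, Set.Subset.antisymm (fun s hs => ?_)
    (Set.insert_subset ht0 (J_mono h.le))⟩
  by_contra hs'
  rw [Set.mem_insert_iff, not_or] at hs'
  have hts : t < s := lt_of_le_of_ne (Nat.find_min' hne ⟨hs, hs'.2⟩) (Ne.symm hs'.1)
  -- A second new position `s` would place `H₁ (H₀ ∩ N (t + 1))` strictly between: it has `s` but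
  -- lacks the least new position `t`.
  rcases hcov _ (le_mid (C := C) H₁ H₀ (t + 1)) (mid_le h.le _) with hK | hK
  · apply hs'.2
    rw [← hK]
    exact (mem_J_mid h.le).2 (Or.inr ⟨hs, hts⟩)
  · have := hK ▸ ht0
    rcases (mem_J_mid h.le).1 this with h' | h'
    · exact ht1 h'
    · omega

theorem eq_or_eq_of_J_eq_insert {H₁ H₀ K : Subgroup G} {t : ℕ}
    (hJ : C.J H₀ = insert t (C.J H₁)) (h1 : H₁ ≤ K) (h0 : K ≤ H₀) : K = H₁ ∨ K = H₀ := by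
  by_cases ht : t ∈ C.J K
  · exact Or.inr (eq_of_J_subset (C := C) h0 (hJ ▸ Set.insert_subset ht (J_mono h1)))
  · refine Or.inl (eq_of_J_subset (C := C) h1 fun s hs => ?_).symm
    have := J_mono h0 hs
    rw [hJ] at this
    exact this.resolve_left fun h => ht (h ▸ hs)

end ComplementedSeries

/-! ### Cosets -/

section Cosets

variable {G : Type*} [Group G]

theorem mem_rightCoset_iff_mul_inv {H : Subgroup G} {x y : G} : y ∈ rightCoset H x ↔ y * x⁻¹ ∈ H := by
  constructor
  · rintro ⟨h, hh, rfl⟩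
    simpa using hh
  · intro h
    exact ⟨y * x⁻¹, h, by simp⟩

theorem self_mem_rightCoset (H : Subgroup G) (x : G) : x ∈ rightCoset H x := by
  simp [mem_rightCoset_iff_mul_inv]

theorem rightCoset_eq_of_mem {H : Subgroup G} {x y : G} (h : y ∈ rightCoset H x) :
    rightCoset H x = rightCoset H y := by
  ext z
  rw [mem_rightCoset_iff_mul_inv] at h
  rw [mem_rightCoset_iff_mul_inv, mem_rightCoset_iff_mul_inv,
    ← Subgroup.mul_mem_cancel_right H h (y := z * y⁻¹)]
  simp [mul_assoc]

theorem rightCoset_subset_iff {H K : Subgroup G} {x : G} :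
    rightCoset H x ⊆ rightCoset K x ↔ H ≤ K := by
  refine ⟨fun h g hg => ?_, fun h => Set.image_mono h⟩
  have := h (mem_rightCoset_iff_mul_inv.2 (by simpa using hg) : g * x ∈ rightCoset H x)
  simpa [mem_rightCoset_iff_mul_inv] using this

theorem rightCoset_subset_subgroup_iff {H M : Subgroup G} {x : G} (hx : x ∈ M) :
    rightCoset H x ⊆ (M : Set G) ↔ H ≤ M := by
  rw [← rightCoset_subset_iff (x := x)]
  suffices rightCoset M x = M by rw [this]
  ext y
  rw [mem_rightCoset_iff_mul_inv, SetLike.mem_coe, Subgroup.mul_mem_cancel_right _ (inv_mem hx)]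

theorem rightCoset_inter {H M : Subgroup G} {x : G} (hx : x ∈ M) :
    rightCoset H x ∩ M = rightCoset (H ⊓ M) x := by
  ext y
  simp only [Set.mem_inter_iff, mem_rightCoset_iff_mul_inv, Subgroup.mem_inf, SetLike.mem_coe,
    Subgroup.mul_mem_cancel_right _ (inv_mem hx)]

theorem stabilizer_rightCoset (H : Subgroup G) (x : G) :
    MulAction.stabilizer G (rightCoset H x) = H := by
  ext g
  rw [MulAction.mem_stabilizer_iff]
  constructor
  · intro h
    have : g • x ∈ g • rightCoset H x := Set.smul_mem_smul_set (self_mem_rightCoset H x)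
    rw [h, mem_rightCoset_iff_mul_inv] at this
    simpa using this
  · intro hg
    ext y
    rw [Set.mem_smul_set_iff_inv_smul_mem, mem_rightCoset_iff_mul_inv, mem_rightCoset_iff_mul_inv, smul_eq_mul, mul_assoc,
      Subgroup.mul_mem_cancel_left _ (inv_mem hg)]

/-- The coset `Hx` as an element of the coset lattice. -/
def toCosetLattice (H : Subgroup G) (x : G) : CosetLattice G := ⟨rightCoset H x, Or.inr ⟨H, x, rfl⟩⟩

/-- The smallest element of the coset lattice. -/
def emptyCoset (G : Type*) [Group G] : CosetLattice G := ⟨∅, Or.inl rfl⟩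

theorem emptyCoset_le (a : CosetLattice G) : emptyCoset G ≤ a := Set.empty_subset _

theorem toCosetLattice_le_iff {H K : Subgroup G} {x : G} :
    toCosetLattice H x ≤ toCosetLattice K x ↔ H ≤ K := rightCoset_subset_iff

theorem eq_emptyCoset_or (a : CosetLattice G) : a = emptyCoset G ∨ ∃ x, x ∈ a.1 := by
  rcases a.1.eq_empty_or_nonempty with h | h
  · exact Or.inl (Subtype.ext h)
  · exact Or.inr h

theorem eq_toCosetLattice {a : CosetLattice G} {x : G} (hx : x ∈ a.1) :
    ∃ H, a = toCosetLattice H x := by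
  rcases a.2 with h | ⟨H, y, h⟩
  · rw [h] at hx; exact hx.elim
  · exact ⟨H, Subtype.ext (h.trans (rightCoset_eq_of_mem (h ▸ hx)))⟩

theorem toCosetLattice_eq_of_mem {H : Subgroup G} {x y : G} (h : y ∈ rightCoset H x) :
    toCosetLattice H x = toCosetLattice H y := Subtype.ext (rightCoset_eq_of_mem h)

theorem toCosetLattice_covBy {H₁ H₀ : Subgroup G} {x : G} (h : H₁ < H₀)
    (hcov : ∀ K, H₁ ≤ K → K ≤ H₀ → K = H₁ ∨ K = H₀) :
    toCosetLattice H₁ x ⋖ toCosetLattice H₀ x := by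
  refine ⟨lt_iff_le_not_ge.2 ⟨toCosetLattice_le_iff.2 h.le, fun h' =>
    h.not_ge (toCosetLattice_le_iff.1 h')⟩, fun c hc1 hc2 => ?_⟩
  obtain ⟨K, rfl⟩ := eq_toCosetLattice (hc1.le (self_mem_rightCoset H₁ x))
  rcases hcov K (toCosetLattice_le_iff.1 hc1.le) (toCosetLattice_le_iff.1 hc2.le) with rfl | rfl
  exacts [lt_irrefl _ hc1, lt_irrefl _ hc2]

theorem of_covBy_toCosetLattice {a : CosetLattice G} {H₀ : Subgroup G} {x : G}
    (h : a ⋖ toCosetLattice H₀ x) (hx : x ∈ a.1) : ∃ H₁, a = toCosetLattice H₁ x ∧ H₁ < H₀ ∧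
      ∀ K, H₁ ≤ K → K ≤ H₀ → K = H₁ ∨ K = H₀ := by
  obtain ⟨H₁, rfl⟩ := eq_toCosetLattice hx
  have hlt : H₁ < H₀ := lt_iff_le_not_ge.2 ⟨toCosetLattice_le_iff.1 h.1.le, fun h' =>
    h.1.not_ge (toCosetLattice_le_iff.2 h')⟩
  refine ⟨H₁, rfl, hlt, fun K h1 h0 => ?_⟩
  by_contra! hK
  exact h.2 (lt_iff_le_not_ge.2 ⟨toCosetLattice_le_iff.2 h1, fun h' =>
      hK.1 (le_antisymm (toCosetLattice_le_iff.1 h') h1)⟩)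
    (lt_iff_le_not_ge.2 ⟨toCosetLattice_le_iff.2 h0, fun h' =>
      hK.2 (le_antisymm h0 (toCosetLattice_le_iff.1 h'))⟩)

theorem emptyCoset_covBy_singleton (x : G) : emptyCoset G ⋖ toCosetLattice ⊥ x := by
  refine ⟨lt_iff_le_not_ge.2 ⟨emptyCoset_le _, fun h => h (self_mem_rightCoset _ x)⟩,
    fun c hc1 hc2 => ?_⟩
  rcases eq_emptyCoset_or c with rfl | ⟨y, hy⟩
  · exact lt_irrefl _ hc1
  · have hyx := hc2.le hy
    have : y = x := by
      simpa [toCosetLattice, mem_rightCoset_iff_mul_inv, mul_inv_eq_one] using hyx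
    subst this
    obtain ⟨K, rfl⟩ := eq_toCosetLattice hy
    exact hc2.not_ge (toCosetLattice_le_iff.2 bot_le)

end Cosets

/-! ### Labels on the edges of the coset lattice -/

namespace ComplementedSeries

variable {G : Type*} [Group G] {C : ComplementedSeries G}

/-- The label of an edge of the coset lattice is `± l t`, where `t` is the position at which the two
subgroups differ; it is negative if the smaller coset is cut out by the complement `M t`. -/
structure IsLabel (C : ComplementedSeries G) (l : ℕ → ℤ) (lab : Set G → Set G → ℤ) : Prop where
  pos : ∀ t ∈ C.J ⊤, 0 < l t
  lt : ∀ s ∈ C.J ⊤, ∀ t ∈ C.J ⊤, s < t → l s < l t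
  empty : ∀ A, lab A ∅ = 0
  cover : ∀ H₁ H₀ x t, H₁ ≤ H₀ → t ∉ C.J H₁ → C.J H₀ = insert t (C.J H₁) →
    (rightCoset H₁ x = rightCoset H₀ x ∩ C.M t ∧ lab (rightCoset H₀ x) (rightCoset H₁ x) = -l t) ∨
    (rightCoset H₁ x ≠ rightCoset H₀ x ∩ C.M t ∧ lab (rightCoset H₀ x) (rightCoset H₁ x) = l t)

theorem covBy_of_J_eq_insert {H₁ H₀ : Subgroup G} {t : ℕ} (x : G) (h : H₁ ≤ H₀)
    (ht : t ∉ C.J H₁) (hJ : C.J H₀ = insert t (C.J H₁)) :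
    toCosetLattice H₁ x ⋖ toCosetLattice H₀ x := by
  refine toCosetLattice_covBy (lt_of_le_of_ne h ?_) fun K h1 h0 => eq_or_eq_of_J_eq_insert hJ h1 h0
  rintro rfl
  exact ht (hJ ▸ Set.mem_insert _ _)

theorem J_eq_insert_inf_M {H : Subgroup G} {t : ℕ} (ht : t ∈ C.J H) :
    t ∉ C.J (H ⊓ C.M t) ∧ C.J H = insert t (C.J (H ⊓ C.M t)) := by
  refine ⟨fun h => ((mem_J_inf_M ht).1 h).2 rfl, ?_⟩
  ext s
  rw [Set.mem_insert_iff, mem_J_inf_M ht]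
  by_cases hs : s = t
  · subst hs; simpa using ht
  · simp [hs]

theorem J_eq_insert_mid {H₁ H₀ : Subgroup G} (h : H₁ ≤ H₀) {t : ℕ} (ht : t ∈ C.J H₀)
    (ht' : t ∉ C.J H₁) (hmin : ∀ s ∈ C.J H₀, s ∉ C.J H₁ → t ≤ s) :
    t ∉ C.J (C.mid H₁ H₀ (t + 1)) ∧ C.J H₀ = insert t (C.J (C.mid H₁ H₀ (t + 1))) := by
  refine ⟨fun h' => ?_, ?_⟩
  · rcases (mem_J_mid h).1 h' with h' | h'
    · exact ht' h'
    · omega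
  · ext s
    rw [Set.mem_insert_iff, mem_J_mid h]
    constructor
    · intro hs
      by_cases hs1 : s ∈ C.J H₁
      · exact Or.inr (Or.inl hs1)
      · have := hmin s hs hs1
        rcases this.eq_or_lt with rfl | hlt
        · exact Or.inl rfl
        · exact Or.inr (Or.inr ⟨hs, hlt⟩)
    · rintro (rfl | hs | hs)
      exacts [ht, J_mono h hs, hs.1]

/-- Multiplying on the left by powers of an element of `H` stays inside `Hx` and reaches `M t`.
Hence `Hx ∩ M t` is again a coset, and every coset of `H` has a negative edge of type `t`. -/
theorem exists_mem_rightCoset_M {H : Subgroup G} {x : G} {t : ℕ} (ht : t ∈ C.J H) :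
    ∃ y ∈ rightCoset H x, y ∈ C.M t := by
  obtain ⟨g, hg, hgt, hgt'⟩ := ht
  obtain ⟨m, hm⟩ := C.exists_zpow_mul_mem t g hgt hgt' x
  exact ⟨_, mem_rightCoset_iff_mul_inv.2 (by simpa using zpow_mem hg m), hm⟩

namespace IsLabel

variable {l : ℕ → ℤ} {lab : Set G → Set G → ℤ} (hl : C.IsLabel l lab)
include hl

theorem pos' {H : Subgroup G} {t : ℕ} (ht : t ∈ C.J H) : 0 < l t := hl.pos t (J_mono le_top ht)

theorem lt' {H : Subgroup G} {s t : ℕ} (hs : s ∈ C.J H) (ht : t ∈ C.J H) (h : s < t) : l s < l t :=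
  hl.lt s (J_mono le_top hs) t (J_mono le_top ht) h

end IsLabel
end ComplementedSeries

namespace ComplementedSeries.IsLabel

variable {G : Type*} [Group G] {C : ComplementedSeries G} {l : ℕ → ℤ} {lab : Set G → Set G → ℤ}
  (hl : C.IsLabel l lab)
include hl

/-- The edge cut out by `M t`. -/
theorem neg_edge {H : Subgroup G} {x : G} {t : ℕ} (ht : t ∈ C.J H) (hx : x ∈ C.M t) :
    toCosetLattice (H ⊓ C.M t) x ⋖ toCosetLattice H x ∧
      lab (rightCoset H x) (rightCoset (H ⊓ C.M t) x) = -l t := by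
  obtain ⟨h1, h2⟩ := J_eq_insert_inf_M ht
  refine ⟨covBy_of_J_eq_insert x inf_le_left h1 h2, ?_⟩
  rcases hl.cover _ _ x t inf_le_left h1 h2 with h | h
  · exact h.2
  · exact absurd (rightCoset_inter hx).symm h.1

/-- Every coset has an edge to below with a nonpositive label. -/
theorem exists_nonpos_edge (H : Subgroup G) (x : G) :
    ∃ b, b ⋖ toCosetLattice H x ∧ lab (rightCoset H x) b.1 ≤ 0 := by
  rcases (C.J H).eq_empty_or_nonempty with h | ⟨t, ht⟩
  · obtain rfl : ⊥ = H := eq_of_J_subset (C := C) bot_le (by simp [h])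
    exact ⟨_, emptyCoset_covBy_singleton x, (hl.empty _).le⟩
  · obtain ⟨y, hy, hyM⟩ := exists_mem_rightCoset_M (x := x) ht
    obtain ⟨h1, h2⟩ := hl.neg_edge ht hyM
    rw [toCosetLattice_eq_of_mem hy, rightCoset_eq_of_mem hy]
    exact ⟨_, h1, h2.trans_le (by have := hl.pos' ht; omega)⟩

/-- The edge towards `H₁` of the smallest type, if `H₁` and `H` differ from position `t` on. -/
theorem mid_edge {H₁ H : Subgroup G} (h : H₁ ≤ H) (x : G) {t : ℕ} (ht : t ∈ C.J H)
    (ht' : t ∉ C.J H₁) (hmin : ∀ s ∈ C.J H, s ∉ C.J H₁ → t ≤ s) :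
    toCosetLattice (C.mid H₁ H (t + 1)) x ⋖ toCosetLattice H x ∧
      toCosetLattice H₁ x ≤ toCosetLattice (C.mid H₁ H (t + 1)) x ∧
      lab (rightCoset H x) (rightCoset (C.mid H₁ H (t + 1)) x) ≤ l t := by
  obtain ⟨h1, h2⟩ := J_eq_insert_mid h ht ht' hmin
  refine ⟨covBy_of_J_eq_insert x (mid_le h _) h1 h2,
    toCosetLattice_le_iff.2 (le_mid _ _ _), ?_⟩
  have := hl.pos' ht
  rcases hl.cover _ _ x t (mid_le h _) h1 h2 with h | h <;> omega

theorem edge {H : Subgroup G} {x : G} {a : CosetLattice G} (ha : a ⋖ toCosetLattice H x)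
    (hx : x ∈ a.1) : ∃ H' t, a = toCosetLattice H' x ∧ H' ≤ H ∧ t ∉ C.J H' ∧
      C.J H = insert t (C.J H') ∧ ((rightCoset H' x = rightCoset H x ∩ C.M t ∧
        lab (rightCoset H x) a.1 = -l t) ∨ (rightCoset H' x ≠ rightCoset H x ∩ C.M t ∧
          lab (rightCoset H x) a.1 = l t)) := by
  obtain ⟨H', rfl, hlt, hcov⟩ := of_covBy_toCosetLattice ha hx
  obtain ⟨t, h1, h2⟩ := exists_J_eq_insert (C := C) hlt hcov
  exact ⟨H', t, rfl, hlt.le, h1, h2, hl.cover _ _ x t hlt.le h1 h2⟩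

/-- The local criterion for intervals with bottom `∅`. -/
theorem local_empty {A : CosetLattice G} (hA : emptyCoset G < A) : ∃ a, a ⋖ A ∧
    (∀ b, b ⋖ a → lab A.1 a.1 < lab a.1 b.1) ∧
    ∀ a', a' ⋖ A → a' ≠ a → lab A.1 a.1 < lab A.1 a'.1 ∧ ∃ b, b ⋖ a' ∧ lab a'.1 b.1 ≤ lab A.1 a'.1 := by
  rcases eq_emptyCoset_or A with rfl | ⟨x₀, hx₀⟩
  · exact absurd hA (lt_irrefl _)
  obtain ⟨H, rfl⟩ := eq_toCosetLattice hx₀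
  rcases (C.J H).eq_empty_or_nonempty with h | hne
  · obtain rfl : ⊥ = H := eq_of_J_subset (C := C) bot_le (by simp [h])
    refine ⟨_, emptyCoset_covBy_singleton x₀, fun b hb => ?_, fun a' ha' hne => ?_⟩
    · exact absurd (emptyCoset_le b) hb.1.not_ge
    · exact absurd ((emptyCoset_le a').lt_of_ne (Ne.symm hne))
        fun h => (emptyCoset_covBy_singleton x₀).2 h ha'.1
  -- For the largest position `t₀`, the value `-l t₀` is the least possible label, attained below
  -- `Hx` only by `Hx ∩ M t₀`; afterwards `t₀` is gone.
  obtain ⟨t₀, ht₀, hmax⟩ := (finite_J H).exists_maximal hne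
  obtain ⟨x, hx, hxM⟩ := exists_mem_rightCoset_M (x := x₀) ht₀
  rw [toCosetLattice_eq_of_mem hx]
  obtain ⟨hcov, hlab⟩ := hl.neg_edge ht₀ hxM
  refine ⟨_, hcov, fun b hb => ?_, fun a' ha' hne => ?_⟩
  · have h0 := hl.pos' ht₀
    change lab (rightCoset H x) (rightCoset (H ⊓ C.M t₀) x) < lab (rightCoset (H ⊓ C.M t₀) x) b.1
    rw [hlab]
    rcases eq_emptyCoset_or b with rfl | ⟨y, hy⟩
    · rw [emptyCoset, hl.empty]; omega
    · have hy' := hb.1.le hy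
      rw [toCosetLattice_eq_of_mem hy'] at hb
      obtain ⟨H', t, -, -, -, hJ, h⟩ := hl.edge hb hy
      rw [← rightCoset_eq_of_mem hy'] at h
      have ht : t ∈ C.J (H ⊓ C.M t₀) := hJ ▸ Set.mem_insert _ _
      obtain ⟨ht1, ht2⟩ := (mem_J_inf_M ht₀).1 ht
      have hlt : t < t₀ := lt_of_le_of_ne (by
        rcases le_total t t₀ with h | h
        exacts [h, hmax ht1 h]) ht2
      have := hl.lt' ht1 ht₀ hlt
      have := hl.pos' ht
      rcases h with h | h <;> omega
  · change lab (rightCoset H x) (rightCoset (H ⊓ C.M t₀) x) < lab (rightCoset H x) a'.1 ∧ _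
    rw [hlab]
    rcases eq_emptyCoset_or a' with rfl | ⟨y, hy⟩
    · exact absurd ((emptyCoset_le _).lt_of_ne hne)
        fun h => ha'.2 h hcov.1
    have hy' := ha'.1.le hy
    rw [toCosetLattice_eq_of_mem hy'] at ha' ⊢
    obtain ⟨H', t, rfl, hle, ht', hJ, h⟩ := hl.edge ha' hy
    have ht : t ∈ C.J H := hJ ▸ Set.mem_insert _ _
    have h0 := hl.pos' ht
    have h00 := hl.pos' ht₀
    rw [rightCoset_eq_of_mem hy']
    change _ ∧ ∃ b, b ⋖ toCosetLattice H' y ∧ lab (rightCoset H' y) b.1 ≤ lab (rightCoset H y) _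
    by_cases htt : t = t₀
    · subst htt
      rcases h with h | h
      · refine absurd (Subtype.ext ?_) hne
        change rightCoset H' y = rightCoset (H ⊓ C.M t) x
        rw [h.1, ← rightCoset_inter hxM, rightCoset_eq_of_mem hy']
      · obtain ⟨b, hb, hb'⟩ := hl.exists_nonpos_edge H' y
        exact ⟨by omega, b, hb, by omega⟩
    · have hlt : t < t₀ := lt_of_le_of_ne (by
        rcases le_total t t₀ with h | h
        exacts [h, hmax ht h]) htt
      have := hl.lt' ht ht₀ hlt
      -- A first step of another type keeps `t₀`, so the edge with label `-l t₀` can follow.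
      have ht₀' : t₀ ∈ C.J H' := by
        rw [hJ] at ht₀
        exact ht₀.resolve_left (Ne.symm htt)
      obtain ⟨z, hz, hzM⟩ := exists_mem_rightCoset_M (x := y) ht₀'
      obtain ⟨h1, h2⟩ := hl.neg_edge ht₀' hzM
      have hlt' : -l t₀ < lab (rightCoset H y) (toCosetLattice H' y).1 := by
        rcases h with h | h <;> omega
      refine ⟨hlt', ?_⟩
      generalize lab (rightCoset H y) (toCosetLattice H' y).1 = v at hlt' ⊢
      rw [toCosetLattice_eq_of_mem hz, rightCoset_eq_of_mem hz]
      exact ⟨_, h1, h2.trans_le hlt'.le⟩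

/-- The local criterion for intervals whose bottom is a coset. -/
theorem local_coset {A : CosetLattice G} {H₁ : Subgroup G} {x : G}
    (hA : toCosetLattice H₁ x < A) : ∃ a, a ⋖ A ∧ toCosetLattice H₁ x ≤ a ∧
    (∀ b, b ⋖ a → toCosetLattice H₁ x ≤ b → lab A.1 a.1 < lab a.1 b.1) ∧
    ∀ a', a' ⋖ A → toCosetLattice H₁ x ≤ a' → a' ≠ a → lab A.1 a.1 < lab A.1 a'.1 ∧
      ∃ b, b ⋖ a' ∧ toCosetLattice H₁ x ≤ b ∧ lab a'.1 b.1 ≤ lab A.1 a'.1 := by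
  classical
  obtain ⟨H, rfl⟩ := eq_toCosetLattice (hA.le (self_mem_rightCoset H₁ x))
  have hle : H₁ ≤ H := toCosetLattice_le_iff.1 hA.le
  have hex : ∃ t, t ∈ C.J H ∧ t ∉ C.J H₁ := by
    by_contra! hno
    exact hA.ne (by rw [eq_of_J_subset (C := C) hle hno])
  -- edges of the interval
  have hedge : ∀ (K : Subgroup G) (a : CosetLattice G), a ⋖ toCosetLattice K x →
      toCosetLattice H₁ x ≤ a → ∃ H' t, a = toCosetLattice H' x ∧ H₁ ≤ H' ∧ H' ≤ K ∧ t ∈ C.J K ∧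
        t ∉ C.J H₁ ∧ t ∉ C.J H' ∧ C.J K = insert t (C.J H') ∧
        ((rightCoset H' x = rightCoset K x ∩ C.M t ∧ x ∈ C.M t ∧ H₁ ≤ C.M t ∧
          lab (rightCoset K x) a.1 = -l t) ∨ (rightCoset H' x ≠ rightCoset K x ∩ C.M t ∧
          lab (rightCoset K x) a.1 = l t)) := by
    intro K a ha hBa
    obtain ⟨H', t, rfl, h1, h2, h3, h4⟩ := hl.edge ha (hBa (self_mem_rightCoset H₁ x))
    have h5 : H₁ ≤ H' := toCosetLattice_le_iff.1 hBa
    refine ⟨H', t, rfl, h5, h1, h3 ▸ Set.mem_insert _ _, fun h => h2 (J_mono h5 h), h2, h3, ?_⟩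
    refine h4.imp_left fun h => ?_
    have hsub : rightCoset H' x ⊆ C.M t := h.1 ▸ Set.inter_subset_right
    have hx : x ∈ C.M t := hsub (self_mem_rightCoset H' x)
    exact ⟨h.1, hx, h5.trans ((rightCoset_subset_subgroup_iff hx).1 hsub), h.2⟩
  -- These are the missing positions whose negative edge from `Hx` stays above `H₁x`.
  by_cases hS : ∃ t, t ∈ C.J H ∧ t ∉ C.J H₁ ∧ x ∈ C.M t ∧ H₁ ≤ C.M t
  · obtain ⟨t₀, ⟨ht₀, ht₀', hxM, hM⟩, hmax⟩ :=
      ((finite_J (C := C) H).subset (t := {t | t ∈ C.J H ∧ t ∉ C.J H₁ ∧ x ∈ C.M t ∧ H₁ ≤ C.M t})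
        fun _ h => h.1).exists_maximal hS
    have hneg : ∀ t ∈ C.J H, t ∉ C.J H₁ → x ∈ C.M t → H₁ ≤ C.M t → t ≠ t₀ → l t < l t₀ := by
      intro t h1 h2 h3 h4 hne
      refine hl.lt' h1 ht₀ (lt_of_le_of_ne ?_ hne)
      rcases le_total t t₀ with h | h
      exacts [h, hmax ⟨h1, h2, h3, h4⟩ h]
    have h00 := hl.pos' ht₀
    obtain ⟨hcov, hlab⟩ := hl.neg_edge ht₀ hxM
    refine ⟨_, hcov, toCosetLattice_le_iff.2 (le_inf hle hM), fun b hb hBb => ?_,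
      fun a' ha' hBa' hne => ?_⟩
    · change lab (rightCoset H x) (rightCoset (H ⊓ C.M t₀) x) <
        lab (rightCoset (H ⊓ C.M t₀) x) b.1
      rw [hlab]
      obtain ⟨H', t, rfl, -, -, ht, ht1, -, -, h⟩ := hedge _ b hb hBb
      obtain ⟨ht2, ht3⟩ := (mem_J_inf_M ht₀).1 ht
      have := hl.pos' ht
      rcases h with ⟨-, h1, h2, h3⟩ | ⟨-, h3⟩
      · have := hneg t ht2 ht1 h1 h2 ht3
        omega
      · omega
    · change lab (rightCoset H x) (rightCoset (H ⊓ C.M t₀) x) < lab (rightCoset H x) a'.1 ∧ _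
      rw [hlab]
      obtain ⟨H', t, rfl, hH', hH'', ht, ht1, htn, hJ, h⟩ := hedge _ a' ha' hBa'
      have h0 := hl.pos' ht
      change _ ∧ ∃ b, b ⋖ toCosetLattice H' x ∧ _ ∧
        lab (rightCoset H' x) b.1 ≤ lab (rightCoset H x) _
      by_cases htt : t = t₀
      · subst htt
        rcases h with ⟨h, -⟩ | ⟨-, h⟩
        · exact absurd (Subtype.ext (h.trans (rightCoset_inter hxM))) hne
        refine ⟨by omega, ?_⟩
        by_cases hS' : ∃ s, s ∈ C.J H' ∧ s ∉ C.J H₁ ∧ x ∈ C.M s ∧ H₁ ≤ C.M s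
        · obtain ⟨s, hs, hs', hxs, hsM⟩ := hS'
          obtain ⟨h1, h2⟩ := hl.neg_edge hs hxs
          have := hl.pos' hs
          exact ⟨_, h1, toCosetLattice_le_iff.2 (le_inf hH' hsM), h2.trans_le (by omega)⟩
        by_cases hs : ∃ s, s ∈ C.J H' ∧ s ∉ C.J H₁
        · have hmin := fun s h => Nat.find_min' hs (m := s) h
          obtain ⟨hs1, hs2⟩ := Nat.find_spec hs
          obtain ⟨h1, h2, h3⟩ := hl.mid_edge hH' x hs1 hs2 fun s h h' => hmin s ⟨h, h'⟩
          refine ⟨_, h1, h2, h3.trans ?_⟩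
          rw [h]
          -- Otherwise all remaining positions come after `t`, so `le_M_of_J` puts `H'` inside `M
          -- t`, and `a'` is the distinguished step after all.
          by_contra hlt
          have hgt : ∀ s ∈ C.J H', s ∉ C.J H₁ → t < s := by
            intro s hs3 hs4
            by_contra hle'
            have hst : s ≠ t := fun h => htn (h ▸ hs3)
            have : Nat.find hs < t := (hmin s ⟨hs3, hs4⟩).trans_lt (by omega)
            exact hlt (hl.lt' (J_mono hH'' hs1) ht this).le
          obtain ⟨g, -, hg, hg'⟩ := ht
          have hH'M := le_M_of_J hH' hg hg' hM hgt
          apply hne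
          rw [eq_of_J_subset (C := C) (le_inf hH'' hH'M)]
          intro s hs
          obtain ⟨hs3, hs4⟩ := (mem_J_inf_M ht₀).1 hs
          rw [hJ] at hs3
          exact hs3.resolve_left hs4
        · exfalso
          push Not at hs
          have : H₁ = H' := eq_of_J_subset (C := C) hH' hs
          subst this
          apply hne
          rw [eq_of_J_subset (C := C) (le_inf hH'' hM)]
          intro s hs
          obtain ⟨hs3, hs4⟩ := (mem_J_inf_M ht₀).1 hs
          rw [hJ] at hs3
          exact hs3.resolve_left hs4
      · have ht₀'' : t₀ ∈ C.J H' := by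
          rw [hJ] at ht₀
          exact ht₀.resolve_left (Ne.symm htt)
        obtain ⟨h1, h2⟩ := hl.neg_edge ht₀'' hxM
        have hlt : -l t₀ < lab (rightCoset H x) (toCosetLattice H' x).1 := by
          rcases h with ⟨-, h1, h2, h3⟩ | ⟨-, h3⟩
          · have := hneg t ht ht1 h1 h2 htt
            omega
          · omega
        exact ⟨hlt, _, h1, toCosetLattice_le_iff.2 (le_inf hH' hM), h2.trans_le hlt.le⟩
  -- No complement at a missing position contains `H₁x`, so every label in the interval is positive.
  · have hpos : ∀ K ≤ H, ∀ a, a ⋖ toCosetLattice K x → toCosetLattice H₁ x ≤ a →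
        ∃ H' t, a = toCosetLattice H' x ∧ H₁ ≤ H' ∧ H' ≤ K ∧ t ∈ C.J K ∧ t ∉ C.J H₁ ∧ t ∉ C.J H' ∧
          C.J K = insert t (C.J H') ∧ lab (rightCoset K x) a.1 = l t := by
      intro K hK a ha hBa
      obtain ⟨H', t, h1, h2, h3, h4, h5, h6, h7, h⟩ := hedge K a ha hBa
      refine ⟨H', t, h1, h2, h3, h4, h5, h6, h7, ?_⟩
      rcases h with ⟨-, h8, h9, -⟩ | ⟨-, h⟩
      · exact absurd ⟨t, J_mono hK h4, h5, h8, h9⟩ hS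
      · exact h
    have hmin := fun s h h' => Nat.find_min' hex (m := s) ⟨h, h'⟩
    obtain ⟨ht₀, ht₀'⟩ := Nat.find_spec hex
    set t₀ := Nat.find hex
    obtain ⟨hcov, hB, hlab⟩ := hl.mid_edge hle x ht₀ ht₀' hmin
    refine ⟨_, hcov, hB, fun b hb hBb => ?_, fun a' ha' hBa' hne => ?_⟩
    · refine lt_of_le_of_lt hlab ?_
      obtain ⟨H', t, rfl, -, -, ht, ht1, -, -, h⟩ := hpos _ (mid_le hle _) b hb hBb
      refine lt_of_lt_of_eq ?_ h.symm
      rcases (mem_J_mid hle).1 ht with h | h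
      · exact absurd h ht1
      · exact hl.lt' ht₀ h.1 h.2
    · obtain ⟨H', t, rfl, hH', hH'', ht, ht1, htn, hJ, h⟩ := hpos _ le_rfl a' ha' hBa'
      -- Only one step has type `t₀`: all positions of `H'` missing from `H₁` come after `t₀`,
      -- whence `H' = H₁ (H' ∩ N (t₀ + 1))`, which lies in `mid` and has the same positions.
      have htt : t ≠ t₀ := by
        rintro rfl
        apply hne
        have hH'm : H' ≤ C.mid H₁ H (t₀ + 1) := by
          rw [← mid_eq (C := C) hH' (k := t₀ + 1) fun s hs hs' => ?_]
          · exact sup_le_sup_left (inf_le_inf_right _ hH'') _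
          · have := hmin s (J_mono hH'' hs) hs'
            have : s ≠ t₀ := fun h => htn (h ▸ hs)
            omega
        rw [eq_of_J_subset (C := C) hH'm]
        intro s hs
        obtain ⟨h1, h2⟩ := J_eq_insert_mid hle ht₀ ht₀' hmin
        have : s ∈ C.J H := h2 ▸ Set.mem_insert_of_mem _ hs
        rw [hJ] at this
        exact this.resolve_left fun h => h1 (h ▸ hs)
      have hlt : l t₀ < l t := hl.lt' ht₀ ht (lt_of_le_of_ne (hmin t ht ht1) (Ne.symm htt))
      have ht₀'' : t₀ ∈ C.J H' := by
        rw [hJ] at ht₀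
        exact ht₀.resolve_left (Ne.symm htt)
      obtain ⟨h1, h2, h3⟩ := hl.mid_edge hH' x ht₀'' ht₀' fun s hs => hmin s (J_mono hH'' hs)
      exact ⟨lt_of_le_of_lt hlab (hlt.trans_eq h.symm), _, h1, h2,
        h3.trans (hlt.le.trans_eq h.symm)⟩

theorem isLocalEL : IsLocalEL (P := (CosetLattice G)ᵒᵈ)
    fun a b => lab (OrderDual.ofDual a).1 (OrderDual.ofDual b).1 := by
  intro A B hAB
  induction A using OrderDual.rec with | toDual A
  induction B using OrderDual.rec with | toDual B
  have hAB : B < A := hAB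
  suffices ∃ a, a ⋖ A ∧ B ≤ a ∧ (∀ b, b ⋖ a → B ≤ b → lab A.1 a.1 < lab a.1 b.1) ∧
      ∀ a', a' ⋖ A → B ≤ a' → a' ≠ a → lab A.1 a.1 < lab A.1 a'.1 ∧
        ∃ b, b ⋖ a' ∧ B ≤ b ∧ lab a'.1 b.1 ≤ lab A.1 a'.1 by
    obtain ⟨a, h1, h2, h3, h4⟩ := this
    refine ⟨OrderDual.toDual a, h1.toDual, h2, fun b hb => h3 b hb.ofDual, fun a' ha' hBa hne => ?_⟩
    obtain ⟨h5, b, h6, h7⟩ := h4 a' ha'.ofDual hBa hne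
    exact ⟨h5, OrderDual.toDual b, h6.toDual, h7⟩
  rcases eq_emptyCoset_or B with rfl | ⟨x, hx⟩
  · obtain ⟨a, h1, h2, h3⟩ := hl.local_empty hAB
    refine ⟨a, h1, emptyCoset_le a, fun b hb _ => h2 b hb, fun a' ha' _ hne => ?_⟩
    obtain ⟨h4, b, h5, h6⟩ := h3 a' ha' hne
    exact ⟨h4, b, h5, emptyCoset_le b, h6⟩
  · obtain ⟨H₁, rfl⟩ := eq_toCosetLattice hx
    exact hl.local_coset hAB

end ComplementedSeries.IsLabel

/-! ### Groups of square-free order -/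

section Squarefree

theorem card_dvd_prime_of_isPGroup {X : Type*} [Group X] (hX : Squarefree (Nat.card X)) {p : ℕ}
    [Fact p.Prime] {P : Subgroup X} (hP : IsPGroup p P) : Nat.card P ∣ p := by
  have : Finite X := Nat.finite_of_card_ne_zero hX.ne_zero
  obtain ⟨n, hn⟩ := hP.exists_card_eq
  have hsq : Squarefree (p ^ n) := hn ▸ hX.squarefree_of_dvd P.card_subgroup_dvd_card
  rw [hn]
  by_contra hnd
  have h2 : 2 ≤ n := by
    by_contra hlt
    interval_cases n <;> simp at hnd
  have : p * p ∣ p ^ n := by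
    rw [← pow_two]
    exact pow_dvd_pow p h2
  exact (Fact.out : p.Prime).one_lt.ne' (Nat.isUnit_iff.1 (hsq p this))

/-- In a group of square-free order, the elements of order divisible only by primes `≥ n` form a
subgroup. -/
theorem exists_subgroup_forall_le (X : Type*) [Group X] (hX : Squarefree (Nat.card X)) (n : ℕ) :
    ∃ K : Subgroup X, ∀ x, x ∈ K ↔ ∀ q, q.Prime → q ∣ orderOf x → n ≤ q := by
  induction hc : Nat.card X using Nat.strong_induction_on generalizing X with
  | _ c ih =>
    subst hc
    have : Finite X := Nat.finite_of_card_ne_zero hX.ne_zero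
    by_cases h1 : Nat.card X = 1
    · refine ⟨⊤, fun x => ⟨fun _ q hq hqx => ?_, fun _ => trivial⟩⟩
      have := (Nat.card_eq_one_iff_unique.1 h1).1
      rw [Subsingleton.elim x 1, orderOf_one] at hqx
      exact absurd (Nat.dvd_one.1 hqx) hq.ne_one
    set p := (Nat.card X).minFac with hp
    have hpp : p.Prime := Nat.minFac_prime h1
    by_cases hn : n ≤ p
    · exact ⟨⊤, fun x => ⟨fun _ q hq hqx => hn.trans (Nat.minFac_le_of_dvd hq.two_le
        (hqx.trans (orderOf_dvd_natCard x))), fun _ => trivial⟩⟩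
    have := Fact.mk hpp
    have : IsZGroup X := IsZGroup.of_squarefree hX
    obtain ⟨P⟩ : Nonempty (Sylow p X) := inferInstance
    -- Burnside transfer: a cyclic Sylow subgroup for the smallest prime divisor has a normal
    -- complement `Q`.
    have hcompl := IsCyclic.isComplement' hp.symm (P := P) inferInstance
    set Q := (MonoidHom.transferSylow P _).ker
    have hQc : Nat.card Q * Nat.card P = Nat.card X := hcompl.card_mul_card
    have hcop : Q.index = Nat.card P := hcompl.symm.index_eq_card
    have hP1 : Nat.card P ≠ 1 := fun h => by
      have := P.ne_bot_of_dvd_card (Nat.minFac_dvd _)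
      exact this (Subgroup.card_eq_one.1 h)
    have hPp : Nat.card P = p :=
      ((Nat.dvd_prime hpp).1 (card_dvd_prime_of_isPGroup hX P.2)).resolve_left hP1
    have hpQ : ¬ p ∣ Nat.card Q := fun h => by
      have h2 : p * p ∣ Nat.card X := by
        rw [← hQc, hPp]
        exact Nat.mul_dvd_mul_right h p
      exact hpp.one_lt.ne' (Nat.isUnit_iff.1 (hX p h2))
    obtain ⟨K, hK⟩ := ih (Nat.card Q) (by
        rw [← hQc, hPp]
        exact lt_mul_of_one_lt_right Nat.card_pos hpp.one_lt) Q
      (hX.squarefree_of_dvd Q.card_subgroup_dvd_card) rfl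
    refine ⟨K.map Q.subtype, fun x => ⟨?_, fun hx => ?_⟩⟩
    · rintro ⟨y, hy, rfl⟩
      simpa using (hK y).1 hy
    · have hxp : ¬ p ∣ orderOf x := fun h => hn (hx p hpp h)
      -- `Q` has index `p`, so `x ^ p ∈ Q`, and `x` is a power of `x ^ p` because its order is prime
      -- to `p`.
      have hxQ : x ∈ Q := by
        have h2 := Q.pow_index_mem x
        rw [hcop, hPp] at h2
        have hc : Nat.Coprime p (orderOf x) := (Nat.Prime.coprime_iff_not_dvd hpp).2 hxp
        obtain ⟨m, hm⟩ := exists_pow_eq_self_of_coprime hc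
        rw [← hm]
        exact pow_mem h2 m
      exact ⟨⟨x, hxQ⟩, (hK _).2 (by simpa using hx), rfl⟩

/-- The subgroup of elements of order divisible only by primes `≥ n`, in a group of square-free
order. -/
noncomputable def bigPart {X : Type*} [Group X] (hX : Squarefree (Nat.card X)) (n : ℕ) :
    Subgroup X :=
  (exists_subgroup_forall_le X hX n).choose

variable {X : Type*} [Group X] (hX : Squarefree (Nat.card X))

theorem mem_bigPart {n : ℕ} {x : X} :
    x ∈ bigPart hX n ↔ ∀ q, q.Prime → q ∣ orderOf x → n ≤ q :=
  (exists_subgroup_forall_le X hX n).choose_spec x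

theorem bigPart_antitone : Antitone (bigPart hX) := fun _ _ h _ hx =>
  (mem_bigPart hX).2 fun q hq hqx => h.trans ((mem_bigPart hX).1 hx q hq hqx)

theorem bigPart_zero : bigPart hX 0 = ⊤ :=
  eq_top_iff.2 fun _ _ => (mem_bigPart hX).2 fun q _ _ => q.zero_le

theorem bigPart_eq_bot {n : ℕ} (hn : Nat.card X < n) : bigPart hX n = ⊥ := by
  have : Finite X := Nat.finite_of_card_ne_zero hX.ne_zero
  refine (Subgroup.eq_bot_iff_forall _).2 fun x hx => orderOf_eq_one_iff.1 ?_
  by_contra h1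
  obtain ⟨q, hq, hqx⟩ := Nat.exists_prime_and_dvd h1
  have := (mem_bigPart hX).1 hx q hq hqx
  have := Nat.le_of_dvd Nat.card_pos (hqx.trans (orderOf_dvd_natCard x))
  omega

instance bigPart_normal (n : ℕ) : (bigPart hX n).Normal := ⟨fun x hx g => by
  rw [mem_bigPart] at hx ⊢
  have : orderOf (g * x * g⁻¹) = orderOf x := by
    simpa using MulEquiv.orderOf_eq (MulAut.conj g) x
  rwa [this]⟩

theorem prime_of_mem_bigPart {n : ℕ} {x : X} (h : x ∈ bigPart hX n) (h' : x ∉ bigPart hX (n + 1)) :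
    n.Prime ∧ n ∣ orderOf x := by
  rw [mem_bigPart] at h h'
  push Not at h'
  obtain ⟨q, hq, hqx, hlt⟩ := h'
  have := h q hq hqx
  obtain rfl : n = q := by omega
  exact ⟨hq, hqx⟩

variable {hX}

section Index

variable {p : ℕ} {M : Subgroup X}

/-- A prime dividing the relative index is at most `p`, but by Cauchy it is the order of an element
of `bigPart hX (p + 1)`. -/
theorem bigPart_le_of_index (hM : M.index = p) : bigPart hX (p + 1) ≤ M := by
  have : Finite X := Nat.finite_of_card_ne_zero hX.ne_zero
  have h0 : ∀ K, M.relIndex K ≠ 0 := fun K =>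
    ne_zero_of_dvd_ne_zero Nat.card_pos.ne' (Subgroup.relIndex_dvd_card M K)
  rw [← Subgroup.relIndex_eq_one]
  by_contra h1
  obtain ⟨q, hq, hqd⟩ := Nat.exists_prime_and_dvd h1
  have h2 : M.relIndex (bigPart hX (p + 1)) ≤ p := by
    rw [← hM, ← Subgroup.relIndex_top_right]
    exact Subgroup.relIndex_le_of_le_right le_top (h0 _)
  have h3 : q ≤ p := (Nat.le_of_dvd (Nat.pos_of_ne_zero (h0 _)) hqd).trans h2
  have := Fact.mk hq
  obtain ⟨x, hx⟩ := exists_prime_orderOf_dvd_card' (G := bigPart hX (p + 1)) q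
    (hqd.trans (Subgroup.relIndex_dvd_card _ _))
  have := (mem_bigPart hX).1 x.2 q hq (by rw [Subgroup.orderOf_coe, hx])
  omega

theorem not_dvd_card_of_index (hX : Squarefree (Nat.card X)) (hp : p.Prime) (hM : M.index = p) :
    ¬ p ∣ Nat.card M := fun h => by
  have h2 : p * p ∣ Nat.card X := by
    rw [← M.card_mul_index, hM]
    exact Nat.mul_dvd_mul_right h p
  exact hp.one_lt.ne' (Nat.isUnit_iff.1 (hX p h2))

theorem inf_bigPart_le_of_index (hM : M.index = p) (hp : p.Prime) :
    M ⊓ bigPart hX p ≤ bigPart hX (p + 1) := by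
  rintro x ⟨hx, hxp⟩
  by_contra hx'
  have := (prime_of_mem_bigPart hX hxp hx').2
  exact not_dvd_card_of_index hX hp hM (this.trans (Subgroup.orderOf_dvd_natCard M hx))

/-- A power of `g` has order `p`. The group it generates and `M` have coprime orders with product
`|X|`, so they are complements. -/
theorem exists_zpow_mul_mem_of_index (hX : Squarefree (Nat.card X)) (hp : p.Prime)
    (hM : M.index = p) {g : X} (hg : p ∣ orderOf g) (x : X) : ∃ m : ℤ, g ^ m * x ∈ M := by
  have : Finite X := Nat.finite_of_card_ne_zero hX.ne_zero
  obtain ⟨k, hk⟩ := hg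
  have hk0 : k ≠ 0 := by
    rintro rfl
    exact (orderOf_pos g).ne' hk
  have ho : orderOf (g ^ k) = p := by
    rw [orderOf_pow' g hk0, hk, Nat.gcd_eq_right (Dvd.intro_left p rfl),
      Nat.mul_div_cancel _ (Nat.pos_of_ne_zero hk0)]
  have hcompl : Subgroup.IsComplement' (Subgroup.zpowers (g ^ k)) M := by
    apply Subgroup.isComplement'_of_coprime
    · rw [Nat.card_zpowers, ho, ← M.card_mul_index, hM, mul_comm]
    · rw [Nat.card_zpowers, ho]
      exact (Nat.Prime.coprime_iff_not_dvd hp).2 (not_dvd_card_of_index hX hp hM)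
  obtain ⟨⟨⟨a, ha⟩, ⟨b, hb⟩⟩, hab⟩ := hcompl.2 x
  obtain ⟨m, rfl⟩ := ha
  refine ⟨-(k * m), ?_⟩
  have : x = (g ^ k) ^ m * b := hab.symm
  rw [this, zpow_neg, zpow_mul, zpow_natCast, inv_mul_cancel_left]
  exact hb

theorem pow_mem_bigPart (hp : p.Prime) {x : X} (hx : x ∈ bigPart hX p) :
    x ^ p ∈ bigPart hX (p + 1) := by
  refine (mem_bigPart hX).2 fun q hq hqx => ?_
  have h1 : q ∣ orderOf x := hqx.trans (orderOf_pow_dvd p)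
  refine Nat.lt_of_le_of_ne ((mem_bigPart hX).1 hx q hq h1) ?_
  rintro rfl
  rw [orderOf_pow_of_dvd hp.ne_zero h1] at hqx
  have h2 : p * p ∣ orderOf x := by
    conv_rhs => rw [← Nat.mul_div_cancel' h1]
    exact Nat.mul_dvd_mul_left p hqx
  exact hp.one_lt.ne' (Nat.isUnit_iff.1 (hX p (h2.trans (orderOf_dvd_natCard x))))

/-- Modulo `bigPart hX (p + 1)`, the image of `bigPart hX p` is normal of order `p` and coprime
index. Its Schur–Zassenhaus complement has index `p` and is pulled back. -/
theorem exists_index_eq (hX : Squarefree (Nat.card X)) (hp : p.Prime) (hpX : p ∣ Nat.card X) :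
    ∃ M : Subgroup X, M.index = p := by
  have : Finite X := Nat.finite_of_card_ne_zero hX.ne_zero
  have := Fact.mk hp
  let L := bigPart hX (p + 1)
  let K := (bigPart hX p).map (QuotientGroup.mk' L)
  have hK : K.Normal := (bigPart_normal hX p).map _ (QuotientGroup.mk'_surjective L)
  have hKp : IsPGroup p K := by
    rintro ⟨_, ⟨x, hx, rfl⟩⟩
    refine ⟨1, Subtype.ext ?_⟩
    change (QuotientGroup.mk' L x) ^ p ^ 1 = 1
    rw [← map_pow, pow_one]
    exact (QuotientGroup.eq_one_iff _).2 (pow_mem_bigPart hp hx)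
  have hXL : Squarefree (Nat.card (X ⧸ L)) :=
    hX.squarefree_of_dvd (Subgroup.card_quotient_dvd_card L)
  have hK1 : Nat.card K ≠ 1 := fun h => by
    obtain ⟨x, hx⟩ := exists_prime_orderOf_dvd_card' p hpX
    have hxp : x ∈ bigPart hX p := (mem_bigPart hX).2 fun q hq hqx =>
      ((Nat.prime_dvd_prime_iff_eq hq hp).1 (hx ▸ hqx)).ge
    have : QuotientGroup.mk' L x ∈ K := ⟨x, hxp, rfl⟩
    rw [Subgroup.card_eq_one.1 h, Subgroup.mem_bot] at this
    have := (mem_bigPart hX).1 ((QuotientGroup.eq_one_iff _).1 this) p hp (by rw [hx])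
    omega
  have hKc : Nat.card K = p :=
    ((Nat.dvd_prime hp).1 (card_dvd_prime_of_isPGroup hXL hKp)).resolve_left hK1
  have hcop : Nat.Coprime (Nat.card K) K.index := by
    rw [hKc]
    refine (Nat.Prime.coprime_iff_not_dvd hp).2 fun h => ?_
    have h2 : p * p ∣ Nat.card (X ⧸ L) := by
      rw [← K.card_mul_index, hKc]
      exact Nat.mul_dvd_mul_left p h
    exact hp.one_lt.ne' (Nat.isUnit_iff.1 (hXL p h2))
  obtain ⟨M, hM⟩ := Subgroup.exists_right_complement'_of_coprime hcop
  refine ⟨M.comap (QuotientGroup.mk' L), ?_⟩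
  rw [Subgroup.index_comap_of_surjective _ (QuotientGroup.mk'_surjective L), hM.index_eq_card, hKc]

end Index

end Squarefree

/-! ### The complemented series of a product of groups of square-free order -/

section Product

variable {r : ℕ} {Γ : Fin r → Type*} [∀ i, Group (Γ i)] (hΓ : ∀ i, Squarefree (Nat.card (Γ i)))

/-- The series of the product; its factor at position `p * r + j` is trivial or has order `p` and
lives in the coordinate `j`. -/
noncomputable def productSeries (k : ℕ) : Subgroup (∀ i, Γ i) :=
  -- At `k = p * r + j` the quotient is `p + 1` for `i < j` and `p` for `i ≥ j`: exactly the
  -- coordinates before `j` have already dropped their `p`-part.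
  Subgroup.pi Set.univ fun i => bigPart (hΓ i) ((k + (r - 1 - i)) / r)

theorem mem_productSeries {k : ℕ} {x : ∀ i, Γ i} :
    x ∈ productSeries hΓ k ↔ ∀ i : Fin r, x i ∈ bigPart (hΓ i) ((k + (r - 1 - i)) / r) := by
  simp [productSeries, Subgroup.mem_pi]

theorem mem_productSeries_mul_add {p : ℕ} {j : Fin r} {x : ∀ i, Γ i} :
    x ∈ productSeries hΓ (p * r + j) ↔
      ∀ i, x i ∈ bigPart (hΓ i) (if i < j then p + 1 else p) := by
  rw [mem_productSeries]
  refine forall_congr' fun i => ?_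
  have hi := i.2
  have hj := j.2
  have : (p * r + j + (r - 1 - i)) / r = if i < j then p + 1 else p := by
    split_ifs with h
    · have h : (i : ℕ) < j := h
      apply Nat.div_eq_of_lt_le <;> (try simp only [add_mul, one_mul]) <;> omega
    · have h : ¬ (i : ℕ) < j := h
      apply Nat.div_eq_of_lt_le <;> (try simp only [add_mul, one_mul]) <;> omega
  rw [this]

theorem mem_productSeries_mul_add_succ {p : ℕ} {j : Fin r} {x : ∀ i, Γ i} :
    x ∈ productSeries hΓ (p * r + j + 1) ↔
      ∀ i, x i ∈ bigPart (hΓ i) (if i ≤ j then p + 1 else p) := by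
  rw [mem_productSeries]
  refine forall_congr' fun i => ?_
  have hi := i.2
  have hj := j.2
  have : (p * r + j + 1 + (r - 1 - i)) / r = if i ≤ j then p + 1 else p := by
    split_ifs with h
    · have h : (i : ℕ) ≤ j := h
      apply Nat.div_eq_of_lt_le <;> (try simp only [add_mul, one_mul]) <;> omega
    · have h : ¬ (i : ℕ) ≤ j := h
      apply Nat.div_eq_of_lt_le <;> (try simp only [add_mul, one_mul]) <;> omega
  rw [this]

theorem productSeries_antitone : Antitone (productSeries hΓ) := fun k k' h x hx => by
  rw [mem_productSeries] at hx ⊢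
  exact fun i => bigPart_antitone (hΓ i) (Nat.div_le_div_right (by omega)) (hx i)

theorem productSeries_zero : productSeries hΓ 0 = ⊤ := by
  refine eq_top_iff.2 fun x _ => (mem_productSeries hΓ).2 fun i => ?_
  have : (0 + (r - 1 - i)) / r = 0 := Nat.div_eq_of_lt (by have := i.2; omega)
  rw [this, bigPart_zero]
  trivial

theorem productSeries_length :
    productSeries hΓ ((∑ i, Nat.card (Γ i) + 1) * r) = ⊥ := by
  refine (Subgroup.eq_bot_iff_forall _).2 fun x hx => funext fun i => ?_
  rw [mem_productSeries] at hx
  have h1 := hx i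
  have h2 : Nat.card (Γ i) ≤ ∑ i, Nat.card (Γ i) :=
    Finset.single_le_sum (f := fun i => Nat.card (Γ i)) (fun _ _ => Nat.zero_le _)
      (Finset.mem_univ i)
  rw [bigPart_eq_bot, Subgroup.mem_bot] at h1
  · exact h1
  · refine lt_of_lt_of_le (Nat.lt_succ_of_le h2) ?_
    rw [Nat.le_div_iff_mul_le (by have := i.2; omega)]
    exact Nat.le_add_right _ _

instance productSeries_normal (k : ℕ) : (productSeries hΓ k).Normal := ⟨fun x hx g => by
  rw [mem_productSeries] at hx ⊢
  exact fun i => (bigPart_normal (hΓ i) _).conj_mem _ (hx i) (g i)⟩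

variable {hΓ}

/-- An element in the difference of two consecutive terms of the series. -/
theorem exists_of_mem_productSeries {k : ℕ} {x : ∀ i, Γ i} (hx : x ∈ productSeries hΓ k)
    (hx' : x ∉ productSeries hΓ (k + 1)) : ∃ (p : ℕ) (j : Fin r), p.Prime ∧ k = p * r + j ∧
      x j ∈ bigPart (hΓ j) p ∧ x j ∉ bigPart (hΓ j) (p + 1) ∧ p ∣ orderOf (x j) := by
  have hr : 0 < r := by
    rcases Nat.eq_zero_or_pos r with rfl | h
    · exact absurd ((mem_productSeries hΓ).2 fun i => i.elim0) hx'
    · exact h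
  obtain ⟨p, j, rfl⟩ : ∃ (p : ℕ) (j : Fin r), k = p * r + j :=
    ⟨k / r, ⟨k % r, Nat.mod_lt _ hr⟩, by rw [mul_comm]; exact (Nat.div_add_mod k r).symm⟩
  rw [mem_productSeries_mul_add] at hx
  rw [mem_productSeries_mul_add_succ] at hx'
  have hj : x j ∈ bigPart (hΓ j) p := by simpa using hx j
  have hj' : x j ∉ bigPart (hΓ j) (p + 1) := fun h => hx' fun i => by
    rcases lt_trichotomy i j with hij | rfl | hij
    · simpa [hij, hij.le] using hx i
    · simpa using h
    · simpa [hij.not_ge, hij.not_gt] using hx i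
  obtain ⟨h1, h2⟩ := prime_of_mem_bigPart (hΓ j) hj hj'
  exact ⟨p, j, h1, rfl, hj, hj', h2⟩

theorem pow_mem_productSeries {p : ℕ} (hp : p.Prime) {j : Fin r} {g : ∀ i, Γ i}
    (hg : g ∈ productSeries hΓ (p * r + j)) : g ^ p ∈ productSeries hΓ (p * r + j + 1) := by
  rw [mem_productSeries_mul_add] at hg
  rw [mem_productSeries_mul_add_succ]
  intro i
  have := hg i
  rcases lt_trichotomy i j with hij | rfl | hij
  · rw [if_pos hij] at this
    rw [if_pos hij.le]
    exact pow_mem this _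
  · rw [if_neg (lt_irrefl _)] at this
    rw [if_pos le_rfl]
    exact pow_mem_bigPart hp this
  · rw [if_neg hij.not_gt] at this
    rw [if_neg hij.not_ge]
    exact pow_mem this _

theorem mul_add_div_mod {p : ℕ} (j : Fin r) : (p * r + j) / r = p ∧ (p * r + j) % r = j := by
  have hr : 0 < r := by have := j.2; omega
  constructor
  · rw [Nat.mul_comm, Nat.mul_add_div hr, Nat.div_eq_of_lt j.2, add_zero]
  · rw [Nat.mul_comm, Nat.mul_add_mod, Nat.mod_eq_of_lt j.2]

namespace LabelingData

variable (hΓ) (D : LabelingData Γ)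

open Classical in
/-- The subgroup `M_{p,j}`, indexed by the position `p * r + j`. -/
noncomputable def posM (k : ℕ) : Subgroup (∀ i, Γ i) :=
  -- The value `⊥` is harmless, as the factor is trivial at positions not coming from a prime.
  if h : (k / r).Prime ∧ 0 < r then D.M ⟨k / r, h.1⟩ ⟨k % r, Nat.mod_lt _ h.2⟩ else ⊥

/-- The number `l (p, j)`, indexed by the position `p * r + j`. -/
noncomputable def posL (k : ℕ) : ℤ :=
  open Classical in
  if h : (k / r).Prime ∧ 0 < r then D.l ⟨k / r, h.1⟩ ⟨k % r, Nat.mod_lt _ h.2⟩ else 0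

theorem posM_mul_add (p : Nat.Primes) (j : Fin r) : D.posM (p * r + j) = D.M p j := by
  obtain ⟨h1, h2⟩ := mul_add_div_mod (p := p) j
  have h : ((p * r + j) / r).Prime ∧ 0 < r := ⟨by rw [h1]; exact p.2, by have := j.2; omega⟩
  rw [posM, dif_pos h]
  congr

theorem posL_mul_add (p : Nat.Primes) (j : Fin r) : D.posL (p * r + j) = D.l p j := by
  obtain ⟨h1, h2⟩ := mul_add_div_mod (p := p) j
  have h : ((p * r + j) / r).Prime ∧ 0 < r := ⟨by rw [h1]; exact p.2, by have := j.2; omega⟩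
  rw [posL, dif_pos h]
  congr

/-- The series of the product with the complements `M_{p,j}`. -/
noncomputable def series : ComplementedSeries (∀ i, Γ i) where
  N := productSeries hΓ
  M := D.posM
  length := _
  antitone_N := productSeries_antitone hΓ
  N_zero := productSeries_zero hΓ
  N_length := productSeries_length hΓ
  normal := productSeries_normal hΓ
  le_M k g hg hg' := by
    obtain ⟨p, j, hp, rfl, -, -, hpg⟩ := exists_of_mem_productSeries hg hg'
    intro x hx
    rw [D.posM_mul_add ⟨p, hp⟩ j]
    rw [mem_productSeries_mul_add_succ] at hx
    have := hx j
    rw [if_pos le_rfl] at this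
    exact bigPart_le_of_index (D.index_Mstar ⟨p, hp⟩ j (hpg.trans (orderOf_dvd_natCard _))) this
  inf_le k := by
    rintro x ⟨hx, hxN⟩
    by_contra hx'
    obtain ⟨p, j, hp, rfl, h1, h2, hpg⟩ := exists_of_mem_productSeries hxN hx'
    rw [D.posM_mul_add ⟨p, hp⟩ j] at hx
    exact h2 (inf_bigPart_le_of_index
      (D.index_Mstar ⟨p, hp⟩ j (hpg.trans (orderOf_dvd_natCard _))) hp ⟨hx, h1⟩)
  exists_zpow_mul_mem k g hg hg' x := by
    obtain ⟨p, j, hp, rfl, h1, h2, hpg⟩ := exists_of_mem_productSeries hg hg'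
    rw [D.posM_mul_add ⟨p, hp⟩ j]
    exact exists_zpow_mul_mem_of_index (hΓ j) hp
      (D.index_Mstar ⟨p, hp⟩ j (hpg.trans (orderOf_dvd_natCard _))) hpg (x j)

end LabelingData

/-- The nontrivial positions in terms of `p`-elements with leading coordinate `j`. -/
theorem exists_mem_productSeries_iff (H : Subgroup (∀ i, Γ i)) {p : ℕ} (hp : p.Prime) (j : Fin r) :
    (∃ h ∈ H, h ∈ productSeries hΓ (p * r + j) ∧ h ∉ productSeries hΓ (p * r + j + 1)) ↔
      ∃ h ∈ H, (∃ k, h ^ p ^ k = 1) ∧ (∀ i < j, h i = 1) ∧ h j ≠ 1 := by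
  have hfin : ∀ i, Finite (Γ i) := fun i => Nat.finite_of_card_ne_zero (hΓ i).ne_zero
  constructor
  · rintro ⟨h, hH, hN, hN'⟩
    have hpj : p ∣ orderOf (h j) := by
      obtain ⟨p', j', hp', heq, -, -, hd⟩ := exists_of_mem_productSeries hN hN'
      have h1 := mul_add_div_mod (p := p) j
      have h2 := mul_add_div_mod (p := p') j'
      rw [← heq] at h2
      obtain rfl : p = p' := h1.1.symm.trans h2.1
      obtain rfl : j = j' := Fin.ext (h1.2.symm.trans h2.2)
      exact hd
    rw [mem_productSeries_mul_add] at hN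
    set n := orderOf h with hn
    have hn0 : n ≠ 0 := (orderOf_pos h).ne'
    have hdvd : ∀ i, orderOf (h i) ∣ n := fun i => orderOf_map_dvd (Pi.evalMonoidHom Γ i) h
    -- Raising to the `p'`-part of the order leaves a `p`-element. It kills the coordinates before
    -- `j`, whose orders are prime to `p`, but not coordinate `j`, whose order is divisible by `p`.
    refine ⟨h ^ (n / p ^ n.factorization p), pow_mem hH _, ⟨n.factorization p, ?_⟩, ?_, ?_⟩
    · rw [← pow_mul, Nat.div_mul_cancel (Nat.ordProj_dvd n p), pow_orderOf_eq_one]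
    · intro i hij
      have h1 := hN i
      rw [if_pos hij] at h1
      rw [Pi.pow_apply, ← orderOf_dvd_iff_pow_eq_one]
      have h2 : Nat.Coprime (orderOf (h i)) (p ^ n.factorization p) := by
        refine Nat.Coprime.pow_right _ ?_
        rw [Nat.coprime_comm, Nat.Prime.coprime_iff_not_dvd hp]
        intro hd
        have := (mem_bigPart (hΓ i)).1 h1 p hp hd
        omega
      refine h2.dvd_of_dvd_mul_left ?_
      rw [Nat.mul_div_cancel' (Nat.ordProj_dvd n p)]
      exact hdvd i
    · rw [Pi.pow_apply, Ne, ← orderOf_dvd_iff_pow_eq_one]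
      exact fun hd => Nat.not_dvd_ordCompl hp hn0 (hpj.trans hd)
  · rintro ⟨h, hH, ⟨k, hk⟩, hlt, hj⟩
    have hord : ∀ i, ∃ m, orderOf (h i) = p ^ m := fun i => by
      have : h i ^ p ^ k = 1 := by rw [← Pi.pow_apply, hk]; rfl
      obtain ⟨m, -, hm⟩ := (Nat.dvd_prime_pow hp).1 (orderOf_dvd_of_pow_eq_one this)
      exact ⟨m, hm⟩
    refine ⟨h, hH, ?_, ?_⟩
    · rw [mem_productSeries_mul_add]
      intro i
      split_ifs with hij
      · rw [hlt i hij]; exact one_mem _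
      · refine (mem_bigPart _).2 fun q hq hqx => ?_
        obtain ⟨m, hm⟩ := hord i
        rw [hm] at hqx
        exact ((Nat.prime_dvd_prime_iff_eq hq hp).1 (hq.dvd_of_dvd_pow hqx)).ge
    · rw [mem_productSeries_mul_add_succ]
      intro hall
      have h1 := hall j
      rw [if_pos le_rfl, mem_bigPart] at h1
      obtain ⟨m, hm⟩ := hord j
      have hm0 : m ≠ 0 := by
        rintro rfl
        exact hj (orderOf_eq_one_iff.1 (by simpa using hm))
      have := h1 p hp (hm ▸ dvd_pow_self p hm0)
      omega

end Product

/-! ### Pivot columns -/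

section Pivots

variable {ι K : Type*} [LinearOrder ι] [Finite ι] [Field K]

theorem exists_isLeading {v : ι → K} (hv : v ≠ 0) : ∃ j, IsLeading v j := by
  obtain ⟨j, hj⟩ := (Set.toFinite {i | v i ≠ 0}).exists_minimal (Function.ne_iff.1 hv)
  exact ⟨j, hj.1, fun i hij => by
    by_contra hi
    exact hij.not_ge (hj.2 hi hij.le)⟩

omit [Finite ι] in
theorem IsLeading.unique {v : ι → K} {i j : ι} (hi : IsLeading v i) (hj : IsLeading v j) :
    i = j := by
  rcases lt_trichotomy i j with h | h | h
  exacts [absurd (hj.2 i h) hi.1, h, absurd (hi.2 j h) hj.1]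

/-- The reduced basis vector of a subspace at a pivot. -/
theorem exists_reduced_vector (W : Submodule K (ι → K)) {j : ι} (hj : ∃ v ∈ W, IsLeading v j) :
    ∃ v ∈ W, v j = 1 ∧ ∀ i, (∃ w ∈ W, IsLeading w i) → i ≠ j → v i = 0 := by
  induction j using WellFoundedGT.induction with
  | ind j ih =>
    classical
    have := Fintype.ofFinite ι
    choose! e heW hej hei using ih
    obtain ⟨v, hv, hvj⟩ := hj
    let T : Finset ι := Finset.univ.filter fun i => j < i ∧ ∃ w ∈ W, IsLeading w i
    have hT : ∀ i ∈ T, j < i ∧ ∃ w ∈ W, IsLeading w i := fun i hi => (Finset.mem_filter.1 hi).2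
    -- Later pivots are cleared with their reduced vectors, known by downward induction; these
    -- vanish at `j` and at each other's pivots.
    let w := v - ∑ i ∈ T, v i • e i
    have hw : w ∈ W := sub_mem hv (sum_mem fun i hi => W.smul_mem _ (heW i (hT i hi).1 (hT i hi).2))
    have hwa : ∀ k, w k = v k - ∑ i ∈ T, v i * e i k := fun k => by simp [w]
    have hwj : w j = v j := by
      rw [hwa, Finset.sum_eq_zero, sub_zero]
      intro i hi
      rw [hei i (hT i hi).1 (hT i hi).2 j ⟨v, hv, hvj⟩ (hT i hi).1.ne, mul_zero]
    refine ⟨(v j)⁻¹ • w, W.smul_mem _ hw, ?_, fun k hk hkj => ?_⟩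
    · rw [Pi.smul_apply, hwj, smul_eq_mul, inv_mul_cancel₀ hvj.1]
    · rw [Pi.smul_apply, smul_eq_mul]
      suffices w k = 0 by rw [this, mul_zero]
      rw [hwa]
      rcases lt_or_gt_of_ne hkj with hlt | hgt
      · rw [hvj.2 k hlt, Finset.sum_eq_zero, sub_zero]
        intro i hi
        rw [hei i (hT i hi).1 (hT i hi).2 k hk (hlt.trans (hT i hi).1).ne, mul_zero]
      · have hkT : k ∈ T := Finset.mem_filter.2 ⟨Finset.mem_univ _, hgt, hk⟩
        rw [Finset.sum_eq_single_of_mem k hkT, hej k hgt hk, mul_one, sub_self]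
        intro i hi hik
        rw [hei i (hT i hi).1 (hT i hi).2 k hk hik.symm, mul_zero]

/-- The pivot columns are the positions of the leading coordinates of the vectors of the span. -/
theorem mem_pivotColumns_iff (S : Set (ι → K)) (j : ι) :
    j ∈ pivotColumns S ↔ ∃ v ∈ Submodule.span K S, IsLeading v j := by
  constructor
  · rintro ⟨k, M, -, hspan, a, ha⟩
    exact ⟨M a, hspan ▸ Submodule.subset_span ⟨a, rfl⟩, ha⟩
  · intro hj
    classical
    have := Fintype.ofFinite ι
    set W := Submodule.span K S with hW
    let T : Finset ι := Finset.univ.filter fun i => ∃ w ∈ W, IsLeading w i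
    have hT : ∀ i, i ∈ T ↔ ∃ w ∈ W, IsLeading w i := fun i => by simp [T]
    let f := T.orderIsoOfFin rfl
    have hf : ∀ a, ∃ w ∈ W, IsLeading w (f a : ι) := fun a => (hT _).1 (f a).2
    choose e heW hej hei using fun a => exists_reduced_vector W (hf a)
    have lead : ∀ v ∈ W, v ≠ 0 → ∃ b, IsLeading v (f b : ι) := fun v hv hv0 => by
      obtain ⟨i, hi⟩ := exists_isLeading hv0
      obtain ⟨b, hb⟩ := f.surjective ⟨i, (hT i).2 ⟨v, hv, hi⟩⟩
      exact ⟨b, by rw [hb]; exact hi⟩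
    have hne : ∀ a, e a ≠ 0 := fun a h => by
      have := hej a
      rw [h] at this
      exact zero_ne_one this
    have hei' : ∀ a b, b ≠ a → e a (f b) = 0 := fun a b hab =>
      hei a _ (hf b) fun h => hab (f.injective (Subtype.ext h))
    have hlead : ∀ a, IsLeading (e a) (f a : ι) := fun a => by
      obtain ⟨b, hb⟩ := lead (e a) (heW a) (hne a)
      by_cases hab : b = a
      · rwa [hab] at hb
      · exact absurd (hei' a b hab) hb.1
    obtain ⟨a, ha⟩ := f.surjective ⟨j, (hT j).2 hj⟩
    refine ⟨_, Matrix.of e, ⟨?_, ?_, ?_, ?_⟩, le_antisymm ?_ ?_, a, ?_⟩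
    · intro a j hj
      rw [hj.unique (hlead a)]
      exact hej a
    · intro a j hj b hb
      rw [hj.unique (hlead a)]
      exact hei' b a hb.symm
    · intro a b i j hab hi hj
      rw [hi.unique (hlead a), hj.unique (hlead b)]
      exact f.strictMono hab
    · intro a b _ h
      exact absurd h (hne a)
    · rw [Submodule.span_le]
      rintro _ ⟨a, rfl⟩
      exact heW a
    · intro w hw
      have hsum : ∑ a, w (f a) • e a ∈ Submodule.span K (Set.range (Matrix.of e)) :=
        sum_mem fun a _ => Submodule.smul_mem _ _ (Submodule.subset_span ⟨a, rfl⟩)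
      suffices w = ∑ a, w (f a) • e a by rw [this]; exact hsum
      -- The difference vanishes at every pivot, whereas a nonzero vector of `W` has its leading
      -- coordinate at one.
      by_contra hne'
      obtain ⟨b, hb⟩ := lead (w - ∑ a, w (f a) • e a)
        (sub_mem hw (sum_mem fun a _ => W.smul_mem _ (heW a))) (sub_ne_zero.2 hne')
      apply hb.1
      rw [Pi.sub_apply, Finset.sum_apply, Finset.sum_eq_single b]
      · rw [Pi.smul_apply, hej, smul_eq_mul, mul_one, sub_self]
      · intro a _ hab
        rw [Pi.smul_apply, hei' a b hab.symm, smul_zero]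
      · intro h
        exact absurd (Finset.mem_univ b) h
    · have := hlead a
      rw [ha] at this
      exact this

end Pivots

theorem exists_conj_mem_sylow {G : Type*} [Group G] [Finite G] {p : ℕ} [Fact p.Prime]
    (P : Sylow p G) {x : G} {k : ℕ} (hx : x ^ p ^ k = 1) : ∃ g, g * x * g⁻¹ ∈ P := by
  have hz : IsPGroup p (Subgroup.zpowers x) := by
    apply IsPGroup.of_card_dvd_pow (n := k)
    rw [Nat.card_zpowers]
    exact orderOf_dvd_of_pow_eq_one hx
  obtain ⟨Q, hQ⟩ := hz.exists_le_sylow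
  obtain ⟨g, hg⟩ := MulAction.exists_smul_eq G Q P
  refine ⟨g, ?_⟩
  rw [← hg, ← SetLike.mem_coe, Sylow.coe_smul]
  exact Set.smul_mem_smul_set (hQ (Subgroup.mem_zpowers x))

/-! ### The invariants `I^p(H)` in terms of leading coordinates -/

section PivotData

variable {r : ℕ} {Γ : Fin r → Type*} [∀ i, Group (Γ i)]

theorem apply_pow_prime_eq_one (hΓ : ∀ i, Squarefree (Nat.card (Γ i))) {p : ℕ} (hp : p.Prime)
    {x : ∀ i, Γ i} {k : ℕ} (hx : x ^ p ^ k = 1) (i : Fin r) : x i ^ p = 1 := by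
  have := Fact.mk hp
  have hz : IsPGroup p (Subgroup.zpowers (x i)) := by
    apply IsPGroup.of_card_dvd_pow (n := k)
    rw [Nat.card_zpowers]
    refine orderOf_dvd_of_pow_eq_one ?_
    rw [← Pi.pow_apply, hx]
    rfl
  have := card_dvd_prime_of_isPGroup (hΓ i) hz
  rw [Nat.card_zpowers] at this
  exact orderOf_dvd_iff_pow_eq_one.1 this

/-- A Sylow subgroup of a product contains the coordinates of its elements. -/
theorem mulSingle_mem_sylow [∀ i, Finite (Γ i)] {p : ℕ} [Fact p.Prime] (P : Sylow p (∀ i, Γ i))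
    {g : ∀ i, Γ i} (hg : g ∈ P) (i : Fin r) : MonoidHom.mulSingle Γ i (g i) ∈ P := by
  -- The product of the projections of `P` is a `p`-group containing `P`, hence equal to `P` by
  -- maximality.
  let Q : Subgroup (∀ i, Γ i) := 
    Subgroup.pi Set.univ fun i => (P : Subgroup _).map (Pi.evalMonoidHom Γ i)
  have memQ : ∀ x, x ∈ Q ↔ ∀ i, ∃ g ∈ P, g i = x i := fun x => by
    simp only [Q, Subgroup.mem_pi, Set.mem_univ, forall_const, Subgroup.mem_map]
    rfl
  obtain ⟨n, hn⟩ := P.2.exists_card_eq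
  have hQ : IsPGroup p Q := fun ⟨x, hx⟩ => ⟨n, Subtype.ext <| funext fun i => by
    obtain ⟨g, hg, hgi⟩ := (memQ x).1 hx i
    have : g ^ p ^ n = 1 := by
      rw [← hn]
      exact congrArg Subtype.val (pow_card_eq_one' (x := (⟨g, hg⟩ : P.toSubgroup)))
    change x i ^ p ^ n = 1
    rw [← hgi, ← Pi.pow_apply, this]
    rfl⟩
  have hPQ : Q = P.toSubgroup := P.3 hQ fun x hx => (memQ x).2 fun i => ⟨x, hx, rfl⟩
  change _ ∈ P.toSubgroup
  rw [← hPQ, memQ]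
  intro k
  by_cases hk : k = i
  · subst hk
    exact ⟨g, hg, by simp⟩
  · exact ⟨1, one_mem _, by simp [Pi.mulSingle_eq_of_ne hk]⟩

namespace PivotData

variable {p : Nat.Primes} {H : Subgroup (∀ i, Γ i)} (D : PivotData Γ p H)

theorem mulSingle_e_mem (i) : MonoidHom.mulSingle Γ i.1 (D.e i) ∈ D.Gstar := by
  have : MonoidHom.mulSingle Γ i.1 (D.e i) ∈
      (D.Gstar : Subgroup (∀ i, Γ i)) ⊓ (MonoidHom.mulSingle Γ i.1).range := by
    rw [← D.zpowers_e i]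
    exact Subgroup.mem_zpowers _
  exact this.1

variable (hΓ : ∀ i, Squarefree (Nat.card (Γ i)))
include hΓ

/-- The order divides `p` by square-freeness. It is not `1`: an element of order `p` in the factor
is conjugate into `Gstar`, and conjugation does not leave the factor. -/
theorem orderOf_e (i) : orderOf (D.e i) = p := by
  have := Fact.mk p.2
  have hfin : ∀ i, Finite (Γ i) := fun i => Nat.finite_of_card_ne_zero (hΓ i).ne_zero
  refine orderOf_eq_prime ?_ fun h1 => ?_
  · obtain ⟨k, hk⟩ := D.Gstar.2 ⟨_, D.mulSingle_e_mem i⟩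
    have := apply_pow_prime_eq_one hΓ p.2 (congrArg Subtype.val hk) i.1
    simpa using this
  · obtain ⟨y, hy⟩ := exists_prime_orderOf_dvd_card' (p : ℕ) i.2
    have hy1 : MonoidHom.mulSingle Γ i.1 y ^ (p : ℕ) ^ 1 = 1 := by
      rw [← map_pow, pow_one, orderOf_dvd_iff_pow_eq_one.1 hy.dvd, map_one]
    obtain ⟨g, hg⟩ := exists_conj_mem_sylow D.Gstar hy1
    have hgr : g * MonoidHom.mulSingle Γ i.1 y * g⁻¹ =
        MonoidHom.mulSingle Γ i.1 (g i.1 * y * (g i.1)⁻¹) := by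
      ext k
      by_cases hk : k = i.1
      · subst hk; simp
      · simp [Pi.mulSingle_eq_of_ne hk]
    have : MonoidHom.mulSingle Γ i.1 (g i.1 * y * (g i.1)⁻¹) ∈
        (D.Gstar : Subgroup (∀ i, Γ i)) ⊓ (MonoidHom.mulSingle Γ i.1).range :=
      ⟨hgr ▸ hg, _, rfl⟩
    rw [← D.zpowers_e i, h1, map_one, Subgroup.zpowers_one_eq_bot, Subgroup.mem_bot] at this
    have h2 := congrFun this i.1
    simp only [MonoidHom.mulSingle_apply, Pi.mulSingle_eq_same, Pi.one_apply, conj_eq_one_iff] at h2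
    rw [h2, orderOf_one] at hy
    exact p.2.ne_one hy.symm

theorem e_pow_val_add (i) (a b : ZMod p) :
    D.e i ^ (a + b).val = D.e i ^ a.val * D.e i ^ b.val := by
  have := Fact.mk p.2
  have h1 : D.e i ^ (p : ℕ) = 1 := orderOf_dvd_iff_pow_eq_one.1 (D.orderOf_e hΓ i).dvd
  rw [ZMod.val_add, ← pow_eq_pow_mod _ h1, pow_add]

theorem e_pow_val_mul (i) (a b : ZMod p) :
    D.e i ^ (a * b).val = (D.e i ^ b.val) ^ a.val := by
  have := Fact.mk p.2
  have h1 : D.e i ^ (p : ℕ) = 1 := orderOf_dvd_iff_pow_eq_one.1 (D.orderOf_e hΓ i).dvd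
  rw [ZMod.val_mul, ← pow_eq_pow_mod _ h1, ← pow_mul, mul_comm]

theorem e_pow_val_eq_one_iff (i) (a : ZMod p) : D.e i ^ a.val = 1 ↔ a = 0 := by
  have := Fact.mk p.2
  rw [← orderOf_dvd_iff_pow_eq_one, D.orderOf_e hΓ i]
  refine ⟨fun h => ?_, fun h => by simp [h]⟩
  exact (ZMod.val_eq_zero a).1 (Nat.eq_zero_of_dvd_of_lt h a.val_lt)

/-- Products and powers in `H*` correspond to sums and multiples of coordinate vectors, so these
already form a subspace. -/
theorem span_coords : (Submodule.span (ZMod p) D.coords : Set _) = D.coords := by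
  have := Fact.mk p.2
  let W : Submodule (ZMod p) ({i : Fin r // (p : ℕ) ∣ Nat.card (Γ i)} → ZMod p) :=
    { carrier := D.coords
      zero_mem' := ⟨1, one_mem _, fun i => by split_ifs <;> simp⟩
      add_mem' := by
        rintro α β ⟨h, hh, hα⟩ ⟨h', hh', hβ⟩
        refine ⟨h * h', mul_mem hh hh', fun i => ?_⟩
        rw [Subgroup.coe_mul, Pi.mul_apply, hα, hβ]
        split_ifs with hi
        · rw [Pi.add_apply, D.e_pow_val_add hΓ]
        · simp
      smul_mem' := by
        rintro c α ⟨h, hh, hα⟩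
        refine ⟨h ^ c.val, pow_mem hh _, fun i => ?_⟩
        rw [Subgroup.coe_pow, Pi.pow_apply, hα]
        split_ifs with hi
        · rw [Pi.smul_apply, smul_eq_mul, D.e_pow_val_mul hΓ]
        · simp }
  exact congrArg (SetLike.coe) (Submodule.span_eq W)

/-- Each coordinate of an element of `Gstar` lies, as an element of the product, in `Gstar` again,
hence in the group generated by `e i`. Coordinates in factors of order prime to `p` are trivial. -/
theorem exists_coords (h : H) (hh : h ∈ (D.Hstar : Subgroup H)) : ∃ α ∈ D.coords, ∀ i : Fin r,
    (h : ∀ i, Γ i) i = if hi : (p : ℕ) ∣ Nat.card (Γ i) then D.e ⟨i, hi⟩ ^ (α ⟨i, hi⟩).val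
      else 1 := by
  have := Fact.mk p.2
  have hfin : ∀ i, Finite (Γ i) := fun i => Nat.finite_of_card_ne_zero (hΓ i).ne_zero
  have hG : (h : ∀ i, Γ i) ∈ D.Gstar := D.Hstar_le ⟨h, hh, rfl⟩
  have hex : ∀ i : {i : Fin r // (p : ℕ) ∣ Nat.card (Γ i)}, ∃ a : ZMod p,
      (h : ∀ i, Γ i) i.1 = D.e i ^ a.val := fun i => by
    have hm : MonoidHom.mulSingle Γ i.1 ((h : ∀ i, Γ i) i.1) ∈
        Subgroup.zpowers (MonoidHom.mulSingle Γ i.1 (D.e i)) := by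
      rw [D.zpowers_e i]
      exact ⟨mulSingle_mem_sylow D.Gstar hG i.1, _, rfl⟩
    rw [← mem_powers_iff_mem_zpowers] at hm
    obtain ⟨n, hn⟩ := hm
    have hn : MonoidHom.mulSingle Γ i.1 (D.e i) ^ n =
      MonoidHom.mulSingle Γ i.1 ((h : ∀ i, Γ i) i.1) := hn
    refine ⟨n, ?_⟩
    have h1 : D.e i ^ (p : ℕ) = 1 := orderOf_dvd_iff_pow_eq_one.1 (D.orderOf_e hΓ i).dvd
    rw [ZMod.val_natCast, ← pow_eq_pow_mod _ h1]
    rw [← map_pow] at hn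
    simpa using (congrFun hn i.1).symm
  choose α hα using hex
  have key : ∀ i : Fin r, (h : ∀ i, Γ i) i =
      if hi : (p : ℕ) ∣ Nat.card (Γ i) then D.e ⟨i, hi⟩ ^ (α ⟨i, hi⟩).val else 1 := fun i => by
    split_ifs with hi
    · exact hα ⟨i, hi⟩
    · obtain ⟨k, hk⟩ := D.Gstar.2 ⟨_, hG⟩
      have h1 := apply_pow_prime_eq_one hΓ p.2 (congrArg Subtype.val hk) i
      rw [← orderOf_dvd_iff_pow_eq_one] at h1
      rcases (Nat.dvd_prime p.2).1 h1 with h2 | h2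
      · exact orderOf_eq_one_iff.1 h2
      · exact absurd (h2 ▸ orderOf_dvd_natCard _) hi
  exact ⟨α, ⟨h, hh, key⟩, key⟩

/-- The description is free of choices: every `p`-element of `H` is conjugate in `H` into `H*`, and
conjugation preserves which coordinates are trivial. -/
theorem mem_pivots_iff (j : Fin r) : j ∈ D.pivots ↔
    ∃ h ∈ H, (∃ k, h ^ (p : ℕ) ^ k = 1) ∧ (∀ i < j, h i = 1) ∧ h j ≠ 1 := by
  have := Fact.mk p.2
  have hfin : ∀ i, Finite (Γ i) := fun i => Nat.finite_of_card_ne_zero (hΓ i).ne_zero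
  have hspan : ∀ v, v ∈ Submodule.span (ZMod p) D.coords ↔ v ∈ D.coords := fun v => by
    rw [← SetLike.mem_coe, D.span_coords hΓ]
  constructor
  · rintro ⟨j, hj, rfl⟩
    obtain ⟨α, hα, hlead⟩ := (mem_pivotColumns_iff _ _).1 hj
    obtain ⟨h, hh, hα⟩ := (hspan α).1 hα
    refine ⟨h, h.2, ?_, fun i hi => ?_, ?_⟩
    · obtain ⟨k, hk⟩ := D.Hstar.2 ⟨h, hh⟩
      exact ⟨k, by simpa using congrArg (fun x => (x.1.1 : ∀ i, Γ i)) hk⟩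
    · rw [hα i]
      split_ifs with hi'
      · rw [D.e_pow_val_eq_one_iff hΓ]
        exact hlead.2 ⟨i, hi'⟩ hi
      · rfl
    · rw [hα j, dif_pos j.2, Ne, D.e_pow_val_eq_one_iff hΓ]
      exact hlead.1
  · rintro ⟨h, hH, ⟨k, hk⟩, hlt, hj⟩
    have hk' : (⟨h, hH⟩ : H) ^ (p : ℕ) ^ k = 1 := Subtype.ext hk
    obtain ⟨g, hg⟩ := exists_conj_mem_sylow D.Hstar hk'
    obtain ⟨α, hα, hαh⟩ := D.exists_coords hΓ _ hg
    have hconj : ∀ i, (((g * ⟨h, hH⟩ * g⁻¹ : H) : ∀ i, Γ i) i = 1 ↔ h i = 1) := fun i => by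
      simp
    have hjp : (p : ℕ) ∣ Nat.card (Γ j) := by
      by_contra hn
      have := hαh j
      rw [dif_neg hn, hconj] at this
      exact hj this
    refine ⟨⟨j, hjp⟩, (mem_pivotColumns_iff _ _).2 ⟨α, (hspan α).2 hα, ?_, fun i hi => ?_⟩, rfl⟩
    · rw [Ne, ← D.e_pow_val_eq_one_iff hΓ ⟨j, hjp⟩]
      have := hαh j
      rw [dif_pos hjp] at this
      rw [← this, hconj]
      exact hj
    · rw [← D.e_pow_val_eq_one_iff hΓ i]
      have := hαh i
      rw [dif_pos i.2] at this
      rw [← this, hconj]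
      exact hlt i hi

end PivotData

end PivotData

/-! ### Relative indices across covers -/

theorem index_eq_relIndex_of_sup_eq_top {G : Type*} [Group G] [Finite G] {K L : Subgroup G}
    [L.Normal] (h : K ⊔ L = ⊤) : K.index = K.relIndex L := by
  have h1 : L.index = L.relIndex K := by
    rw [← Subgroup.relIndex_top_right, ← h, Subgroup.relIndex_sup_right]
  have h2 := K.card_mul_index
  have h3 := L.card_mul_index
  have h4 := Subgroup.relIndex_mul_relIndex ⊥ (K ⊓ L) L bot_le inf_le_right
  have h5 := Subgroup.relIndex_mul_relIndex ⊥ (K ⊓ L) K bot_le inf_le_left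
  rw [Subgroup.inf_relIndex_right, Subgroup.relIndex_bot_left, Subgroup.relIndex_bot_left] at h4
  rw [Subgroup.inf_relIndex_left, Subgroup.relIndex_bot_left, Subgroup.relIndex_bot_left] at h5
  have hpos : 0 < Nat.card K := Nat.card_pos
  apply Nat.eq_of_mul_eq_mul_left hpos
  rw [h2, ← h3, h1, ← h4, ← h5]
  ring

theorem relIndex_eq_relIndex_inf {G : Type*} [Group G] [Finite G] {H₁ H₀ N : Subgroup G}
    [N.Normal] (h : H₁ ≤ H₀) (hsup : H₁ ⊔ (H₀ ⊓ N) = H₀) :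
    H₁.relIndex H₀ = H₁.relIndex (H₀ ⊓ N) := by
  have hN : N.subgroupOf H₀ = (H₀ ⊓ N).subgroupOf H₀ := by
    rw [inf_comm, Subgroup.inf_subgroupOf_right]
  have h1 : H₁.subgroupOf H₀ ⊔ N.subgroupOf H₀ = ⊤ := by
    rw [hN, ← Subgroup.subgroupOf_sup h inf_le_left, hsup,
      Subgroup.subgroupOf_self]
  rw [Subgroup.relIndex, index_eq_relIndex_of_sup_eq_top h1, hN, Subgroup.relIndex_subgroupOf inf_le_left]

/-- The index can be computed inside `N t`, since `H₀ = H₁ (H₀ ∩ N t)`. It is then the order of the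
image of `H₀ ∩ N t` in `N t / N (t + 1)`, a nontrivial cyclic group killed by `p`. -/
theorem ComplementedSeries.relIndex_eq {G : Type*} [Group G] [Finite G] {C : ComplementedSeries G}
    {H₁ H₀ : Subgroup G} (h : H₁ ≤ H₀) {t p : ℕ} (hp : p.Prime) (ht : t ∉ C.J H₁)
    (hJ : C.J H₀ = insert t (C.J H₁)) (hpow : ∀ g ∈ C.N t, g ^ p ∈ C.N (t + 1)) :
    H₁.relIndex H₀ = p := by
  have hN := C.normal t
  have hN' := C.normal (t + 1)
  rw [relIndex_eq_relIndex_inf (N := C.N t) h (mid_eq (C := C) h fun s hs hs' => by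
    rw [hJ] at hs
    exact (hs.resolve_right hs').ge)]
  have hinf : H₁ ⊓ (H₀ ⊓ C.N t) = C.N (t + 1) ⊓ (H₀ ⊓ C.N t) := by
    apply le_antisymm
    · rintro x ⟨h1, h2, h3⟩
      refine ⟨?_, h2, h3⟩
      by_contra h4
      exact ht ⟨x, h1, h3, h4⟩
    · rintro x ⟨h1, h2, h3⟩
      refine ⟨inf_N_le (C := C) h (t + 1) (fun s hs hts => ?_) ⟨h2, h1⟩, h2, h3⟩
      rw [hJ] at hs
      exact hs.resolve_left (by omega)
  rw [← Subgroup.inf_relIndex_right, hinf, Subgroup.inf_relIndex_right]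
  obtain ⟨g, hg, hgt, hgt'⟩ : t ∈ C.J H₀ := hJ ▸ Set.mem_insert _ _
  have hmap : (H₀ ⊓ C.N t).map (QuotientGroup.mk' (C.N (t + 1))) =
      Subgroup.zpowers (QuotientGroup.mk' (C.N (t + 1)) g) := by
    apply le_antisymm
    · rintro _ ⟨x, ⟨-, hx⟩, rfl⟩
      obtain ⟨m, hm⟩ := exists_zpow_mul_mem_succ hgt hgt' hx
      have := (QuotientGroup.eq_one_iff _).2 hm
      refine ⟨-m, ?_⟩
      have h1 : (QuotientGroup.mk' (C.N (t + 1)) g) ^ m * QuotientGroup.mk' (C.N (t + 1)) x = 1 := by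
        rw [← map_zpow, ← map_mul]
        exact this
      dsimp only
      rw [zpow_neg]
      exact inv_eq_of_mul_eq_one_right h1
    · rw [Subgroup.zpowers_le]
      exact ⟨g, ⟨hg, hgt⟩, rfl⟩
  have hker := Subgroup.relIndex_ker (K := H₀ ⊓ C.N t) (QuotientGroup.mk' (C.N (t + 1)))
  rw [QuotientGroup.ker_mk'] at hker
  rw [hker, hmap, Nat.card_zpowers]
  have := Fact.mk hp
  refine orderOf_eq_prime ?_ fun h1 => hgt' ((QuotientGroup.eq_one_iff _).1 h1)
  rw [← map_pow]
  exact (QuotientGroup.eq_one_iff _).2 (hpow g hgt)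

/-! ### The explicit labeling as an abstract labeling of the series -/

namespace LabelingData

variable {r : ℕ} {Γ : Fin r → Type*} [∀ i, Group (Γ i)] (hΓ : ∀ i, Squarefree (Nat.card (Γ i)))
  (D : LabelingData Γ)

/-- Both sides say that `K` contains a `p`-element whose first nontrivial coordinate is `j`. -/
theorem mul_add_mem_J_series_iff (K : Subgroup (∀ i, Γ i)) (p : Nat.Primes) (j : Fin r) :
    p * r + j ∈ (D.series hΓ).J K ↔ j ∈ D.I p K :=
  (exists_mem_productSeries_iff K p.2 j).trans ((D.pivot p K).mem_pivots_iff hΓ j).symm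

theorem exists_of_mem_J_series {K : Subgroup (∀ i, Γ i)} {t : ℕ} (ht : t ∈ (D.series hΓ).J K) :
    ∃ (p : Nat.Primes) (j : Fin r), t = p * r + j ∧ (p : ℕ) ∣ Nat.card (∀ i, Γ i) := by
  obtain ⟨x, -, hx, hx'⟩ := ht
  obtain ⟨p, j, hp, h, -, -, hd⟩ := exists_of_mem_productSeries hx hx'
  exact ⟨⟨p, hp⟩, j, h, (hd.trans (orderOf_map_dvd (Pi.evalMonoidHom Γ j) x)).trans
    (orderOf_dvd_natCard x)⟩

theorem mul_add_injective {p q : Nat.Primes} {i j : Fin r}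
    (h : (p : ℕ) * r + i = q * r + j) : p = q ∧ i = j := by
  have h1 := mul_add_div_mod (p := p) i
  have h2 := mul_add_div_mod (p := q) j
  rw [h] at h1
  exact ⟨Subtype.ext (h1.1.symm.trans h2.1), Fin.ext (h1.2.symm.trans h2.2)⟩

theorem isType_of_J {K₁ K₀ : Subgroup (∀ i, Γ i)} (x : ∀ i, Γ i) (h : K₁ ≤ K₀) (p : Nat.Primes)
    (j : Fin r) (ht : p * r + j ∉ (D.series hΓ).J K₁)
    (hJ : (D.series hΓ).J K₀ = insert (p * r + j : ℕ) ((D.series hΓ).J K₁)) :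
    D.IsType (rightCoset K₀ x) (rightCoset K₁ x) (p, j) := by
  have hfin : ∀ i, Finite (Γ i) := fun i => Nat.finite_of_card_ne_zero (hΓ i).ne_zero
  rw [IsType, stabilizer_rightCoset, stabilizer_rightCoset]
  refine ⟨ComplementedSeries.relIndex_eq h p.2 ht hJ fun g hg => ?_,
    (D.mul_add_mem_J_series_iff hΓ K₁ p j).not.1 ht, Set.ext fun i => ?_⟩
  · exact pow_mem_productSeries p.2 hg
  · rw [← D.mul_add_mem_J_series_iff hΓ, hJ, Set.mem_insert_iff, Set.mem_union,
      Set.mem_singleton_iff, D.mul_add_mem_J_series_iff hΓ, or_comm]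
    refine or_congr_right ⟨fun h => (mul_add_injective h).2, ?_⟩
    rintro rfl
    rfl

theorem IsType.unique {A B : Set (∀ i, Γ i)} {s t : Nat.Primes × Fin r} (hs : D.IsType A B s)
    (ht : D.IsType A B t) : s = t := by
  obtain ⟨p, i⟩ := s
  obtain ⟨q, j⟩ := t
  obtain ⟨h1, h2, h3⟩ := hs
  obtain ⟨h4, h5, h6⟩ := ht
  obtain rfl : p = q := Subtype.ext (h1.symm.trans h4)
  have : i ∈ D.I p (MulAction.stabilizer (∀ i, Γ i) A) := h3 ▸ Or.inr rfl
  rw [h6] at this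
  rw [this.resolve_left h2]

open Classical in
theorem label_eq {A B : Set (∀ i, Γ i)} (hB : B.Nonempty) {p : Nat.Primes} {j : Fin r}
    (h : D.IsType A B (p, j)) :
    D.label A B = if B = A ∩ D.M p j then -(D.l p j : ℤ) else (D.l p j : ℤ) := by
  have hex : ∃ t, D.IsType A B t := ⟨_, h⟩
  have hch : hex.choose = (p, j) := IsType.unique D hex.choose_spec h
  rw [label, if_neg hB.ne_empty, dif_pos hex, hch]

theorem image_rightCoset {G G' : Type*} [Group G] [Group G'] (φ : G →* G') (H : Subgroup G)
    (x : G) : φ '' rightCoset H x = rightCoset (H.map φ) (φ x) := by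
  simp only [rightCoset, Subgroup.coe_map, Set.image_image, map_mul]

/-- The type of a cover is the position removed from `J`, and the order of the positions `p * r + j`
is the lexicographic order of the pairs. Injectivity of `φ` allows the test against `M_{p,j}` to be
made in `G`. -/
theorem isLabel {G : Type*} [Group G] (φ : G →* ∀ i, Γ i) (hφ : Function.Injective φ) :
    ((D.series hΓ).comap φ hφ).IsLabel D.posL fun A B => D.label (φ '' A) (φ '' B) where
  pos t ht := by
    rw [ComplementedSeries.J_comap] at ht
    obtain ⟨p, j, rfl, hp⟩ := D.exists_of_mem_J_series hΓ ht
    rw [D.posL_mul_add]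
    exact_mod_cast D.l_pos p j hp
  lt s hs t ht hst := by
    rw [ComplementedSeries.J_comap] at hs ht
    obtain ⟨p, i, rfl, hp⟩ := D.exists_of_mem_J_series hΓ hs
    obtain ⟨q, j, rfl, hq⟩ := D.exists_of_mem_J_series hΓ ht
    rw [D.posL_mul_add, D.posL_mul_add]
    refine Int.ofNat_lt.2 (D.l_lt p q i j hp hq ?_)
    rcases lt_trichotomy (p : ℕ) q with h | h | h
    · exact Or.inl h
    · obtain rfl : p = q := Subtype.ext h
      exact Or.inr ⟨rfl, by
        change (i : ℕ) < j
        omega⟩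
    · have h1 := Nat.mul_le_mul_right r (Nat.succ_le_of_lt h)
      rw [Nat.succ_mul] at h1
      have := i.2
      have := j.2
      omega
  empty A := by
    simp [label]
  cover H₁ H₀ x t h ht hJ := by
    classical
    rw [ComplementedSeries.J_comap] at ht
    rw [ComplementedSeries.J_comap, ComplementedSeries.J_comap] at hJ
    obtain ⟨p, j, rfl, hp⟩ := D.exists_of_mem_J_series hΓ (K := H₀.map φ)
      (hJ ▸ Set.mem_insert _ _)
    have htype := D.isType_of_J hΓ (φ x) (Subgroup.map_mono h) p j ht hJ
    have hlab := D.label_eq ⟨_, self_mem_rightCoset _ _⟩ htype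
    rw [D.posL_mul_add, image_rightCoset, image_rightCoset, hlab]
    have hiff : rightCoset H₁ x = rightCoset H₀ x ∩
        ((D.series hΓ).comap φ hφ).M (p * r + j) ↔
        rightCoset (H₁.map φ) (φ x) = rightCoset (H₀.map φ) (φ x) ∩ D.M p j := by
      rw [← image_rightCoset, ← image_rightCoset, ← Set.image_inter_preimage,
        hφ.image_injective.eq_iff]
      change _ = _ ∩ ((D.posM (p * r + j)).comap φ : Set G) ↔ _
      rw [D.posM_mul_add]
      rfl
    by_cases hM : rightCoset (H₁.map φ) (φ x) = rightCoset (H₀.map φ) (φ x) ∩ D.M p j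
    · exact Or.inl ⟨hiff.2 hM, if_pos hM⟩
    · exact Or.inr ⟨fun h => hM (hiff.1 h), if_neg hM⟩

theorem isLocalEL (hΓ : ∀ i, Squarefree (Nat.card (Γ i))) {G : Type*} [Group G]
    (φ : G →* ∀ i, Γ i) (hφ : Function.Injective φ) :
    IsLocalEL (P := (CosetLattice G)ᵒᵈ)
      fun a b => D.labelVia φ (OrderDual.ofDual a) (OrderDual.ofDual b) :=
  (D.isLabel hΓ φ hφ).isLocalEL

end LabelingData

/-! ### Existence of the choices -/

section Existence

variable {r : ℕ} {Γ : Fin r → Type*} [∀ i, Group (Γ i)] (hΓ : ∀ i, Squarefree (Nat.card (Γ i)))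
include hΓ

/-- In a group of square-free order every `p`-subgroup is cyclic, so the part of `G*` in each factor
has a generator. -/
theorem nonempty_pivotData (p : Nat.Primes) (H : Subgroup (∀ i, Γ i)) :
    Nonempty (PivotData Γ p H) := by
  have := Fact.mk p.2
  have hfin : ∀ i, Finite (Γ i) := fun i => Nat.finite_of_card_ne_zero (hΓ i).ne_zero
  obtain ⟨Q⟩ : Nonempty (Sylow p H) := inferInstance
  obtain ⟨P, hP⟩ := (Q.2.map H.subtype).exists_le_sylow
  have hex : ∀ i : Fin r, ∃ e : Γ i, Subgroup.zpowers (MonoidHom.mulSingle Γ i e) =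
      (P : Subgroup (∀ i, Γ i)) ⊓ (MonoidHom.mulSingle Γ i).range := fun i => by
    have : IsZGroup (Γ i) := IsZGroup.of_squarefree (hΓ i)
    have hcyc : IsCyclic ((P : Subgroup (∀ i, Γ i)).comap (MonoidHom.mulSingle Γ i)) :=
      IsPGroup.isCyclic_of_isZGroup (P.2.comap_of_injective _ (Pi.mulSingle_injective i))
    obtain ⟨e, he⟩ := (Subgroup.isCyclic_iff_exists_zpowers_eq_top _).1 hcyc
    refine ⟨e, ?_⟩
    rw [← MonoidHom.map_zpowers, he, Subgroup.map_comap_eq, inf_comm]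
  choose e he using hex
  exact ⟨⟨P, Q, hP, fun i => e i, fun i => he i⟩⟩

theorem nonempty_labelingData : Nonempty (LabelingData Γ) := by
  have hM : ∀ (p : Nat.Primes) (i : Fin r), ∃ M : Subgroup (Γ i),
      (p : ℕ) ∣ Nat.card (Γ i) → M.index = p := fun p i => by
    by_cases hp : (p : ℕ) ∣ Nat.card (Γ i)
    · obtain ⟨M, hM⟩ := exists_index_eq (hΓ i) p.2 hp
      exact ⟨M, fun _ => hM⟩
    · exact ⟨⊥, fun h => absurd h hp⟩
  choose M hM using hM
  refine ⟨⟨fun p H => (nonempty_pivotData hΓ p H).some, M, hM, fun p j => p * r + j + 1,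
    fun _ _ _ => Nat.succ_pos _, fun p q i j _ _ h => ?_⟩⟩
  rcases h with h | ⟨rfl, h⟩
  · have h1 := Nat.mul_le_mul_right r (Nat.succ_le_of_lt h)
    rw [Nat.succ_mul] at h1
    have := i.2
    omega
  · have : (i : ℕ) < j := h
    omega

end Existence

/-! ### Supersolvable groups -/

section Supersolvable

variable {G : Type*} [Group G]

/-- Trivial factors may be removed from a series. -/
theorem isSupersolvable_of_series (k : ℕ) (N : ℕ → Subgroup G) (h0 : N 0 = ⊥) (hk : N k = ⊤)
    (hn : ∀ i, (N i).Normal) (h : ∀ i < k, N i ≤ N (i + 1) ∧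
      ((N i).relIndex (N (i + 1)) = 1 ∨ ((N i).relIndex (N (i + 1))).Prime)) :
    IsSupersolvable G := by
  have key : ∀ j ≤ k, ∃ (m : ℕ) (N' : ℕ → Subgroup G), N' 0 = ⊥ ∧ N' m = N j ∧
      (∀ i, (N' i).Normal) ∧
        ∀ i < m, N' i ≤ N' (i + 1) ∧ ((N' i).relIndex (N' (i + 1))).Prime := by
    intro j hj
    induction j with
    | zero => exact ⟨0, N, h0, rfl, hn, by simp⟩
    | succ j ih =>
      obtain ⟨m, N', h1, h2, h3, h4⟩ := ih (by omega)
      obtain ⟨hle, hrel | hrel⟩ := h j (by omega)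
      · exact ⟨m, N', h1, h2.trans (le_antisymm hle (Subgroup.relIndex_eq_one.1 hrel)), h3, h4⟩
      · refine ⟨m + 1, fun i => if i ≤ m then N' i else N (j + 1), by simpa using h1, by simp,
          fun i => ?_, fun i hi => ?_⟩
        · dsimp only
          split_ifs
          exacts [h3 i, hn _]
        · rcases (Nat.lt_succ_iff.1 hi).eq_or_lt with rfl | hi
          · simp only [le_refl, if_true, Nat.succ_le_iff, lt_irrefl, if_false]
            rw [h2]
            exact ⟨hle, hrel⟩
          · simp only [hi.le, Nat.succ_le_of_lt hi, if_true]
            exact h4 i hi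
  obtain ⟨m, N', h1, h2, h3, h4⟩ := key k le_rfl
  exact ⟨m, N', h1, h2.trans hk, h3, h4⟩

theorem IsSupersolvable.of_surjective {G' : Type*} [Group G'] (h : IsSupersolvable G)
    (f : G →* G') (hf : Function.Surjective f) : IsSupersolvable G' := by
  obtain ⟨k, N, h1, h2, h3, h4⟩ := h
  refine isSupersolvable_of_series k (fun i => (N i).map f) ?_ ?_ (fun i => (h3 i).map f hf)
    fun i hi => ⟨Subgroup.map_mono (h4 i hi).1, ?_⟩
  · rw [h1, Subgroup.map_bot]
  · rw [h2, Subgroup.map_top_of_surjective f hf]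
  -- Indices of images divide the original primes, so a factor of the image series is trivial or of
  -- prime order.
  · have hd : ((N i).map f).relIndex ((N (i + 1)).map f) ∣ (N i).relIndex (N (i + 1)) := by
      rw [Subgroup.relIndex_map_map]
      have hsup : N (i + 1) ⊔ f.ker = N (i + 1) ⊔ (N i ⊔ f.ker) := by
        rw [← sup_assoc, sup_eq_left.2 (h4 i hi).1]
      have := h3 i
      rw [hsup, Subgroup.relIndex_sup_right]
      exact Subgroup.relIndex_dvd_of_le_left _ le_sup_left
    rcases (Nat.dvd_prime (h4 i hi).2).1 hd with h | h
    · exact Or.inl h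
    · rw [h]
      exact Or.inr (h4 i hi).2

theorem HasElementaryAbelianSylows.of_surjective [Finite G] {G' : Type*} [Group G']
    (h : HasElementaryAbelianSylows G) (f : G →* G') (hf : Function.Surjective f) :
    HasElementaryAbelianSylows G' := by
  intro p Q
  have := Fact.mk p.2
  obtain ⟨P, rfl⟩ := Sylow.mapSurjective_surjective hf p Q
  obtain ⟨h1, h2⟩ := h p P
  constructor
  · rintro _ ⟨x, hx, rfl⟩ _ ⟨y, hy, rfl⟩
    rw [← map_mul, h1 x hx y hy, map_mul]
  · rintro _ ⟨x, hx, rfl⟩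
    rw [← map_pow, h2 x hx, map_one]

theorem IsSupersolvable.exists_normal_prime_card [Nontrivial G] (h : IsSupersolvable G) :
    ∃ Z : Subgroup G, Z.Normal ∧ (Nat.card Z).Prime := by
  obtain ⟨k, N, h1, h2, h3, h4⟩ := h
  have hk : 0 < k := by
    rcases Nat.eq_zero_or_pos k with rfl | hk
    · exact absurd (h1.symm.trans h2) bot_ne_top
    · exact hk
  have := (h4 0 hk).2
  rw [h1, Subgroup.relIndex_bot_left] at this
  exact ⟨_, h3 1, this⟩

/-- In a supersolvable group, the Sylow subgroups of the largest prime are normal. -/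
theorem IsSupersolvable.sylow_normal [Finite G] (h : IsSupersolvable G) {q : ℕ} (hq : q.Prime)
    (hmax : ∀ ℓ, ℓ.Prime → ℓ ∣ Nat.card G → ℓ ≤ q) (P : Sylow q G) : (P : Subgroup G).Normal := by
  have := Fact.mk hq
  induction hc : Nat.card G using Nat.strong_induction_on generalizing G with
  | _ c ih =>
    subst hc
    rcases subsingleton_or_nontrivial G with hs | hn
    · exact ⟨fun x hx g => by rwa [Subsingleton.elim (g * x * g⁻¹) x]⟩
    obtain ⟨Z, hZ, hZp⟩ := h.exists_normal_prime_card
    have hcard : Nat.card (G ⧸ Z) < Nat.card G := by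
      rw [Subgroup.card_eq_card_quotient_mul_card_subgroup Z]
      exact lt_mul_of_one_lt_right Nat.card_pos hZp.one_lt
    have hsurj := QuotientGroup.mk'_surjective Z
    have hnor := ih _ hcard (h.of_surjective _ hsurj)
      (fun ℓ hℓ hd => hmax ℓ hℓ (hd.trans (Subgroup.card_quotient_dvd_card Z)))
      (P.mapSurjective hsurj) rfl
    -- `PZ` is the preimage of a Sylow subgroup of `G/Z`, normal by induction.
    have hL : ((P : Subgroup G) ⊔ Z).Normal := by
      have := hnor.comap (QuotientGroup.mk' Z)
      rwa [Sylow.coe_mapSurjective, Subgroup.comap_map_eq, QuotientGroup.ker_mk'] at this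
    by_cases hqZ : Nat.card Z = q
    · have hZq : IsPGroup q Z := IsPGroup.of_card (n := 1) (by rw [hqZ, pow_one])
      have := P.3 (P.2.to_sup_of_normal_right hZq) le_sup_left
      rwa [this] at hL
    · set L := (P : Subgroup G) ⊔ Z with hLdef
      have hPL : (P : Subgroup G) ≤ L := le_sup_left
      -- The number of Sylow `q`-subgroups of `PZ` divides the prime `|Z| < q` and is `1` modulo
      -- `q`. So it is `1`, and `P` is characteristic in `PZ`.
      have hdvd : Nat.card (Sylow q L) ∣ Nat.card Z := by
        refine (P.subtype hPL).card_dvd_index.trans ?_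
        rw [Sylow.coe_subtype]
        change (P : Subgroup G).relIndex L ∣ _
        rw [relIndex_eq_relIndex_inf (N := Z) hPL (le_antisymm (sup_le hPL inf_le_left)
          (sup_le_sup_left (le_inf le_sup_right le_rfl) _)), inf_eq_right.2 le_sup_right]
        exact Subgroup.relIndex_dvd_card _ _
      have hone : Nat.card (Sylow q L) = 1 := by
        refine ((Nat.dvd_prime hZp).1 hdvd).resolve_right fun heq => ?_
        have hmod := card_sylow_modEq_one q L
        rw [heq] at hmod
        have hle := hmax _ hZp Z.card_subgroup_dvd_card
        have : Nat.card Z = 1 := Nat.ModEq.eq_of_lt_of_lt hmod (by omega) hq.one_lt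
        exact hZp.ne_one this
      have hsub : Subsingleton (Sylow q L) := (Nat.card_eq_one_iff_unique.1 hone).1
      have hchar := Sylow.characteristic_of_subsingleton (P.subtype hPL)
      have : (((P.subtype hPL : Sylow q L) : Subgroup L).map L.subtype).Normal := inferInstance
      rwa [Sylow.coe_subtype, Subgroup.subgroupOf_map_subtype, inf_eq_left.2 hPL] at this

end Supersolvable

/-! ### Splitting off normal subgroups -/

section Splitting

theorem Submodule.exists_retraction {k A : Type*} [Field k] [AddCommGroup A] [Module k A]
    (W : Submodule k A) : ∃ f : A →+ A, (∀ x, f x ∈ W) ∧ ∀ w ∈ W, f w = w := by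
  obtain ⟨g, hg⟩ := W.subtype.exists_leftInverse_of_injective W.ker_subtype
  exact ⟨(W.subtype.comp g).toAddMonoidHom, fun x => (g x).2, fun w hw =>
    congrArg Subtype.val (LinearMap.congr_fun hg ⟨w, hw⟩)⟩

theorem exists_retraction {P : Type*} [CommGroup P] {p : ℕ} [Fact p.Prime] (hp : ∀ x : P, x ^ p = 1)
    (Z : Subgroup P) : ∃ f : P →* P, (∀ x, f x ∈ Z) ∧ ∀ z ∈ Z, f z = z := by
  let _ : Module (ZMod p) (Additive P) := AddCommGroup.zmodModule fun x => hp x.toMul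
  obtain ⟨f, hf1, hf2⟩ := Submodule.exists_retraction
    (AddSubgroup.toZModSubmodule p Z.toAddSubgroup)
  exact ⟨MonoidHom.toAdditive.symm f, fun x => hf1 (Additive.ofMul x),
    fun z hz => hf2 (Additive.ofMul z) hz⟩

/-- A normal subgroup of an elementary abelian normal subgroup of coprime index has a complement in
it that is normal in the whole group. -/
theorem exists_normal_inf_eq_bot {G : Type*} [Group G] [Finite G] {p : ℕ} [Fact p.Prime]
    {P Z : Subgroup G} [P.Normal] [Z.Normal] (hZP : Z ≤ P) (hcomm : ∀ x ∈ P, ∀ y ∈ P, x * y = y * x)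
    (hp : ∀ x ∈ P, x ^ p = 1) (hcop : (Nat.card P).Coprime P.index) (hpP : p ∣ Nat.card P) :
    ∃ K : Subgroup G, K.Normal ∧ K ⊓ Z = ⊥ ∧ (K = ⊥ → P = Z) := by
  classical
  let _ : CommGroup P := { mul_comm := fun a b => Subtype.ext (hcomm a a.2 b b.2) }
  obtain ⟨H, hH⟩ := Subgroup.exists_right_complement'_of_coprime hcop
  have := Fintype.ofFinite H
  obtain ⟨f, hfZ, hf⟩ := exists_retraction (P := P) (p := p) (fun x => Subtype.ext (hp x x.2))
    (Z.subgroupOf P)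
  let c : G →* MulAut P := MulAut.conjNormal
  -- Maschke averaging without division: the conjugates of a retraction onto `Z` are multiplied. On
  -- `Z` the result is the power map with exponent `|H|`, prime to `p`, so its kernel meets `Z`
  -- trivially.
  let F : P →* P := ∏ h : H, (c h).toMonoidHom.comp (f.comp (c (h : G)⁻¹).toMonoidHom)
  have hF : ∀ x, F x = ∏ h : H, c h (f (c (h : G)⁻¹ x)) := fun x => by
    simp [F]
  have hcZ : ∀ (g : G) (x : P), x ∈ Z.subgroupOf P → c g x ∈ Z.subgroupOf P := fun g x hx => by
    rw [Subgroup.mem_subgroupOf] at hx ⊢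
    rw [MulAut.conjNormal_apply]
    exact Subgroup.Normal.conj_mem inferInstance _ hx g
  have hFZ : ∀ x, F x ∈ Z.subgroupOf P := fun x => by
    rw [hF]
    exact prod_mem fun h _ => hcZ _ _ (hfZ _)
  have hFz : ∀ z ∈ Z.subgroupOf P, F z = z ^ Nat.card H := fun z hz => by
    rw [hF, Finset.prod_congr rfl (g := fun _ => z), Finset.prod_const, Finset.card_univ,
      Nat.card_eq_fintype_card]
    intro h _
    rw [hf _ (hcZ _ _ hz), ← MulAut.mul_apply, ← map_mul, mul_inv_cancel, map_one, MulAut.one_apply]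
  have hFc : ∀ (g : H) (x : P), F (c g x) = c g (F x) := fun g x => by
    rw [hF, hF, map_prod]
    refine Fintype.prod_equiv (Equiv.mulLeft g⁻¹) _ _ fun h => ?_
    simp only [Equiv.coe_mulLeft, Subgroup.coe_mul, Subgroup.coe_inv]
    rw [← MulAut.mul_apply, ← MulAut.mul_apply, ← map_mul, ← map_mul, mul_inv_cancel_left,
      mul_inv_rev, inv_inv]
  have hcopH : (Nat.card H).Coprime p := by
    rw [← hH.symm.index_eq_card]
    exact (hcop.coprime_dvd_left hpP).symm
  refine ⟨F.ker.map P.subtype, ⟨?_⟩, ?_, fun hbot => ?_⟩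
  · rintro _ ⟨x, hx, rfl⟩ g
    -- In `g = y h` the factor `y` acts trivially on the abelian group `P`, so equivariance under
    -- `H` suffices.
    obtain ⟨⟨⟨y, hy⟩, h⟩, rfl⟩ := hH.2 g
    refine ⟨c h x, ?_, ?_⟩
    · change F _ = 1
      rw [hFc, hx, map_one]
    · change ((c h x : P) : G) = y * h * x * (y * h)⁻¹
      have h1 : ((c h x : P) : G) = h * x * (h : G)⁻¹ := MulAut.conjNormal_apply _ _
      have h2 := hcomm y hy _ (c h x).2
      rw [h1] at h2 ⊢
      rw [mul_inv_rev, ← mul_assoc, mul_assoc y, mul_assoc y, h2]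
      group
  · rw [Subgroup.eq_bot_iff_forall]
    rintro _ ⟨⟨x, hx, rfl⟩, hxZ⟩
    have h1 : x ^ Nat.card H = 1 := by rw [← hFz x hxZ]; exact hx
    have h2 : x ^ p = 1 := Subtype.ext (hp x x.2)
    have : orderOf x ∣ 1 := by
      rw [← hcopH]
      exact Nat.dvd_gcd (orderOf_dvd_of_pow_eq_one h1) (orderOf_dvd_of_pow_eq_one h2)
    rw [orderOf_eq_one_iff.1 (Nat.dvd_one.1 this)]
    rfl
  · have hinj : Function.Injective F := by
      rw [← MonoidHom.ker_eq_bot_iff]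
      exact (Subgroup.map_eq_bot_iff_of_injective _ P.subtype_injective).1 hbot
    have hle : Nat.card P ≤ Nat.card Z :=
      Nat.card_le_card_of_injective (fun x => (⟨F x, hFZ x⟩ : Z)) fun x y hxy =>
        hinj (Subtype.ext (congrArg (fun z : Z => (z : G)) hxy))
    exact (Subgroup.eq_of_le_of_card_ge hZP hle).symm

/-- A central Sylow subgroup of its centralizer splits off as a normal subgroup. -/
theorem exists_normal_centralizer_complement {G : Type*} [Group G] [Finite G] {Z : Subgroup G}
    [Z.Normal] (hZ : Z ≤ Subgroup.centralizer (Z : Set G)) (hcop : (Nat.card Z).Coprime Z.index) :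
    ∃ K : Subgroup G, K.Normal ∧ K ⊓ Z = ⊥ ∧ (K = ⊥ → Subgroup.centralizer (Z : Set G) = Z) := by
  set C := Subgroup.centralizer (Z : Set G) with hC
  have hCn : C.Normal := inferInstance
  have hcard : Nat.card (Z.subgroupOf C) = Nat.card Z := by
    rw [← Subgroup.card_map_of_injective C.subtype_injective, Subgroup.subgroupOf_map_subtype,
      inf_eq_left.2 hZ]
  have hcop' : (Nat.card (Z.subgroupOf C)).Coprime (Z.subgroupOf C).index := by
    rw [hcard]
    exact hcop.coprime_dvd_right (Subgroup.relIndex_dvd_index_of_normal Z C)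
  obtain ⟨K, hK⟩ := Subgroup.exists_right_complement'_of_coprime hcop'
  have hKcard : (Nat.card Z).Coprime (Nat.card K) := by
    rw [← hK.symm.index_eq_card, ← hcard]
    exact hcop'
  refine ⟨K.map C.subtype, ⟨?_⟩, ?_, fun hbot => ?_⟩
  · rintro _ ⟨k, hk, rfl⟩ g
    have hgC : g * k * g⁻¹ ∈ C := hCn.conj_mem _ k.2 g
    -- A conjugate of an element of `K` has the form `z k'` with `z` and `k'` commuting. Its
    -- `|K|`-th power is trivial, so `z` has order dividing both `|K|` and `|Z|`.
    obtain ⟨⟨⟨z, hz⟩, ⟨k', hk'⟩⟩, hzk⟩ := hK.2 (⟨g * k * g⁻¹, hgC⟩ : C)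
    have hzk : z * k' = ⟨g * k * g⁻¹, hgC⟩ := hzk
    have hcomm : Commute z k' := Subtype.ext (k'.2 z hz)
    have hk1 : k ^ Nat.card K = 1 := congrArg Subtype.val (pow_card_eq_one' (x := (⟨k, hk⟩ : K)))
    have hk1' : k' ^ Nat.card K = 1 :=
      congrArg Subtype.val (pow_card_eq_one' (x := (⟨k', hk'⟩ : K)))
    have hz1 : z ^ Nat.card Z = 1 := by
      rw [← hcard]
      exact congrArg Subtype.val (pow_card_eq_one' (x := (⟨z, hz⟩ : Z.subgroupOf C)))
    have hz2 : z ^ Nat.card K = 1 := by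
      have h1 : (⟨g * k * g⁻¹, hgC⟩ : C) ^ Nat.card K = 1 := by
        refine Subtype.ext ?_
        change (g * k * g⁻¹) ^ Nat.card K = 1
        rw [conj_pow, ← Subgroup.coe_pow, hk1]
        simp
      rwa [← hzk, hcomm.mul_pow, hk1', mul_one] at h1
    have hz3 : z = 1 := by
      have : orderOf z ∣ 1 := by
        rw [← hKcard]
        exact Nat.dvd_gcd (orderOf_dvd_of_pow_eq_one hz1) (orderOf_dvd_of_pow_eq_one hz2)
      exact orderOf_eq_one_iff.1 (Nat.dvd_one.1 this)
    rw [hz3, one_mul] at hzk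
    exact ⟨k', hk', congrArg Subtype.val hzk⟩
  · have := hK.disjoint
    rw [Subgroup.eq_bot_iff_forall]
    rintro _ ⟨⟨x, hx, rfl⟩, hxZ⟩
    rw [Subgroup.disjoint_def] at this
    rw [this (x := x) hxZ hx]
    rfl
  · have hKb : K = ⊥ := (Subgroup.map_eq_bot_iff_of_injective _ C.subtype_injective).1 hbot
    rw [hKb] at hK
    have := Subgroup.isComplement'_bot_right.1 hK
    exact le_antisymm (Subgroup.subgroupOf_eq_top.1 this) hZ

end Splitting

/-! ### Embedding into products of groups of square-free order -/

section Embedding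

/-- If `q * q` divided the order, some element would have order `q * q`, impossible in a Sylow
subgroup of exponent `q`. -/
theorem squarefree_card_of_isCyclic {X : Type*} [Group X] [Finite X] [IsCyclic X]
    (h : HasElementaryAbelianSylows X) : Squarefree (Nat.card X) := by
  rw [Nat.squarefree_iff_prime_squarefree]
  intro q hq hd
  have := Fact.mk hq
  obtain ⟨g, hg⟩ := IsCyclic.exists_ofOrder_eq_natCard (α := X)
  obtain ⟨m, hm⟩ := hd
  have hm0 : m ≠ 0 := by
    rintro rfl
    exact Nat.card_pos.ne' hm
  have ho : orderOf (g ^ m) = q * q := by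
    rw [orderOf_pow' g hm0, hg, hm, Nat.gcd_eq_right (Dvd.intro_left _ rfl),
      Nat.mul_div_cancel _ (Nat.pos_of_ne_zero hm0)]
  have hz : IsPGroup q (Subgroup.zpowers (g ^ m)) := by
    apply IsPGroup.of_card (n := 2)
    rw [Nat.card_zpowers, ho, pow_two]
  obtain ⟨Q, hQ⟩ := hz.exists_le_sylow
  have h1 := (h ⟨q, hq⟩ Q).2 _ (hQ (Subgroup.mem_zpowers _))
  have h2 := Nat.le_of_dvd hq.pos (ho ▸ orderOf_dvd_of_pow_eq_one h1)
  have := hq.one_lt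
  nlinarith

/-- A supersolvable group with elementary abelian Sylow subgroups and a unique minimal normal
subgroup has square-free order. -/
theorem squarefree_card_of_unique_minimal {G : Type*} [Group G] [Finite G] (hs : IsSupersolvable G)
    (he : HasElementaryAbelianSylows G) {Z : Subgroup G} (hZn : Z.Normal) (hZ : (Nat.card Z).Prime)
    (hmin : ∀ K : Subgroup G, K.Normal → K ≠ ⊥ → Z ≤ K) : Squarefree (Nat.card G) := by
  have hdisj : ∀ K : Subgroup G, K.Normal → K ⊓ Z = ⊥ → K = ⊥ := fun K hK h => by
    by_contra hne
    rw [inf_eq_right.2 (hmin K hK hne)] at h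
    rw [h, Subgroup.card_bot] at hZ
    exact Nat.not_prime_one hZ
  set p := Nat.card Z with hp
  have := Fact.mk hZ
  have hpG : p ∣ Nat.card G := Z.card_subgroup_dvd_card
  obtain ⟨q, hq, hqmax⟩ := (Nat.card G).primeFactors.exists_max_image id
    ⟨p, Nat.mem_primeFactors.2 ⟨hZ, hpG, Nat.card_pos.ne'⟩⟩
  obtain ⟨hqp, hqG, -⟩ := Nat.mem_primeFactors.1 hq
  have := Fact.mk hqp
  obtain ⟨P⟩ : Nonempty (Sylow q G) := inferInstance
  have hPn : (P : Subgroup G).Normal := hs.sylow_normal hqp (fun ℓ hℓ hd =>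
    hqmax ℓ (Nat.mem_primeFactors.2 ⟨hℓ, hd, Nat.card_pos.ne'⟩)) P
  have hZP : Z ≤ P := hmin P hPn (P.ne_bot_of_dvd_card hqG)
  -- The Sylow subgroup for the largest prime `q` is normal, so it contains `Z`.
  obtain rfl : p = q := by
    obtain ⟨n, hn⟩ := P.2.exists_card_eq
    have hd : p ∣ q ^ n := hn ▸ Subgroup.card_dvd_of_le hZP
    exact (Nat.prime_dvd_prime_iff_eq hZ hqp).1 (hZ.dvd_of_dvd_pow hd)
  obtain ⟨hcomm, hexp⟩ := he ⟨p, hZ⟩ P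
  -- A nontrivial normal subgroup meeting `Z` trivially would contradict minimality; the same
  -- argument gives `hcent`.
  have hPZ : (P : Subgroup G) = Z := by
    obtain ⟨K, hK, hKZ, hKP⟩ := exists_normal_inf_eq_bot hZP hcomm hexp P.card_coprime_index
      (Subgroup.card_dvd_of_le hZP)
    exact hKP (hdisj K hK hKZ)
  have hcop : (Nat.card Z).Coprime Z.index := hPZ ▸ P.card_coprime_index
  have hcent : Subgroup.centralizer (Z : Set G) = Z := by
    obtain ⟨K, hK, hKZ, hKC⟩ := exists_normal_centralizer_complement (Z := Z)
      (fun x hx y hy => hcomm y (hZP hy) x (hZP hx)) hcop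
    exact hKC (hdisj K hK hKZ)
  let c : G →* MulAut Z := MulAut.conjNormal
  have hker : c.ker ≤ Z := fun g hg => by
    rw [← hcent]
    intro z hz
    have h1 : ((c g ⟨z, hz⟩ : Z) : G) = g * z * g⁻¹ := MulAut.conjNormal_apply _ _
    rw [MonoidHom.mem_ker.1 hg] at h1
    exact (mul_inv_eq_iff_eq_mul.1 h1.symm).symm
  have hcard : Nat.card G = Nat.card c.ker * Nat.card c.range := by
    rw [← c.ker.card_mul_index, Subgroup.index_ker]
  have hZc : IsCyclic Z := isCyclic_of_prime_card (p := p) rfl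
  -- The conjugation action has kernel inside `Z` and cyclic image in `Aut Z`, of order prime to
  -- `p`.
  have hdvd : Nat.card c.range ∣ p - 1 := by
    rw [← Nat.totient_prime hZ, hp, ← IsCyclic.card_mulAut]
    exact Subgroup.card_subgroup_dvd_card _
  have hcyc : IsCyclic c.range := by
    have : Fact (Nat.card Z).Prime := ⟨hZ⟩
    have : IsCyclic (MulAut Z) :=
      isCyclic_of_injective (IsCyclic.mulAutMulEquiv Z).toMonoidHom (IsCyclic.mulAutMulEquiv Z).injective
    infer_instance
  have hsq : Squarefree (Nat.card c.range) := squarefree_card_of_isCyclic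
    (he.of_surjective c.rangeRestrict c.rangeRestrict_surjective)
  have hkd : Nat.card c.ker ∣ p := Subgroup.card_dvd_of_le hker
  rw [hcard, Nat.squarefree_mul_iff]
  refine ⟨?_, hZ.squarefree.squarefree_of_dvd hkd, hsq⟩
  refine Nat.Coprime.coprime_dvd_left hkd ((Nat.Prime.coprime_iff_not_dvd hZ).2 fun h => ?_)
  have := Nat.le_of_dvd (Nat.sub_pos_of_lt hZ.one_lt) (h.trans hdvd)
  have := hZ.pos
  omega

/-- For `N` maximal among the normal subgroups avoiding `x`, every nontrivial normal subgroup of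
`G/N` contains the image of `x`. A normal subgroup of prime order is therefore contained in all of
them. -/
theorem exists_normal_squarefree_index {G : Type*} [Group G] [Finite G] (hs : IsSupersolvable G)
    (he : HasElementaryAbelianSylows G) {x : G} (hx : x ≠ 1) :
    ∃ N : Subgroup G, N.Normal ∧ x ∉ N ∧ Squarefree (Nat.card (G ⧸ N)) := by
  obtain ⟨N, ⟨hN, hxN⟩, hmax⟩ := (Set.toFinite {N : Subgroup G | N.Normal ∧ x ∉ N}).exists_maximal
    ⟨⊥, inferInstance, by simpa using hx⟩
  refine ⟨N, hN, hxN, ?_⟩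
  have hsurj := QuotientGroup.mk'_surjective N
  have hs' := hs.of_surjective _ hsurj
  have hx1 : QuotientGroup.mk' N x ≠ 1 := fun h => hxN ((QuotientGroup.eq_one_iff x).1 h)
  have hmem : ∀ K : Subgroup (G ⧸ N), K.Normal → K ≠ ⊥ → QuotientGroup.mk' N x ∈ K := by
    intro K hK hne
    by_contra hxK
    have hle : N ≤ K.comap (QuotientGroup.mk' N) := fun y hy => by
      change QuotientGroup.mk' N y ∈ K
      have hy1 : QuotientGroup.mk' N y = 1 := (QuotientGroup.eq_one_iff y).2 hy
      rw [hy1]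
      exact one_mem K
    have := hmax ⟨hK.comap _, hxK⟩ hle
    apply hne
    rw [Subgroup.eq_bot_iff_forall]
    intro y hy
    obtain ⟨y, rfl⟩ := hsurj y
    exact (QuotientGroup.eq_one_iff y).2 (this hy)
  have : Nontrivial (G ⧸ N) := ⟨_, _, hx1⟩
  obtain ⟨Z, hZn, hZ⟩ := hs'.exists_normal_prime_card
  refine squarefree_card_of_unique_minimal hs' (he.of_surjective _ hsurj) hZn hZ fun K hK hne => ?_
  have hxZ := hmem Z hZn fun h => by
    rw [h, Subgroup.card_bot] at hZ
    exact Nat.not_prime_one hZ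
  have hd : Nat.card (K ⊓ Z : Subgroup (G ⧸ N)) ∣ Nat.card Z := Subgroup.card_dvd_of_le inf_le_right
  rcases (Nat.dvd_prime hZ).1 hd with h1 | h1
  · have h2 : QuotientGroup.mk' N x ∈ K ⊓ Z := ⟨hmem K hK hne, hxZ⟩
    rw [Subgroup.card_eq_one.1 h1, Subgroup.mem_bot] at h2
    exact absurd h2 hx1
  · exact inf_eq_right.1 (Subgroup.eq_of_le_of_card_ge inf_le_right h1.ge)

theorem exists_embedding {G : Type u} [Group G] [Finite G] (hs : IsSupersolvable G)
    (he : HasElementaryAbelianSylows G) :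
    ∃ (r : ℕ) (Γ : Fin r → Type u) (_ : ∀ i, Group (Γ i)) (φ : G →* ∀ i, Γ i),
      (∀ i, Squarefree (Nat.card (Γ i))) ∧ Function.Injective φ := by
  choose N hN hxN hsq using fun x : {x : G // x ≠ 1} => exists_normal_squarefree_index hs he x.2
  let e := Finite.equivFin {x : G // x ≠ 1}
  refine ⟨_, fun i => G ⧸ N (e.symm i), fun i => inferInstance,
    MonoidHom.pi fun i => QuotientGroup.mk' (N (e.symm i)), fun i => hsq _, ?_⟩
  rw [injective_iff_map_eq_one]
  intro x hx
  by_contra hne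
  have h1 := congrFun hx (e ⟨x, hne⟩)
  have h2 : x ∈ N (e.symm (e ⟨x, hne⟩)) := (QuotientGroup.eq_one_iff x).1 h1
  rw [e.symm_apply_apply] at h2
  exact hxN _ h2

theorem ComplementedSeries.isSupersolvable {G : Type*} [Group G] [Finite G]
    (C : ComplementedSeries G) (h : ∀ t, ∀ g ∈ C.N t, g ∉ C.N (t + 1) →
      ∃ p : ℕ, p.Prime ∧ ∀ x ∈ C.N t, x ^ p ∈ C.N (t + 1)) : IsSupersolvable G := by
  refine isSupersolvable_of_series C.length (fun i => C.N (C.length - i)) ?_ ?_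
    (fun i => C.normal _) fun i hi => ?_
  · simpa using C.N_length
  · simpa using C.N_zero
  · obtain ⟨t, ht⟩ : ∃ t, t = C.length - (i + 1) := ⟨_, rfl⟩
    have ht' : C.length - i = t + 1 := by omega
    simp only [← ht, ht']
    have hle : C.N (t + 1) ≤ C.N t := C.antitone_N (Nat.le_succ t)
    refine ⟨hle, or_iff_not_imp_left.2 fun h1 => ?_⟩
    rw [Subgroup.relIndex_eq_one, SetLike.not_le_iff_exists] at h1
    obtain ⟨g, hg, hg'⟩ := h1
    obtain ⟨p, hp, hpow⟩ := h t g hg hg'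
    -- The subgroups `N (t + 1)` and `N t` differ exactly at position `t`.
    rw [relIndex_eq (C := C) hle (t := t) hp ?_ ?_ hpow]
    · exact hp
    · rintro ⟨x, hx, -, hx'⟩
      exact hx' hx
    · refine Set.Subset.antisymm (fun s hs => ?_)
        (Set.insert_subset ⟨g, hg, hg, hg'⟩ (J_mono hle))
      obtain ⟨x, hx, hxs, hxs'⟩ := hs
      rcases lt_trichotomy s t with hlt | rfl | hlt
      · exact absurd (C.antitone_N hlt hx) hxs'
      · exact Set.mem_insert _ _
      · exact Set.mem_insert_of_mem _ ⟨x, C.antitone_N hlt hxs, hxs, hxs'⟩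

variable {G : Type*} [Group G] {r : ℕ} {Γ : Fin r → Type*} [∀ i, Group (Γ i)]
  (hΓ : ∀ i, Squarefree (Nat.card (Γ i))) (φ : G →* ∀ i, Γ i) (hφ : Function.Injective φ)
include hΓ hφ

theorem isSupersolvable_of_injective [Finite G] : IsSupersolvable G := by
  obtain ⟨D⟩ := nonempty_labelingData hΓ
  refine ((D.series hΓ).comap φ hφ).isSupersolvable fun t g hg hg' => ?_
  obtain ⟨p, j, hp, rfl, -⟩ := exists_of_mem_productSeries (hΓ := hΓ) hg hg'
  refine ⟨p, hp, fun x hx => ?_⟩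
  change φ (x ^ p) ∈ productSeries hΓ (p * r + j + 1)
  rw [map_pow]
  exact pow_mem_productSeries hp hx

/-- In each coordinate the image of a Sylow subgroup is a `p`-subgroup of a group of square-free
order, hence cyclic and of exponent dividing `p`. -/
theorem hasElementaryAbelianSylows_of_injective : HasElementaryAbelianSylows G := by
  intro p P
  have := Fact.mk p.2
  have hfin : ∀ i, Finite (Γ i) := fun i => Nat.finite_of_card_ne_zero (hΓ i).ne_zero
  constructor
  · intro x hx y hy
    refine hφ (funext fun i => ?_)
    have : IsZGroup (Γ i) := IsZGroup.of_squarefree (hΓ i)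
    let f : G →* Γ i := (Pi.evalMonoidHom Γ i).comp φ
    have hcyc : IsCyclic ((P : Subgroup G).map f) := IsPGroup.isCyclic_of_isZGroup (P.2.map f)
    obtain ⟨g, hg⟩ := hcyc
    obtain ⟨m, hm⟩ := hg ⟨f x, x, hx, rfl⟩
    obtain ⟨n, hn⟩ := hg ⟨f y, y, hy, rfl⟩
    have h1 : (g : Γ i) ^ m = f x := congrArg Subtype.val hm
    have h2 : (g : Γ i) ^ n = f y := congrArg Subtype.val hn
    change f (x * y) = f (y * x)
    rw [map_mul, map_mul, ← h1, ← h2, ← zpow_add, ← zpow_add, add_comm]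
  · intro x hx
    obtain ⟨k, hk⟩ := P.2 ⟨x, hx⟩
    have hk : x ^ (p : ℕ) ^ k = 1 := congrArg Subtype.val hk
    apply hφ
    rw [map_pow, map_one]
    refine funext fun i => apply_pow_prime_eq_one hΓ p.2 (k := k) ?_ i
    rw [← map_pow, hk, map_one]

end Embedding

/-! ### Coset-shellability -/

/-- The coset poset is the proper part of the coset lattice. In the dual the least element is `G`
and the greatest is `∅`; the order complex ignores the reversal. -/
theorem isCosetShellable_of_isLocalEL {G : Type*} [Group G] [Finite G]
    {lab : (CosetLattice G)ᵒᵈ → (CosetLattice G)ᵒᵈ → ℤ} (h : IsLocalEL lab) :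
    IsCosetShellable G := by
  have huniv : ∀ x : G, rightCoset ⊤ x = Set.univ := fun x =>
    Set.eq_univ_of_forall fun y => mem_rightCoset_iff_mul_inv.2 trivial
  let _ : BoundedOrder (CosetLattice G)ᵒᵈ :=
    { top := OrderDual.toDual (emptyCoset G)
      le_top := fun a => emptyCoset_le (OrderDual.ofDual a)
      bot := OrderDual.toDual (toCosetLattice ⊤ 1)
      bot_le := fun a => by
        change (OrderDual.ofDual a).1 ⊆ rightCoset ⊤ 1
        rw [huniv]
        exact Set.subset_univ _ }
  have hbot : ∀ z : CosetLattice G, OrderDual.toDual z = ⊥ ↔ z.1 = Set.univ := fun z => by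
    rw [← huniv 1]
    exact Subtype.ext_iff
  have htop : ∀ z : CosetLattice G, OrderDual.toDual z = ⊤ ↔ z.1 = ∅ := fun z => Subtype.ext_iff
  refine h.isShellablePoset (Q := CosetPoset G)
    (fun q => OrderDual.toDual ⟨q.1, Or.inr (by obtain ⟨H, x, -, h⟩ := q.2; exact ⟨H, x, h⟩)⟩)
    (fun a b hab => Subtype.ext (congrArg (fun c => (OrderDual.ofDual c).1) hab)) (fun z => ?_)
    fun a b => or_comm
  induction z using OrderDual.rec with | toDual z
  rw [Ne, Ne, hbot, htop]
  constructor
  · rintro ⟨⟨S, H, x, hH, rfl⟩, hq⟩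
    obtain rfl := OrderDual.toDual.injective hq
    refine ⟨fun h => hH (eq_top_iff.2 fun g _ => ?_), ?_⟩
    · have : g * x ∈ rightCoset H x := by
        change rightCoset H x = Set.univ at h
        rw [h]
        trivial
      simpa [mem_rightCoset_iff_mul_inv] using this
    · exact (Set.nonempty_iff_ne_empty.1 ⟨x, self_mem_rightCoset H x⟩)
  · rintro ⟨h1, h2⟩
    obtain ⟨H, x, hz⟩ := z.2.resolve_left h2
    refine ⟨⟨z.1, H, x, ?_, hz⟩, rfl⟩
    rintro rfl
    exact h1 (hz.trans (huniv x))

theorem mainTheorem3 (G : Type u) [Group G] [Finite G] :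
    -- the two descriptions of the class of groups agree
    ((IsSupersolvable G ∧ HasElementaryAbelianSylows G) ↔
      ∃ (r : ℕ) (Γ : Fin r → Type u) (_ : ∀ i, Group (Γ i)) (φ : G →* ∀ i, Γ i),
        (∀ i, Squarefree (Nat.card (Γ i))) ∧ Function.Injective φ) ∧
    -- the explicit labeling, for every embedding and every choice made in its construction
    (∀ (r : ℕ) (Γ : Fin r → Type v) [∀ i, Group (Γ i)] (φ : G →* ∀ i, Γ i),
      (∀ i, Squarefree (Nat.card (Γ i))) → Function.Injective φ →
        Nonempty (LabelingData Γ) ∧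
          ∀ D : LabelingData Γ, IsCoELLabeling (P := CosetLattice G) (D.labelVia φ)) ∧
    -- coEL-shellability and coset-shellability
    (IsSupersolvable G → HasElementaryAbelianSylows G →
      IsCoELShellable (CosetLattice G) ∧ IsCosetShellable G) := by
  have : Finite (CosetLattice G)ᵒᵈ := inferInstanceAs (Finite (CosetLattice G))
  refine ⟨⟨fun h => exists_embedding h.1 h.2, ?_⟩, ?_, fun hs he => ?_⟩
  · rintro ⟨r, Γ, _, φ, hΓ, hφ⟩
    exact ⟨isSupersolvable_of_injective hΓ φ hφ, hasElementaryAbelianSylows_of_injective hΓ φ hφ⟩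
  · intro r Γ _ φ hΓ hφ
    exact ⟨nonempty_labelingData hΓ, fun D => (D.isLocalEL hΓ φ hφ).isELLabeling⟩
  · obtain ⟨r, Γ, _, φ, hΓ, hφ⟩ := exists_embedding hs he
    obtain ⟨D⟩ := nonempty_labelingData hΓ
    have h := D.isLocalEL hΓ φ hφ
    exact ⟨⟨D.labelVia φ, h.isELLabeling⟩, isCosetShellable_of_isLocalEL h⟩
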